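/- Fix a countably saturated nonstandard universe (Transfer holds, and every countable family of internal sets with the finite intersection property has a common element), and let ${}^*\mathbb N$ be its set of hypernatural numbers. *Borel* subsets of ${}^*\mathbb N$ (of ${}^*\mathbb N\times{}^*\mathbb N$) are the members of the least $\sigma$-algebra containing all internal subsets; a map is Borel if its graph is. For $X,Y\subseteq{}^*\mathbb N$ write $X\le_B Y$ if there is a Borel injection $X\to Y$, $X\equiv_B Y$ if $X\le_B Y\le_B X$, and $X<_B Y$ if $X\le_B Y\not\le_B X$. A *cut* is an initial segment of ${}^*\mathbb N$ (including $\varnothing$ and ${}^*\mathbb N$); it is *additive* if it is closed under $+$. A Borel cut $U$ is *minimal* if $V\not\equiv_B U$ for every cut $V\subsetneq U$. For $c\in{}^*\mathbb N\setminus\mathbb N$ and a standard real $r>0$ let $\widetilde U_{cr}$ be the set of all $x$ for which there is $y$ with $x<y\le\lfloor cr\rfloor$ and $x/y\not\simeq 1$. For $c\in{}^*\mathbb N$ put $c/\mathbb N=\{x:\ nx\le c\text{ for all }n\in\mathbb N\}$ and $c\mathbb N=\{x:\ x\le nc\text{ for some }n\in\mathbb N\}$. Then: 1. For every Borel set $X\subseteq{}^*\mathbb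 N$ there is a minimal Borel cut $U$ with $X\equiv_B U$; moreover there is a Borel bijection of $X$ onto $U$, $U$ is contained in every Borel cut $V$ with $X\equiv_B V$, and $U$ is the only minimal Borel cut with $X\equiv_B U$. 2. For any two Borel sets $X,Y\subseteq{}^*\mathbb N$, $X\le_B Y$ or $Y\le_B X$. 3. (Classification of Borel cardinalities.) A set $U\subseteq{}^*\mathbb N$ is a minimal Borel cut if and only if it is an additive Borel cut, or $U=[0,n)$ for some $n\in\mathbb N$, or $U=\widetilde U_{cr}$ for some $c\in{}^*\mathbb N\setminus\mathbb N$ and some real $r>0$. If a minimal Borel cut $U$ is not additive, there is $c\in U$ with $2c\notin U$ and $c/\mathbb N<_B U<_B c\mathbb N$. For each $c\in{}^*\mathbb N\setminus\mathbb N$, the minimal Borel cuts $U$ with $c/\mathbb N<_B U<_B c\mathbb N$ are exactly the sets $\widetilde U_{cr}$ with $r>0$ real, and $\widetilde U_{cr}\ne\widetilde U_{cr'}$ whenever $r\ne r'$. -/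

import Mathlib

universe u

/-- The finite types over the natural numbers: `ℕ`, products, and power sets. -/
inductive FinType : Type
  | nat : FinType
  | prod : FinType → FinType → FinType
  | pow : FinType → FinType
  deriving DecidableEq

namespace FinType

/-- The standard objects of a given finite type. -/
def Carrier : FinType → Type
  | nat => ℕ
  | prod σ τ => Carrier σ × Carrier τ
  | pow σ => Set (Carrier σ)

def default : (σ : FinType) → Carrier σ
  | nat => (0 : ℕ)
  | prod σ τ => (default σ, default τ)
  | pow σ => (∅ : Set (Carrier σ))

end FinType

open FinType in
/-- A structure for the typed language of sets: objects of every finite type over `ℕ`,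
a membership relation, and ordered pairs. -/
structure TypedStructure where
  Obj : FinType → Type u
  Mem : ∀ {σ : FinType}, Obj σ → Obj (pow σ) → Prop
  pair : ∀ {σ τ : FinType}, Obj σ → Obj τ → Obj (prod σ τ)

/-- The standard universe: all sets of finite type over `ℕ`. -/
def standardUniverse : TypedStructure.{0} where
  Obj := FinType.Carrier
  Mem := fun {σ} (x : σ.Carrier) (A : Set σ.Carrier) => x ∈ A
  pair := fun {σ τ} (x : σ.Carrier) (y : τ.Carrier) => ((x, y) : σ.Carrier × τ.Carrier)

/-- Terms of the typed language: variables of each type, and pairs. -/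
inductive TypedTerm : FinType → Type
  | var (σ : FinType) (i : ℕ) : TypedTerm σ
  | pair {σ τ : FinType} : TypedTerm σ → TypedTerm τ → TypedTerm (FinType.prod σ τ)

/-- First-order formulas of the typed language; every quantifier ranges over the objects of one
type (so these are formulas with bounded quantifiers over the whole universe). -/
inductive TypedFormula : Type
  | eq {σ : FinType} : TypedTerm σ → TypedTerm σ → TypedFormula
  | mem {σ : FinType} : TypedTerm σ → TypedTerm (FinType.pow σ) → TypedFormula
  | neg : TypedFormula → TypedFormula
  | and : TypedFormula → TypedFormula → TypedFormula
  | ex (σ : FinType) (i : ℕ) : TypedFormula → TypedFormula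

namespace TypedStructure

/-- Assignments of objects to the variables (`i`-th variable of type `σ`). -/
abbrev Assignment (M : TypedStructure.{u}) : Type u := (σ : FinType) → ℕ → M.Obj σ

/-- Change the value of the `i`-th variable of type `σ` to `a`. -/
def update (M : TypedStructure.{u}) (v : M.Assignment) (σ : FinType) (i : ℕ) (a : M.Obj σ) :
    M.Assignment :=
  fun τ j => if h : σ = τ ∧ i = j then h.1 ▸ a else v τ j

theorem update_self (M : TypedStructure.{u}) (v : M.Assignment) (σ : FinType) (i : ℕ)
    (a : M.Obj σ) : M.update v σ i a σ i = a := by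
  simp [update]

theorem update_of_ne (M : TypedStructure.{u}) (v : M.Assignment) (σ τ : FinType) {i j : ℕ}
    (hij : i ≠ j) (a : M.Obj σ) : M.update v σ i a τ j = v τ j := by
  simp [update, hij]

/-- The value of a term. -/
def eval (M : TypedStructure.{u}) (v : M.Assignment) : {σ : FinType} → TypedTerm σ → M.Obj σ
  | _, .var σ i => v σ i
  | _, .pair s t => M.pair (M.eval v s) (M.eval v t)

/-- Tarski's satisfaction relation. -/
def Sat (M : TypedStructure.{u}) : TypedFormula → M.Assignment → Prop
  | .eq s t, v => M.eval v s = M.eval v t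
  | .mem s t, v => M.Mem (M.eval v s) (M.eval v t)
  | .neg φ, v => ¬ M.Sat φ v
  | .and φ ψ, v => M.Sat φ v ∧ M.Sat ψ v
  | .ex σ i φ, v => ∃ a : M.Obj σ, M.Sat φ (M.update v σ i a)

/-- The formula "for every `x` there is `y` with `(x, y) ∈ G`". -/
theorem sat_total (M : TypedStructure.{u}) (σ τ : FinType) (v : M.Assignment) :
    M.Sat (.neg (.ex σ 1 (.neg (.ex τ 2 (.mem (.pair (.var σ 1) (.var τ 2))
      (.var (FinType.pow (FinType.prod σ τ)) 0)))))) v ↔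
      ∀ x : M.Obj σ, ∃ y : M.Obj τ, M.Mem (M.pair x y) (v (FinType.pow (FinType.prod σ τ)) 0) := by
  have h10 : (1 : ℕ) ≠ 0 := by decide
  have h20 : (2 : ℕ) ≠ 0 := by decide
  have h21 : (2 : ℕ) ≠ 1 := by decide
  simp only [Sat, eval, update_self, update_of_ne _ _ _ _ h10, update_of_ne _ _ _ _ h20,
    update_of_ne _ _ _ _ h21]
  push Not
  rfl

end TypedStructure

/-- A countably saturated nonstandard universe over `ℕ`: internal objects of every finite type,
with a map `star` from the standard objects for which Transfer holds, and such that every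
countable family of internal sets with the finite intersection property has a common element. -/
structure NonstandardUniverse extends TypedStructure.{u} where
  star : ∀ {σ : FinType}, σ.Carrier → Obj σ
  transfer : ∀ (φ : TypedFormula) (v : standardUniverse.Assignment),
    standardUniverse.Sat φ v ↔ toTypedStructure.Sat φ (fun σ i => star (v σ i))
  saturation : ∀ {σ : FinType} (A : ℕ → Obj (FinType.pow σ)),
    (∀ n : ℕ, ∃ x : Obj σ, ∀ k ≤ n, Mem x (A k)) → ∃ x : Obj σ, ∀ k : ℕ, Mem x (A k)

namespace NonstandardUniverse

open FinType

noncomputable section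

variable (N : NonstandardUniverse.{u})

/-- The hypernatural numbers. -/
abbrev HNat : Type u := N.Obj nat

/-- The star of a natural number. -/
def ofNat (n : ℕ) : N.HNat := N.star (σ := nat) n

/-- The star of a standard set. -/
def starSet {σ : FinType} (A : Set σ.Carrier) : N.Obj (pow σ) := N.star (σ := pow σ) A

/-- The graph of a standard function. -/
def stdGraph {σ τ : FinType} (g : σ.Carrier → τ.Carrier) : Set (prod σ τ).Carrier :=
  {p : σ.Carrier × τ.Carrier | p.2 = g p.1}

theorem exists_starFun {σ τ : FinType} (g : σ.Carrier → τ.Carrier) (x : N.Obj σ) :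
    ∃ y : N.Obj τ, N.Mem (N.pair x y) (N.starSet (stdGraph g)) := by
  obtain ⟨v, hv⟩ : ∃ v : standardUniverse.Assignment, v (pow (prod σ τ)) 0 = stdGraph g :=
    ⟨_, TypedStructure.update_self standardUniverse (fun σ _ => FinType.default σ) _ 0 _⟩
  have h := (N.transfer _ v).1 ((TypedStructure.sat_total standardUniverse σ τ v).2
    (fun a => ⟨g a, by rw [hv]; rfl⟩))
  rw [TypedStructure.sat_total, hv] at h
  exact h x

/-- The star-extension of a standard function (its graph is the star of the standard graph). -/
def starFun {σ τ : FinType} (g : σ.Carrier → τ.Carrier) (x : N.Obj σ) : N.Obj τ :=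
  Classical.choose (N.exists_starFun g x)

def add (x y : N.HNat) : N.HNat :=
  N.starFun (σ := prod nat nat) (τ := nat) (fun p : ℕ × ℕ => (p.1 + p.2 : ℕ)) (N.pair x y)

def mul (x y : N.HNat) : N.HNat :=
  N.starFun (σ := prod nat nat) (τ := nat) (fun p : ℕ × ℕ => (p.1 * p.2 : ℕ)) (N.pair x y)

def le (x y : N.HNat) : Prop :=
  N.Mem (N.pair x y) (N.starSet (σ := prod nat nat) {p : ℕ × ℕ | p.1 ≤ p.2})

def lt (x y : N.HNat) : Prop :=
  N.Mem (N.pair x y) (N.starSet (σ := prod nat nat) {p : ℕ × ℕ | p.1 < p.2})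

/-- `c ∈ *ℕ ∖ ℕ`. -/
def IsNonstandard (c : N.HNat) : Prop := ∀ n : ℕ, c ≠ N.ofNat n

/-- The set of elements of an internal set. -/
def elems {σ : FinType} (a : N.Obj (pow σ)) : Set (N.Obj σ) := {x | N.Mem x a}

/-- Borel sets of type `σ`: the least σ-algebra containing all internal sets. -/
def IsBorel {σ : FinType} (X : Set (N.Obj σ)) : Prop :=
  @MeasurableSet _ (MeasurableSpace.generateFrom (Set.range (N.elems (σ := σ)))) X

/-- The graph of `f` restricted to `X`. -/
def graphOn (f : N.HNat → N.HNat) (X : Set N.HNat) : Set (N.Obj (prod nat nat)) :=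
  {p | ∃ x ∈ X, p = N.pair x (f x)}

/-- `X ≤_B Y`: there is a Borel injection `X → Y`. -/
def BorelLE (X Y : Set N.HNat) : Prop :=
  ∃ f : N.HNat → N.HNat, Set.MapsTo f X Y ∧ Set.InjOn f X ∧ N.IsBorel (N.graphOn f X)

/-- `X ≡_B Y`. -/
def BorelEquiv (X Y : Set N.HNat) : Prop := N.BorelLE X Y ∧ N.BorelLE Y X

/-- `X <_B Y`. -/
def BorelLT (X Y : Set N.HNat) : Prop := N.BorelLE X Y ∧ ¬ N.BorelLE Y X

/-- There is a Borel bijection of `X` onto `Y`. -/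
def BorelBijective (X Y : Set N.HNat) : Prop :=
  ∃ f : N.HNat → N.HNat, Set.BijOn f X Y ∧ N.IsBorel (N.graphOn f X)

/-- Cuts are the initial segments of `*ℕ`. -/
def IsCut (U : Set N.HNat) : Prop := ∀ x ∈ U, ∀ y, N.le y x → y ∈ U

def IsBorelCut (U : Set N.HNat) : Prop := N.IsCut U ∧ N.IsBorel U

/-- A Borel cut `U` is minimal if no cut `V ⊊ U` satisfies `V ≡_B U`. -/
def IsMinimalBorelCut (U : Set N.HNat) : Prop :=
  N.IsBorelCut U ∧ ∀ V, N.IsCut V → V ⊂ U → ¬ N.BorelEquiv V U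

def IsAdditive (U : Set N.HNat) : Prop := ∀ x ∈ U, ∀ y ∈ U, N.add x y ∈ U

/-- The cut `[0, c)`. -/
def below (c : N.HNat) : Set N.HNat := {x | N.lt x c}

/-- The cut `c/ℕ`, i.e. the intersection of the segments `[0, c/n]`. -/
def divNat (c : N.HNat) : Set N.HNat := {x | ∀ n : ℕ, N.le (N.mul (N.ofNat n) x) c}

/-- The cut `cℕ`, i.e. the union of the segments `[0, cn]`. -/
def mulNat (c : N.HNat) : Set N.HNat := {x | ∃ n : ℕ, N.le x (N.mul (N.ofNat n) c)}

/-- For `y > 0`: the quotient `x / y` is infinitely close to `1`, i.e. `n * |x - y| ≤ y` for all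
standard `n`. -/
def QuotNearOne (x y : N.HNat) : Prop :=
  ∀ n : ℕ, N.le (N.mul (N.ofNat n) x) (N.add (N.mul (N.ofNat n) y) y) ∧
    N.le (N.mul (N.ofNat n) y) (N.add (N.mul (N.ofNat n) x) y)

/-- The set of all `x ∈ U` for which some `y ∈ U`, `y > x`, has `x / y` not infinitely close
to `1`. -/
def reduced (U : Set N.HNat) : Set N.HNat :=
  {x | x ∈ U ∧ ∃ y ∈ U, N.lt x y ∧ ¬ N.QuotNearOne x y}

/-- The internal integer part of `c * r`, for a standard real `r ≥ 0`. -/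
def floorMul (c : N.HNat) (r : ℝ) : N.HNat :=
  N.starFun (σ := nat) (τ := nat) (fun n : ℕ => (⌊(n : ℝ) * r⌋₊ : ℕ)) c

/-- The reduction of the segment `[0, ⌊c r⌋]`. -/
def realCut (c : N.HNat) (r : ℝ) : Set N.HNat :=
  N.reduced {x | N.le x (N.floorMul c r)}

end

end NonstandardUniverse

/-!
By Transfer, an internal object is the germ of a function on standard objects along an ultrafilter.
So `*ℕ` is an ordered semiring, every internal set with at most `d` elements has an internal
cardinality in `*ℕ`, and statements of this kind can be checked pointwise along the ultrafilter.

An infinite Borel set `X` is measured from the inside by the cut `U` of all `x` such that some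
internal subset of `X` has `x + 1` elements. As in the construction of Loeb measure, saturation
shows that a Borel set without internal subsets of more than `d` elements is covered, for each
standard `n`, by an internal set of at most `(1 + 1/n) d` elements. If `U` is additive, it follows
that `X` and `U` embed in each other by countably many internal partial bijections. If `U` is not
additive, choose `c ∈ U` with `2c ∉ U`. The position of `U` among the real multiples of `c`
determines a real `r > 0`, and `X` lies in cardinality between the sets `{x | st (x/c) < r}` and
`{x | st (x/c) ≤ r}`. These are equivalent: the monads of `cr, cr/2, cr/4, …` embed in one another,
which leaves room for a Hilbert hotel. The first of the two sets is the reduction `N.realCut c r`.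

The cuts obtained in this way are minimal. By the covering theorem, the domain of a Borel injection
into `[0, u)` is covered by an internal set of `(1 + 1/n) u` elements, while for each `u` in one of
these cuts the cut contains some `[0, w)` with `(1 + 1/n) u < w` for a standard `n`.
-/

namespace TypedFormula

/-- Universal quantification, as an abbreviation in the typed language. -/
def all (σ : FinType) (i : ℕ) (φ : TypedFormula) : TypedFormula := .neg (.ex σ i (.neg φ))

/-- Implication, as an abbreviation in the typed language. -/
def imp (φ ψ : TypedFormula) : TypedFormula := .neg (.and φ (.neg ψ))

end TypedFormula

namespace TypedStructure

variable (M : TypedStructure.{u}) {σ τ : FinType} (v : M.Assignment)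

theorem sat_all (i : ℕ) (φ : TypedFormula) :
    M.Sat (.all σ i φ) v ↔ ∀ a : M.Obj σ, M.Sat φ (M.update v σ i a) := by
  simp [TypedFormula.all, Sat]

theorem sat_imp (φ ψ : TypedFormula) : M.Sat (.imp φ ψ) v ↔ (M.Sat φ v → M.Sat ψ v) := by
  simp [TypedFormula.imp, Sat]

theorem sat_neg (φ : TypedFormula) : M.Sat (.neg φ) v ↔ ¬ M.Sat φ v := Iff.rfl

theorem sat_mem (s : TypedTerm σ) (t : TypedTerm (FinType.pow σ)) :
    M.Sat (.mem s t) v ↔ M.Mem (M.eval v s) (M.eval v t) := Iff.rfl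

theorem sat_eq (s t : TypedTerm σ) : M.Sat (.eq s t) v ↔ M.eval v s = M.eval v t := Iff.rfl

theorem eval_var (i : ℕ) : M.eval v (.var σ i) = v σ i := rfl

theorem eval_pair (s : TypedTerm σ) (t : TypedTerm τ) :
    M.eval v (.pair s t) = M.pair (M.eval v s) (M.eval v t) := rfl

theorem exists_assignment_eq {σ₀ σ₁ σ₂ : FinType} (a : σ₀.Carrier) (b : σ₁.Carrier)
    (c : σ₂.Carrier) : ∃ v : standardUniverse.Assignment, v σ₀ 0 = a ∧ v σ₁ 1 = b ∧ v σ₂ 2 = c :=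
  ⟨standardUniverse.update (standardUniverse.update (standardUniverse.update
    (fun σ _ => FinType.default σ) σ₀ 0 a) σ₁ 1 b) σ₂ 2 c,
    (update_of_ne _ _ _ _ (by decide) _).trans
      ((update_of_ne _ _ _ _ (by decide) _).trans (update_self _ _ _ _ _)),
    (update_of_ne _ _ _ _ (by decide) _).trans (update_self _ _ _ _ _),
    update_self _ _ _ _ _⟩

end TypedStructure

namespace NonstandardUniverse

open FinType TypedStructure

variable (N : NonstandardUniverse.{u}) {σ τ ρ : FinType}

theorem mem_starSet_of_forall {A B C : Set σ.Carrier} (h : ∀ x, x ∈ A → x ∈ B → x ∈ C)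
    (x : N.Obj σ) (hA : N.Mem x (N.starSet A)) (hB : N.Mem x (N.starSet B)) :
    N.Mem x (N.starSet C) := by
  obtain ⟨v, h₀, h₁, h₂⟩ := exists_assignment_eq (σ₀ := pow σ) (σ₁ := pow σ) (σ₂ := pow σ) A B C
  have key := N.transfer (.all σ 3 (.imp (.mem (.var σ 3) (.var (pow σ) 0))
    (.imp (.mem (.var σ 3) (.var (pow σ) 1)) (.mem (.var σ 3) (.var (pow σ) 2))))) v
  simp +decide only [sat_all, sat_imp, sat_mem, eval_var, update_self, update_of_ne,
    h₀, h₁, h₂] at key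
  exact key.1 h x hA hB

theorem mem_starSet_compl (A : Set σ.Carrier) (x : N.Obj σ) :
    N.Mem x (N.starSet Aᶜ) ↔ ¬ N.Mem x (N.starSet A) := by
  obtain ⟨v, h₀, h₁, -⟩ := exists_assignment_eq (σ₀ := pow σ) (σ₁ := pow σ) (σ₂ := pow σ) A
    (Aᶜ : Set σ.Carrier) A
  have disjoint := N.transfer (.all σ 3 (.imp (.mem (.var σ 3) (.var (pow σ) 1))
    (.neg (.mem (.var σ 3) (.var (pow σ) 0))))) v
  have cover := N.transfer (.all σ 3 (.imp (.neg (.mem (.var σ 3) (.var (pow σ) 0)))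
    (.mem (.var σ 3) (.var (pow σ) 1)))) v
  simp +decide only [sat_all, sat_imp, sat_mem, sat_neg, eval_var, update_self, update_of_ne,
    h₀, h₁] at disjoint cover
  exact ⟨disjoint.1 (fun _ h => h) x, cover.1 (fun _ h => h) x⟩

theorem mem_starSet_of_pair_mem {Γ : Set (prod σ τ).Carrier} {A : Set σ.Carrier}
    {B : Set τ.Carrier} (h : ∀ (x : σ.Carrier) (y : τ.Carrier), (x, y) ∈ Γ → x ∈ A → y ∈ B)
    {x : N.Obj σ} {y : N.Obj τ} (hΓ : N.Mem (N.pair x y) (N.starSet Γ))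
    (hA : N.Mem x (N.starSet A)) : N.Mem y (N.starSet B) := by
  obtain ⟨v, h₀, h₁, h₂⟩ := exists_assignment_eq (σ₀ := pow (prod σ τ)) (σ₁ := pow σ)
    (σ₂ := pow τ) Γ A B
  have key := N.transfer (.all σ 3 (.all τ 4 (.imp
    (.mem (.pair (.var σ 3) (.var τ 4)) (.var (pow (prod σ τ)) 0)) (.imp
    (.mem (.var σ 3) (.var (pow σ) 1)) (.mem (.var τ 4) (.var (pow τ) 2)))))) v
  simp +decide only [sat_all, sat_imp, sat_mem, eval_var, eval_pair, update_self, update_of_ne,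
    h₀, h₁, h₂] at key
  exact key.1 h x y hΓ hA

theorem starSet_stdGraph_unique (f : σ.Carrier → τ.Carrier) {x : N.Obj σ} {y z : N.Obj τ}
    (hy : N.Mem (N.pair x y) (N.starSet (stdGraph f)))
    (hz : N.Mem (N.pair x z) (N.starSet (stdGraph f))) : y = z := by
  obtain ⟨v, h₀, -, -⟩ := exists_assignment_eq (σ₀ := pow (prod σ τ)) (σ₁ := nat) (σ₂ := nat)
    (stdGraph f) (0 : ℕ) (0 : ℕ)
  have key := N.transfer (.all σ 3 (.all τ 4 (.all τ 5 (.imp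
    (.mem (.pair (.var σ 3) (.var τ 4)) (.var (pow (prod σ τ)) 0)) (.imp
    (.mem (.pair (.var σ 3) (.var τ 5)) (.var (pow (prod σ τ)) 0))
    (.eq (.var τ 4) (.var τ 5))))))) v
  simp +decide only [sat_all, sat_imp, sat_mem, sat_eq, eval_var, eval_pair, update_self,
    update_of_ne, h₀] at key
  exact key.1 (fun _ _ _ hb hc => hb.trans hc.symm) x y z hy hz

theorem pair_mem_starSet_stdGraph_prodMk (f : σ.Carrier → τ.Carrier) (g : σ.Carrier → ρ.Carrier)
    {x : N.Obj σ} {y : N.Obj τ} {z : N.Obj ρ} (hy : N.Mem (N.pair x y) (N.starSet (stdGraph f)))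
    (hz : N.Mem (N.pair x z) (N.starSet (stdGraph g))) :
    N.Mem (N.pair x (N.pair y z))
      (N.starSet (stdGraph (σ := σ) (τ := prod τ ρ) fun i => (f i, g i))) := by
  obtain ⟨v, h₀, h₁, h₂⟩ := exists_assignment_eq (σ₀ := pow (prod σ τ)) (σ₁ := pow (prod σ ρ))
    (σ₂ := pow (prod σ (prod τ ρ))) (stdGraph f) (stdGraph g)
    (stdGraph (σ := σ) (τ := prod τ ρ) fun i => (f i, g i))
  have key := N.transfer (.all σ 3 (.all τ 4 (.all ρ 5 (.imp
    (.mem (.pair (.var σ 3) (.var τ 4)) (.var (pow (prod σ τ)) 0)) (.imp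
    (.mem (.pair (.var σ 3) (.var ρ 5)) (.var (pow (prod σ ρ)) 1))
    (.mem (.pair (.var σ 3) (.pair (.var τ 4) (.var ρ 5)))
      (.var (pow (prod σ (prod τ ρ))) 2))))))) v
  simp +decide only [sat_all, sat_imp, sat_mem, eval_var, eval_pair, update_self, update_of_ne,
    h₀, h₁, h₂] at key
  exact key.1 (fun _ _ _ hb hc => Prod.ext hb hc) x y z hy hz

theorem pair_mem_starSet_stdGraph_comp (f : σ.Carrier → τ.Carrier) (g : τ.Carrier → ρ.Carrier)
    {x : N.Obj σ} {y : N.Obj τ} {z : N.Obj ρ} (hy : N.Mem (N.pair x y) (N.starSet (stdGraph f)))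
    (hz : N.Mem (N.pair y z) (N.starSet (stdGraph g))) :
    N.Mem (N.pair x z) (N.starSet (stdGraph fun i => g (f i))) := by
  obtain ⟨v, h₀, h₁, h₂⟩ := exists_assignment_eq (σ₀ := pow (prod σ τ)) (σ₁ := pow (prod τ ρ))
    (σ₂ := pow (prod σ ρ)) (stdGraph f) (stdGraph g) (stdGraph fun i => g (f i))
  have key := N.transfer (.all σ 3 (.all τ 4 (.all ρ 5 (.imp
    (.mem (.pair (.var σ 3) (.var τ 4)) (.var (pow (prod σ τ)) 0)) (.imp
    (.mem (.pair (.var τ 4) (.var ρ 5)) (.var (pow (prod τ ρ)) 1))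
    (.mem (.pair (.var σ 3) (.var ρ 5)) (.var (pow (prod σ ρ)) 2))))))) v
  simp +decide only [sat_all, sat_imp, sat_mem, eval_var, eval_pair, update_self, update_of_ne,
    h₀, h₁, h₂] at key
  exact key.1 (fun _ _ _ hb hc => hc.trans (congrArg g hb)) x y z hy hz

theorem pair_mem_starSet_stdGraph_id (x y : N.Obj σ) :
    N.Mem (N.pair x y) (N.starSet (stdGraph (σ := σ) (τ := σ) fun i => i)) ↔ y = x := by
  obtain ⟨v, h₀, -, -⟩ := exists_assignment_eq (σ₀ := pow (prod σ σ)) (σ₁ := nat) (σ₂ := nat)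
    (stdGraph (σ := σ) (τ := σ) fun i => i) (0 : ℕ) (0 : ℕ)
  have sound := N.transfer (.all σ 3 (.all σ 4 (.imp
    (.mem (.pair (.var σ 3) (.var σ 4)) (.var (pow (prod σ σ)) 0))
    (.eq (.var σ 4) (.var σ 3))))) v
  have refl := N.transfer
    (.all σ 3 (.mem (.pair (.var σ 3) (.var σ 3)) (.var (pow (prod σ σ)) 0))) v
  simp +decide only [sat_all, sat_imp, sat_mem, sat_eq, eval_var, eval_pair, update_self,
    update_of_ne, h₀] at sound refl
  exact ⟨sound.1 (fun _ _ h => h) x y, fun h => h ▸ refl.1 (fun _ => rfl) y⟩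

theorem pair_star_mem_starSet_stdGraph_const (a : τ.Carrier) (x : N.Obj σ) :
    N.Mem (N.pair x (N.star a)) (N.starSet (stdGraph (σ := σ) fun _ => a)) := by
  obtain ⟨v, h₀, h₁, -⟩ := exists_assignment_eq (σ₀ := pow (prod σ τ)) (σ₁ := τ) (σ₂ := nat)
    (stdGraph (σ := σ) fun _ => a) a (0 : ℕ)
  have key := N.transfer
    (.all σ 3 (.mem (.pair (.var σ 3) (.var τ 1)) (.var (pow (prod σ τ)) 0))) v
  simp +decide only [sat_all, sat_mem, eval_var, eval_pair, update_self, update_of_ne,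
    h₀, h₁] at key
  exact key.1 (fun _ => rfl) x

theorem pair_mem_starSet_stdGraph_fst (x : N.Obj σ) (y : N.Obj τ) :
    N.Mem (N.pair (N.pair x y) x) (N.starSet (stdGraph (σ := prod σ τ) (τ := σ) Prod.fst)) := by
  obtain ⟨v, h₀, -, -⟩ := exists_assignment_eq (σ₀ := pow (prod (prod σ τ) σ)) (σ₁ := nat)
    (σ₂ := nat) (stdGraph (σ := prod σ τ) (τ := σ) Prod.fst) (0 : ℕ) (0 : ℕ)
  have key := N.transfer (.all σ 3 (.all τ 4 (.mem (.pair (.pair (.var σ 3) (.var τ 4))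
    (.var σ 3)) (.var (pow (prod (prod σ τ) σ)) 0)))) v
  simp +decide only [sat_all, sat_mem, eval_var, eval_pair, update_self, update_of_ne, h₀] at key
  exact key.1 (fun _ _ => rfl) x y

theorem pair_mem_starSet_stdGraph_snd (x : N.Obj σ) (y : N.Obj τ) :
    N.Mem (N.pair (N.pair x y) y) (N.starSet (stdGraph (σ := prod σ τ) (τ := τ) Prod.snd)) := by
  obtain ⟨v, h₀, -, -⟩ := exists_assignment_eq (σ₀ := pow (prod (prod σ τ) τ)) (σ₁ := nat)
    (σ₂ := nat) (stdGraph (σ := prod σ τ) (τ := τ) Prod.snd) (0 : ℕ) (0 : ℕ)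
  have key := N.transfer (.all σ 3 (.all τ 4 (.mem (.pair (.pair (.var σ 3) (.var τ 4))
    (.var τ 4)) (.var (pow (prod (prod σ τ) τ)) 0)))) v
  simp +decide only [sat_all, sat_mem, eval_var, eval_pair, update_self, update_of_ne, h₀] at key
  exact key.1 (fun _ _ => rfl) x y

theorem pair_mem_starSet_membership (x : N.Obj σ) (A : N.Obj (pow σ)) :
    N.Mem (N.pair x A) (N.starSet (σ := prod σ (pow σ))
      {p : σ.Carrier × Set σ.Carrier | p.1 ∈ p.2}) ↔ N.Mem x A := by
  obtain ⟨v, h₀, -, -⟩ := exists_assignment_eq (σ₀ := pow (prod σ (pow σ))) (σ₁ := nat)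
    (σ₂ := nat) {p : σ.Carrier × Set σ.Carrier | p.1 ∈ p.2} (0 : ℕ) (0 : ℕ)
  have mp := N.transfer (.all σ 3 (.all (pow σ) 4 (.imp
    (.mem (.pair (.var σ 3) (.var (pow σ) 4)) (.var (pow (prod σ (pow σ))) 0))
    (.mem (.var σ 3) (.var (pow σ) 4))))) v
  have mpr := N.transfer (.all σ 3 (.all (pow σ) 4 (.imp
    (.mem (.var σ 3) (.var (pow σ) 4))
    (.mem (.pair (.var σ 3) (.var (pow σ) 4)) (.var (pow (prod σ (pow σ))) 0))))) v
  simp +decide only [sat_all, sat_imp, sat_mem, eval_var, eval_pair, update_self, update_of_ne,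
    h₀] at mp mpr
  exact ⟨mp.1 (fun _ _ h => h) x A, mpr.1 (fun _ _ h => h) x A⟩

/-! ### The ultrafilter of an internal object -/

/-- The type of an internal object `a`: the ultrafilter of the standard sets whose star contains
`a`. Together with `starFun` it turns statements about internal objects into statements about
germs of standard functions. -/
def ult (a : N.Obj σ) : Ultrafilter σ.Carrier :=
  Ultrafilter.ofComplNotMemIff
    { sets := {A | N.Mem a (N.starSet A)}
      univ_sets := by
        by_contra h
        exact h (N.mem_starSet_of_forall (fun _ _ _ => trivial) a
          ((N.mem_starSet_compl _ a).2 h) ((N.mem_starSet_compl _ a).2 h))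
      sets_of_superset := fun h hsub => N.mem_starSet_of_forall (fun _ hx _ => hsub hx) a h h
      inter_sets := fun {A B} hA hB =>
        N.mem_starSet_of_forall (C := A ∩ B) (fun _ hxA hxB => ⟨hxA, hxB⟩) a hA hB }
    (fun A => (not_congr (N.mem_starSet_compl A a)).trans not_not)

theorem mem_ult {a : N.Obj σ} {A : Set σ.Carrier} : A ∈ N.ult a ↔ N.Mem a (N.starSet A) := Iff.rfl

theorem pair_starFun_mem (f : σ.Carrier → τ.Carrier) (a : N.Obj σ) :
    N.Mem (N.pair a (N.starFun f a)) (N.starSet (stdGraph f)) :=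
  Classical.choose_spec (N.exists_starFun f a)

theorem starFun_eq {f : σ.Carrier → τ.Carrier} {a : N.Obj σ} {b : N.Obj τ}
    (h : N.Mem (N.pair a b) (N.starSet (stdGraph f))) : N.starFun f a = b :=
  N.starSet_stdGraph_unique f (N.pair_starFun_mem f a) h

theorem ult_starFun (f : σ.Carrier → τ.Carrier) (a : N.Obj σ) :
    N.ult (N.starFun f a) = (N.ult a).map f := by
  refine (Ultrafilter.eq_of_le fun B hB => ?_).symm
  change f ⁻¹' B ∈ N.ult a
  by_contra h
  rw [← Ultrafilter.compl_mem_iff_notMem, mem_ult] at h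
  have hcompl : N.Mem (N.starFun f a) (N.starSet Bᶜ) :=
    N.mem_starSet_of_pair_mem (fun x y (hxy : y = f x) (hx : f x ∉ B) => hxy ▸ hx)
      (N.pair_starFun_mem f a) h
  exact (N.mem_starSet_compl _ _).1 hcompl hB

theorem pair_starFun (f : σ.Carrier → τ.Carrier) (g : σ.Carrier → ρ.Carrier) (a : N.Obj σ) :
    N.pair (N.starFun f a) (N.starFun g a) =
      N.starFun (σ := σ) (τ := prod τ ρ) (fun i => (f i, g i)) a :=
  (N.starFun_eq (N.pair_mem_starSet_stdGraph_prodMk f g (N.pair_starFun_mem f a)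
    (N.pair_starFun_mem g a))).symm

theorem starFun_starFun (g : τ.Carrier → ρ.Carrier) (f : σ.Carrier → τ.Carrier) (a : N.Obj σ) :
    N.starFun g (N.starFun f a) = N.starFun (fun i => g (f i)) a :=
  (N.starFun_eq (N.pair_mem_starSet_stdGraph_comp f g (N.pair_starFun_mem f a)
    (N.pair_starFun_mem g _))).symm

theorem starFun_id (a : N.Obj σ) : N.starFun (σ := σ) (τ := σ) (fun i => i) a = a :=
  N.starFun_eq ((N.pair_mem_starSet_stdGraph_id a a).2 rfl)

theorem starFun_const (b : τ.Carrier) (a : N.Obj σ) :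
    N.starFun (σ := σ) (τ := τ) (fun _ => b) a = N.star b :=
  N.starFun_eq (N.pair_star_mem_starSet_stdGraph_const b a)

theorem starFun_fst (a : N.Obj σ) (b : N.Obj τ) :
    N.starFun (σ := prod σ τ) (τ := σ) Prod.fst (N.pair a b) = a :=
  N.starFun_eq (N.pair_mem_starSet_stdGraph_fst a b)

theorem starFun_snd (a : N.Obj σ) (b : N.Obj τ) :
    N.starFun (σ := prod σ τ) (τ := τ) Prod.snd (N.pair a b) = b :=
  N.starFun_eq (N.pair_mem_starSet_stdGraph_snd a b)

theorem pair_inj {a a' : N.Obj σ} {b b' : N.Obj τ} :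
    N.pair a b = N.pair a' b' ↔ a = a' ∧ b = b' := by
  refine ⟨fun h => ⟨?_, ?_⟩, fun ⟨h, h'⟩ => by rw [h, h']⟩
  · rw [← N.starFun_fst a b, h, N.starFun_fst]
  · rw [← N.starFun_snd a b, h, N.starFun_snd]

theorem mem_starSet_starFun (A : Set τ.Carrier) (f : σ.Carrier → τ.Carrier) (a : N.Obj σ) :
    N.Mem (N.starFun f a) (N.starSet A) ↔ ∀ᶠ i in N.ult a, f i ∈ A := by
  rw [← mem_ult, ult_starFun]; rfl

theorem pair_mem_starSet_starFun (A : Set (τ.Carrier × ρ.Carrier)) (f : σ.Carrier → τ.Carrier)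
    (g : σ.Carrier → ρ.Carrier) (a : N.Obj σ) :
    N.Mem (N.pair (N.starFun f a) (N.starFun g a)) (N.starSet (σ := prod τ ρ) A) ↔
      ∀ᶠ i in N.ult a, (f i, g i) ∈ A := by
  rw [pair_starFun]
  exact N.mem_starSet_starFun (τ := prod τ ρ) A _ a

theorem starFun_eq_iff {f g : σ.Carrier → τ.Carrier} {a : N.Obj σ} :
    N.starFun f a = N.starFun g a ↔ ∀ᶠ i in N.ult a, f i = g i := by
  rw [eq_comm (a := N.starFun f a), ← pair_mem_starSet_stdGraph_id]
  exact (N.pair_mem_starSet_starFun _ f g a).trans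
    (Filter.eventually_congr (Filter.Eventually.of_forall fun _ => eq_comm))

/-- The internal subset of type `τ` given by a family of standard sets. This is `starFun` for
set-valued functions, with the power type spelled out for elaboration. -/
noncomputable def setFun (F : σ.Carrier → Set τ.Carrier) (a : N.Obj σ) : N.Obj (pow τ) :=
  N.starFun (τ := pow τ) F a

/-- The internal relation given by a family of standard relations. This is `starFun` for
relation-valued functions, with the power type spelled out for elaboration. -/
noncomputable def relFun (F : σ.Carrier → Set (τ.Carrier × ρ.Carrier)) (a : N.Obj σ) :
    N.Obj (pow (prod τ ρ)) :=
  N.starFun (τ := pow (prod τ ρ)) F a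

theorem mem_setFun {f : σ.Carrier → τ.Carrier} {F : σ.Carrier → Set τ.Carrier} {a : N.Obj σ} :
    N.Mem (N.starFun f a) (N.setFun F a) ↔ ∀ᶠ i in N.ult a, f i ∈ F i := by
  rw [← pair_mem_starSet_membership]
  exact N.pair_mem_starSet_starFun (ρ := pow τ) {p : τ.Carrier × Set τ.Carrier | p.1 ∈ p.2} f F a

theorem setFun_starFun (F : τ.Carrier → Set ρ.Carrier) (f : σ.Carrier → τ.Carrier) (a : N.Obj σ) :
    N.setFun F (N.starFun f a) = N.setFun (fun i => F (f i)) a :=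
  N.starFun_starFun (ρ := pow ρ) F f a

end NonstandardUniverse

/-! ### The ordered semiring of hypernatural numbers -/

namespace NonstandardUniverse

open FinType TypedStructure Filter

variable {N : NonstandardUniverse.{u}} {σ τ : FinType}

theorem exists_starFun₂ (x : N.Obj σ) (y : N.Obj τ) : ∃ (ρ : FinType) (t : N.Obj ρ)
    (f : ρ.Carrier → σ.Carrier) (g : ρ.Carrier → τ.Carrier),
    x = N.starFun f t ∧ y = N.starFun g t :=
  ⟨prod σ τ, N.pair x y, Prod.fst, Prod.snd, (N.starFun_fst x y).symm, (N.starFun_snd x y).symm⟩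

theorem exists_starFun₃ {σ₁ σ₂ σ₃ : FinType} (x : N.Obj σ₁) (y : N.Obj σ₂) (z : N.Obj σ₃) :
    ∃ (ρ : FinType) (t : N.Obj ρ) (f : ρ.Carrier → σ₁.Carrier) (g : ρ.Carrier → σ₂.Carrier)
      (h : ρ.Carrier → σ₃.Carrier),
      x = N.starFun f t ∧ y = N.starFun g t ∧ z = N.starFun h t := by
  obtain ⟨ρ, t, f, g, rfl, rfl⟩ := exists_starFun₂ x y
  obtain ⟨ρ', t', π, h, rfl, rfl⟩ := exists_starFun₂ t z
  exact ⟨ρ', t', _, _, h, N.starFun_starFun _ _ _, N.starFun_starFun _ _ _, rfl⟩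

theorem exists_starFun₄ {σ₁ σ₂ σ₃ σ₄ : FinType} (x : N.Obj σ₁) (y : N.Obj σ₂) (z : N.Obj σ₃)
    (w : N.Obj σ₄) :
    ∃ (ρ : FinType) (t : N.Obj ρ) (f : ρ.Carrier → σ₁.Carrier) (g : ρ.Carrier → σ₂.Carrier)
      (h : ρ.Carrier → σ₃.Carrier) (k : ρ.Carrier → σ₄.Carrier),
      x = N.starFun f t ∧ y = N.starFun g t ∧ z = N.starFun h t ∧ w = N.starFun k t := by
  obtain ⟨ρ, t, f, g, h, rfl, rfl, rfl⟩ := exists_starFun₃ x y z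
  obtain ⟨ρ', t', π, k, rfl, rfl⟩ := exists_starFun₂ t w
  exact ⟨ρ', t', _, _, _, k, N.starFun_starFun _ _ _, N.starFun_starFun _ _ _,
    N.starFun_starFun _ _ _, rfl⟩

variable (N) in
/-- The hypernatural number given by a family of natural numbers. This is `starFun` for
`ℕ`-valued functions, with the type spelled out for elaboration. -/
noncomputable def natFun (f : σ.Carrier → ℕ) (a : N.Obj σ) : N.HNat :=
  N.starFun (τ := nat) f a

theorem exists_natFun₁ (x : N.HNat) : ∃ (ρ : FinType) (t : N.Obj ρ) (f : ρ.Carrier → ℕ),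
    x = N.natFun f t := ⟨nat, x, fun i => i, (N.starFun_id x).symm⟩

theorem exists_natFun₂ (x y : N.HNat) : ∃ (ρ : FinType) (t : N.Obj ρ) (f g : ρ.Carrier → ℕ),
    x = N.natFun f t ∧ y = N.natFun g t := exists_starFun₂ x y

theorem exists_natFun₃ (x y z : N.HNat) : ∃ (ρ : FinType) (t : N.Obj ρ) (f g h : ρ.Carrier → ℕ),
    x = N.natFun f t ∧ y = N.natFun g t ∧ z = N.natFun h t := exists_starFun₃ x y z

theorem natFun_starFun (g : τ.Carrier → ℕ) (f : σ.Carrier → τ.Carrier) (t : N.Obj σ) :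
    N.natFun g (N.starFun f t) = N.natFun (fun i => g (f i)) t :=
  N.starFun_starFun (ρ := nat) g f t

theorem natFun_eq_iff {f g : σ.Carrier → ℕ} {t : N.Obj σ} :
    N.natFun f t = N.natFun g t ↔ ∀ᶠ i in N.ult t, f i = g i :=
  N.starFun_eq_iff (τ := nat)

theorem starFun_pair_natFun (φ : ℕ × ℕ → ℕ) (f g : σ.Carrier → ℕ) (t : N.Obj σ) :
    N.starFun (σ := prod nat nat) (τ := nat) φ (N.pair (N.natFun f t) (N.natFun g t)) =
      N.natFun (fun i => φ (f i, g i)) t :=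
  (congrArg _ (N.pair_starFun (τ := nat) (ρ := nat) f g t)).trans
    (N.starFun_starFun (τ := prod nat nat) (ρ := nat) _ _ _)

noncomputable instance : Zero N.HNat := ⟨N.ofNat 0⟩

noncomputable instance : One N.HNat := ⟨N.ofNat 1⟩

noncomputable instance : NatCast N.HNat := ⟨N.ofNat⟩

noncomputable instance : Add N.HNat := ⟨N.add⟩

noncomputable instance : Mul N.HNat := ⟨N.mul⟩

/-- Truncated subtraction. -/
noncomputable instance : Sub N.HNat :=
  ⟨fun x y => N.starFun (σ := prod nat nat) (τ := nat)
    (fun p : ℕ × ℕ => (p.1 - p.2 : ℕ)) (N.pair x y)⟩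

instance : LE N.HNat := ⟨N.le⟩

instance : LT N.HNat := ⟨N.lt⟩

theorem natCast_eq_natFun (n : ℕ) (t : N.Obj σ) : (n : N.HNat) = N.natFun (fun _ => n) t :=
  (N.starFun_const (τ := nat) n t).symm

theorem zero_eq_natFun (t : N.Obj σ) : (0 : N.HNat) = N.natFun (fun _ => 0) t :=
  natCast_eq_natFun 0 t

theorem one_eq_natFun (t : N.Obj σ) : (1 : N.HNat) = N.natFun (fun _ => 1) t :=
  natCast_eq_natFun 1 t

theorem natFun_add (f g : σ.Carrier → ℕ) (t : N.Obj σ) :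
    N.natFun f t + N.natFun g t = N.natFun (fun i => f i + g i) t :=
  starFun_pair_natFun _ f g t

theorem natFun_mul (f g : σ.Carrier → ℕ) (t : N.Obj σ) :
    N.natFun f t * N.natFun g t = N.natFun (fun i => f i * g i) t :=
  starFun_pair_natFun _ f g t

theorem natFun_sub (f g : σ.Carrier → ℕ) (t : N.Obj σ) :
    N.natFun f t - N.natFun g t = N.natFun (fun i => f i - g i) t :=
  starFun_pair_natFun _ f g t

theorem natFun_le {f g : σ.Carrier → ℕ} {t : N.Obj σ} :
    N.natFun f t ≤ N.natFun g t ↔ ∀ᶠ i in N.ult t, f i ≤ g i :=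
  N.pair_mem_starSet_starFun (τ := nat) (ρ := nat) _ f g t

theorem natFun_lt {f g : σ.Carrier → ℕ} {t : N.Obj σ} :
    N.natFun f t < N.natFun g t ↔ ∀ᶠ i in N.ult t, f i < g i :=
  N.pair_mem_starSet_starFun (τ := nat) (ρ := nat) _ f g t

noncomputable instance : AddCommMonoid N.HNat where
  add_assoc x y z := by
    obtain ⟨ρ, t, f, g, h, rfl, rfl, rfl⟩ := exists_natFun₃ x y z
    simp only [natFun_add, add_assoc]
  add_comm x y := by
    obtain ⟨ρ, t, f, g, rfl, rfl⟩ := exists_natFun₂ x y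
    simp only [natFun_add, add_comm]
  zero_add x := by
    obtain ⟨ρ, t, f, rfl⟩ := exists_natFun₁ x
    simp only [natFun_add, zero_eq_natFun t, zero_add]
  add_zero x := by
    obtain ⟨ρ, t, f, rfl⟩ := exists_natFun₁ x
    simp only [natFun_add, zero_eq_natFun t, add_zero]
  nsmul := nsmulRec

noncomputable instance : CommMonoid N.HNat where
  mul_assoc x y z := by
    obtain ⟨ρ, t, f, g, h, rfl, rfl, rfl⟩ := exists_natFun₃ x y z
    simp only [natFun_mul, mul_assoc]
  mul_comm x y := by
    obtain ⟨ρ, t, f, g, rfl, rfl⟩ := exists_natFun₂ x y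
    simp only [natFun_mul, mul_comm]
  one_mul x := by
    obtain ⟨ρ, t, f, rfl⟩ := exists_natFun₁ x
    simp only [natFun_mul, one_eq_natFun t, one_mul]
  mul_one x := by
    obtain ⟨ρ, t, f, rfl⟩ := exists_natFun₁ x
    simp only [natFun_mul, one_eq_natFun t, mul_one]

noncomputable instance : CommSemiring N.HNat where
  __ := (inferInstance : AddCommMonoid N.HNat)
  __ := (inferInstance : CommMonoid N.HNat)
  zero_mul x := by
    obtain ⟨ρ, t, f, rfl⟩ := exists_natFun₁ x
    simp only [natFun_mul, zero_eq_natFun t, zero_mul]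
  mul_zero x := by
    obtain ⟨ρ, t, f, rfl⟩ := exists_natFun₁ x
    simp only [natFun_mul, zero_eq_natFun t, mul_zero]
  left_distrib x y z := by
    obtain ⟨ρ, t, f, g, h, rfl, rfl, rfl⟩ := exists_natFun₃ x y z
    simp only [natFun_add, natFun_mul, mul_add]
  right_distrib x y z := by
    obtain ⟨ρ, t, f, g, h, rfl, rfl, rfl⟩ := exists_natFun₃ x y z
    simp only [natFun_add, natFun_mul, add_mul]
  natCast_zero := rfl
  natCast_succ n := by
    simp only [natCast_eq_natFun _ (0 : N.HNat), one_eq_natFun (0 : N.HNat), natFun_add]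

noncomputable instance : LinearOrder N.HNat where
  le_refl x := by
    obtain ⟨ρ, t, f, rfl⟩ := exists_natFun₁ x
    exact natFun_le.2 (.of_forall fun _ => le_rfl)
  le_trans x y z := by
    obtain ⟨ρ, t, f, g, h, rfl, rfl, rfl⟩ := exists_natFun₃ x y z
    simp only [natFun_le]
    intro hfg hgh
    filter_upwards [hfg, hgh] with i hfg hgh using hfg.trans hgh
  le_antisymm x y := by
    obtain ⟨ρ, t, f, g, rfl, rfl⟩ := exists_natFun₂ x y
    simp only [natFun_le, natFun_eq_iff]
    intro hfg hgf
    filter_upwards [hfg, hgf] with i hfg hgf using le_antisymm hfg hgf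
  le_total x y := by
    obtain ⟨ρ, t, f, g, rfl, rfl⟩ := exists_natFun₂ x y
    simp only [natFun_le]
    rw [← Ultrafilter.eventually_or]
    exact .of_forall fun _ => le_total _ _
  lt_iff_le_not_ge x y := by
    obtain ⟨ρ, t, f, g, rfl, rfl⟩ := exists_natFun₂ x y
    simp only [natFun_le, natFun_lt]
    rw [← Ultrafilter.eventually_not, ← eventually_and]
    simp only [lt_iff_le_not_ge]
  toDecidableLE := Classical.decRel _

instance : IsStrictOrderedRing N.HNat where
  zero_le_one := by
    rw [zero_eq_natFun (N.ofNat 0), one_eq_natFun (N.ofNat 0), natFun_le]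
    exact .of_forall fun _ => zero_le_one
  exists_pair_ne := ⟨0, 1, by
    rw [zero_eq_natFun (N.ofNat 0), one_eq_natFun (N.ofNat 0), Ne, natFun_eq_iff]
    simpa using (N.ult _).neBot.ne⟩
  add_le_add_left x y hxy z := by
    obtain ⟨ρ, t, f, g, h, rfl, rfl, rfl⟩ := exists_natFun₃ x y z
    rw [natFun_le] at hxy
    simp only [natFun_add, natFun_le]
    filter_upwards [hxy] with i hi using Nat.add_le_add_right hi _
  le_of_add_le_add_left x y z := by
    obtain ⟨ρ, t, f, g, h, rfl, rfl, rfl⟩ := exists_natFun₃ x y z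
    simp only [natFun_add, natFun_le, add_le_add_iff_left, imp_self]
  mul_lt_mul_of_pos_left x hx y z hyz := by
    obtain ⟨ρ, t, f, g, h, rfl, rfl, rfl⟩ := exists_natFun₃ x y z
    rw [zero_eq_natFun t, natFun_lt] at hx
    rw [natFun_lt] at hyz
    simp only [natFun_mul, natFun_lt]
    filter_upwards [hyz, hx] with i hyz hx using Nat.mul_lt_mul_of_pos_left hyz hx
  mul_lt_mul_of_pos_right x hx y z hyz := by
    obtain ⟨ρ, t, f, g, h, rfl, rfl, rfl⟩ := exists_natFun₃ x y z
    rw [zero_eq_natFun t, natFun_lt] at hx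
    rw [natFun_lt] at hyz
    simp only [natFun_mul, natFun_lt]
    filter_upwards [hyz, hx] with i hyz hx using Nat.mul_lt_mul_of_pos_right hyz hx

instance : OrderedSub N.HNat where
  tsub_le_iff_right x y z := by
    obtain ⟨ρ, t, f, g, h, rfl, rfl, rfl⟩ := exists_natFun₃ x y z
    simp only [natFun_add, natFun_le, natFun_sub, tsub_le_iff_right]

instance : CanonicallyOrderedAdd N.HNat where
  exists_add_of_le {x y} hxy := by
    refine ⟨y - x, ?_⟩
    obtain ⟨ρ, t, f, g, rfl, rfl⟩ := exists_natFun₂ x y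
    rw [natFun_le] at hxy
    rw [natFun_sub, natFun_add, natFun_eq_iff]
    filter_upwards [hxy] with i hi using (Nat.add_sub_cancel' hi).symm
  le_add_self x y := by
    obtain ⟨ρ, t, f, g, rfl, rfl⟩ := exists_natFun₂ x y
    simp only [natFun_add, natFun_le]
    exact .of_forall fun i => Nat.le_add_left _ _
  le_self_add x y := by
    obtain ⟨ρ, t, f, g, rfl, rfl⟩ := exists_natFun₂ x y
    simp only [natFun_add, natFun_le]
    exact .of_forall fun i => Nat.le_add_right _ _

noncomputable instance : SuccAddOrder N.HNat where
  succ x := x + 1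
  succ_eq_add_one _ := rfl
  le_succ _ := le_self_add
  max_of_succ_le {x} h := absurd h (lt_add_one x).not_ge
  succ_le_of_lt {x y} := by
    obtain ⟨ρ, t, f, g, rfl, rfl⟩ := exists_natFun₂ x y
    simp only [natFun_add, natFun_le, natFun_lt, one_eq_natFun t]
    exact id

theorem exists_forall_natCast_mul_le_iff (x : N.HNat) {n : ℕ} (hn : 0 < n) :
    ∃ q : N.HNat, ∀ y : N.HNat, n * y ≤ x ↔ y ≤ q := by
  obtain ⟨ρ, t, f, rfl⟩ := exists_natFun₁ x
  refine ⟨N.natFun (fun i => f i / n) t, fun y => ?_⟩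
  obtain ⟨ρ', t', π, g, rfl, rfl⟩ : ∃ (ρ' : FinType) (t' : N.Obj ρ')
    (π : ρ'.Carrier → ρ.Carrier) (g : ρ'.Carrier → ℕ), t = N.starFun π t' ∧ y = N.natFun g t' :=
    exists_starFun₂ t y
  simp only [natFun_starFun, natCast_eq_natFun _ t', natFun_mul, natFun_le,
    Nat.le_div_iff_mul_le hn, mul_comm]

end NonstandardUniverse

/-! ### Internal sets -/

namespace NonstandardUniverse

open FinType TypedStructure Filter

variable {N : NonstandardUniverse.{u}} {σ τ ρ : FinType}

/-- A set of objects of type `σ` is internal if it is the set of elements of an object of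
type `pow σ`. -/
def IsInternal (S : Set (N.Obj σ)) : Prop := ∃ A, N.elems A = S

theorem isInternal_elems (A : N.Obj (pow σ)) : IsInternal (N.elems A) := ⟨A, rfl⟩

theorem starFun_mem_elems_setFun {f : σ.Carrier → τ.Carrier} {F : σ.Carrier → Set τ.Carrier}
    {t : N.Obj σ} : N.starFun f t ∈ N.elems (N.setFun F t) ↔ ∀ᶠ i in N.ult t, f i ∈ F i :=
  N.mem_setFun

theorem exists_eventually_mem_of_eventually_nonempty {l : Filter σ.Carrier}
    {R : σ.Carrier → Set τ.Carrier} (h : ∀ᶠ i in l, (R i).Nonempty) :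
    ∃ f : σ.Carrier → τ.Carrier, ∀ᶠ i in l, f i ∈ R i := by
  classical
  refine ⟨fun i => if h : (R i).Nonempty then h.some else FinType.default τ, ?_⟩
  filter_upwards [h] with i hi
  rw [dif_pos hi]
  exact hi.some_mem

theorem elems_setFun_subset {F G : σ.Carrier → Set τ.Carrier} {t : N.Obj σ} :
    N.elems (N.setFun F t) ⊆ N.elems (N.setFun G t) ↔ ∀ᶠ i in N.ult t, F i ⊆ G i := by
  constructor
  · intro hsub
    by_contra hnot
    have hdiff : ∀ᶠ i in N.ult t, (F i \ G i).Nonempty := by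
      simpa only [Set.sdiff_nonempty] using Ultrafilter.eventually_not.2 hnot
    obtain ⟨f, hf⟩ := exists_eventually_mem_of_eventually_nonempty hdiff
    have hG := starFun_mem_elems_setFun.1
      (hsub (starFun_mem_elems_setFun.2 (hf.mono fun i hi => hi.1)))
    obtain ⟨i, hi, hfi⟩ := (hG.and hf).exists
    exact hfi.2 hi
  · intro hsub x hx
    obtain ⟨ρ, t', π, f, rfl, rfl⟩ := exists_starFun₂ t x
    rw [setFun_starFun, starFun_mem_elems_setFun] at hx ⊢
    rw [ult_starFun] at hsub
    filter_upwards [hx, hsub] with i hi hFG using hFG hi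

theorem elems_injective : Function.Injective (N.elems (σ := σ)) := by
  intro A B hAB
  obtain ⟨ρ, t, F, G, rfl, rfl⟩ : ∃ (ρ : FinType) (t : N.Obj ρ) (F G : ρ.Carrier → Set σ.Carrier),
    A = N.setFun F t ∧ B = N.setFun G t := exists_starFun₂ A B
  refine (N.starFun_eq_iff (τ := pow σ)).2 ?_
  filter_upwards [elems_setFun_subset.1 hAB.subset, elems_setFun_subset.1 hAB.superset]
    with i hFG hGF using hFG.antisymm hGF

theorem elems_setFun_eq {F G : σ.Carrier → Set τ.Carrier} {t : N.Obj σ} :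
    N.elems (N.setFun F t) = N.elems (N.setFun G t) ↔ ∀ᶠ i in N.ult t, F i = G i :=
  elems_injective.eq_iff.trans (N.starFun_eq_iff (τ := pow τ))

theorem elems_setFun_diff (F G : σ.Carrier → Set τ.Carrier) (t : N.Obj σ) :
    N.elems (N.setFun (fun i => F i \ G i) t) =
      N.elems (N.setFun F t) \ N.elems (N.setFun G t) := by
  ext x
  obtain ⟨ρ, t', π, f, rfl, rfl⟩ := exists_starFun₂ t x
  simp only [Set.mem_sdiff, setFun_starFun, starFun_mem_elems_setFun]
  rw [← Ultrafilter.eventually_not, ← eventually_and]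

theorem elems_setFun_union (F G : σ.Carrier → Set τ.Carrier) (t : N.Obj σ) :
    N.elems (N.setFun (fun i => F i ∪ G i) t) =
      N.elems (N.setFun F t) ∪ N.elems (N.setFun G t) := by
  ext x
  obtain ⟨ρ, t', π, f, rfl, rfl⟩ := exists_starFun₂ t x
  simp only [Set.mem_union, setFun_starFun, starFun_mem_elems_setFun]
  rw [← Ultrafilter.eventually_or]

theorem elems_setFun_univ (t : N.Obj σ) :
    N.elems (N.setFun (fun _ => (Set.univ : Set τ.Carrier)) t) = Set.univ := by
  ext x
  obtain ⟨ρ, t', π, f, rfl, rfl⟩ := exists_starFun₂ t x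
  simp only [setFun_starFun, starFun_mem_elems_setFun, Set.mem_univ, eventually_true]

theorem elems_setFun_image (f : τ.Carrier → ρ.Carrier) (F : σ.Carrier → Set τ.Carrier)
    (t : N.Obj σ) :
    N.elems (N.setFun (fun i => f '' F i) t) = N.starFun f '' N.elems (N.setFun F t) := by
  ext y
  constructor
  · intro hy
    obtain ⟨ρ', t', π, g, rfl, rfl⟩ := exists_starFun₂ t y
    rw [setFun_starFun, starFun_mem_elems_setFun] at hy
    obtain ⟨h, hh⟩ := exists_eventually_mem_of_eventually_nonempty
      (R := fun i => {x | x ∈ F (π i) ∧ f x = g i}) hy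
    refine ⟨N.starFun h t', ?_, ?_⟩
    · rw [setFun_starFun, starFun_mem_elems_setFun]
      exact hh.mono fun i hi => hi.1
    · rw [starFun_starFun, starFun_eq_iff]
      exact hh.mono fun i hi => hi.2
  · rintro ⟨x, hx, rfl⟩
    obtain ⟨ρ', t', π, g, rfl, rfl⟩ := exists_starFun₂ t x
    rw [setFun_starFun, starFun_mem_elems_setFun] at hx
    rw [starFun_starFun, setFun_starFun, starFun_mem_elems_setFun]
    exact hx.mono fun i hi => Set.mem_image_of_mem f hi

theorem injOn_elems_setFun {f : τ.Carrier → ρ.Carrier} {F : σ.Carrier → Set τ.Carrier}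
    {t : N.Obj σ} :
    Set.InjOn (N.starFun f) (N.elems (N.setFun F t)) ↔ ∀ᶠ i in N.ult t, Set.InjOn f (F i) := by
  constructor
  · intro hinj
    by_contra hnot
    obtain ⟨g, hg⟩ := exists_eventually_mem_of_eventually_nonempty (τ := prod τ τ)
      (R := fun i => {p : τ.Carrier × τ.Carrier | p.1 ∈ F i ∧ p.2 ∈ F i ∧ f p.1 = f p.2 ∧
        p.1 ≠ p.2}) ((Ultrafilter.eventually_not.2 hnot).mono fun i hi => by
          simp only [Set.InjOn, not_forall] at hi
          obtain ⟨x, hx, y, hy, hxy, hne⟩ := hi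
          exact ⟨(x, y), hx, hy, hxy, hne⟩)
    have heq := hinj (starFun_mem_elems_setFun.2 (hg.mono fun i hi => hi.1))
      (starFun_mem_elems_setFun.2 (hg.mono fun i hi => hi.2.1)) (by
        rw [starFun_starFun, starFun_starFun, starFun_eq_iff]
        exact hg.mono fun i hi => hi.2.2.1)
    rw [starFun_eq_iff] at heq
    obtain ⟨i, hi, hgi⟩ := (heq.and hg).exists
    exact hgi.2.2.2 hi
  · intro hinj x hx y hy hxy
    obtain ⟨ρ', t', π, g, h, rfl, rfl, rfl⟩ := exists_starFun₃ t x y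
    rw [setFun_starFun, starFun_mem_elems_setFun] at hx hy
    rw [starFun_starFun, starFun_starFun, starFun_eq_iff] at hxy
    rw [ult_starFun] at hinj
    rw [starFun_eq_iff]
    filter_upwards [hinj, hx, hy, hxy] with i hinj hx hy hxy using hinj hx hy hxy

theorem bijOn_iff_injOn_and_image_eq {α β : Type*} {f : α → β} {S : Set α} {T : Set β} :
    Set.BijOn f S T ↔ Set.InjOn f S ∧ f '' S = T :=
  ⟨fun h => ⟨h.injOn, h.image_eq⟩, fun h => h.2 ▸ h.1.bijOn_image⟩

theorem bijOn_elems_setFun {f : τ.Carrier → ρ.Carrier} {F : σ.Carrier → Set τ.Carrier}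
    {G : σ.Carrier → Set ρ.Carrier} {t : N.Obj σ} :
    Set.BijOn (N.starFun f) (N.elems (N.setFun F t)) (N.elems (N.setFun G t)) ↔
      ∀ᶠ i in N.ult t, Set.BijOn f (F i) (G i) := by
  simp only [bijOn_iff_injOn_and_image_eq, eventually_and, injOn_elems_setFun,
    ← elems_setFun_image, elems_setFun_eq]

/-- Internal definition principle: a predicate on internal objects that is computed pointwise on
germs, from an internal parameter `a`, defines an internal set. -/
theorem isInternal_setOf_of_eventually {P : N.Obj τ → Prop} (a : N.Obj σ)
    (R : τ.Carrier → σ.Carrier → Prop)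
    (h : ∀ {ρ : FinType} (t : N.Obj ρ) (f : ρ.Carrier → τ.Carrier) (g : ρ.Carrier → σ.Carrier),
      a = N.starFun g t → (P (N.starFun f t) ↔ ∀ᶠ i in N.ult t, R (f i) (g i))) :
    IsInternal {x | P x} := by
  refine ⟨N.setFun (fun i => {x | R x i}) a, ?_⟩
  ext x
  obtain ⟨ρ, t, f, g, rfl, rfl⟩ := exists_starFun₂ x a
  rw [setFun_starFun, starFun_mem_elems_setFun]
  exact (h t f g rfl).symm

theorem isInternal_setOf_of_eventually₂ {σ₁ σ₂ : FinType} {P : N.Obj τ → Prop} (a : N.Obj σ₁)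
    (b : N.Obj σ₂) (R : τ.Carrier → σ₁.Carrier → σ₂.Carrier → Prop)
    (h : ∀ {ρ : FinType} (t : N.Obj ρ) (f : ρ.Carrier → τ.Carrier) (g : ρ.Carrier → σ₁.Carrier)
      (k : ρ.Carrier → σ₂.Carrier), a = N.starFun g t → b = N.starFun k t →
      (P (N.starFun f t) ↔ ∀ᶠ i in N.ult t, R (f i) (g i) (k i))) :
    IsInternal {x | P x} := by
  refine isInternal_setOf_of_eventually (σ := prod σ₁ σ₂) (N.pair a b)
    (fun x (p : σ₁.Carrier × σ₂.Carrier) => R x p.1 p.2) fun t f g hg => ?_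
  refine h t f (fun i => Prod.fst (g i)) (fun i => Prod.snd (g i)) ?_ ?_
  · rw [← N.starFun_fst a b, hg]
    exact N.starFun_starFun (τ := prod σ₁ σ₂) Prod.fst g t
  · rw [← N.starFun_snd a b, hg]
    exact N.starFun_starFun (τ := prod σ₁ σ₂) Prod.snd g t

theorem isInternal_univ : IsInternal (Set.univ : Set (N.Obj σ)) :=
  ⟨_, elems_setFun_univ (N.ofNat 0)⟩

theorem IsInternal.diff {S T : Set (N.Obj σ)} (hS : IsInternal S) (hT : IsInternal T) :
    IsInternal (S \ T) := by
  obtain ⟨A, rfl⟩ := hS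
  obtain ⟨B, rfl⟩ := hT
  obtain ⟨ρ, t, F, G, rfl, rfl⟩ : ∃ (ρ : FinType) (t : N.Obj ρ) (F G : ρ.Carrier → Set σ.Carrier),
    A = N.setFun F t ∧ B = N.setFun G t := exists_starFun₂ A B
  exact ⟨_, elems_setFun_diff F G t⟩

theorem IsInternal.compl {S : Set (N.Obj σ)} (hS : IsInternal S) : IsInternal Sᶜ :=
  Set.compl_eq_univ_sdiff S ▸ isInternal_univ.diff hS

theorem IsInternal.inter {S T : Set (N.Obj σ)} (hS : IsInternal S) (hT : IsInternal T) :
    IsInternal (S ∩ T) :=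
  Set.sdiff_compl (s := S) (t := T) ▸ hS.diff hT.compl

theorem IsInternal.union {S T : Set (N.Obj σ)} (hS : IsInternal S) (hT : IsInternal T) :
    IsInternal (S ∪ T) :=
  Set.union_eq_compl_compl_inter_compl S T ▸ (hS.compl.inter hT.compl).compl

theorem isInternal_empty : IsInternal (∅ : Set (N.Obj σ)) :=
  Set.compl_univ (α := N.Obj σ) ▸ isInternal_univ.compl

theorem isInternal_iUnion_lt {S : ℕ → Set (N.Obj σ)} (hS : ∀ n, IsInternal (S n)) (n : ℕ) :
    IsInternal (⋃ i < n, S i) := by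
  induction n with
  | zero => simpa using isInternal_empty
  | succ n ih => exact Set.biUnion_lt_succ S n ▸ ih.union (hS n)

theorem isInternal_Iic (c : N.HNat) : IsInternal (Set.Iic c) :=
  isInternal_setOf_of_eventually (τ := nat) (σ := nat) (P := fun x : N.HNat => x ≤ c) c
    (fun m n : ℕ => m ≤ n) fun _ _ _ hc => hc ▸ natFun_le

theorem isInternal_Iio (c : N.HNat) : IsInternal (Set.Iio c) :=
  isInternal_setOf_of_eventually (τ := nat) (σ := nat) (P := fun x : N.HNat => x < c) c
    (fun m n : ℕ => m < n) fun _ _ _ hc => hc ▸ natFun_lt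

theorem isInternal_superset {S : Set (N.Obj σ)} (hS : IsInternal S) :
    IsInternal {A : N.Obj (pow σ) | S ⊆ N.elems A} := by
  obtain ⟨B, rfl⟩ := hS
  exact isInternal_setOf_of_eventually (τ := pow σ) (σ := pow σ) B
    (fun F G : Set σ.Carrier => G ⊆ F) fun _ _ _ hB => hB ▸ elems_setFun_subset

theorem isInternal_subset {S : Set (N.Obj σ)} (hS : IsInternal S) :
    IsInternal {A : N.Obj (pow σ) | N.elems A ⊆ S} := by
  obtain ⟨B, rfl⟩ := hS
  exact isInternal_setOf_of_eventually (τ := pow σ) (σ := pow σ) B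
    (fun F G : Set σ.Carrier => F ⊆ G) fun _ _ _ hB => hB ▸ elems_setFun_subset

theorem IsInternal.preimage {S : Set (N.Obj τ)} (hS : IsInternal S) (f : σ.Carrier → τ.Carrier) :
    IsInternal (N.starFun f ⁻¹' S) := by
  obtain ⟨A, rfl⟩ := hS
  refine isInternal_setOf_of_eventually (σ := pow τ) A
    (fun x (F : Set τ.Carrier) => f x ∈ F) fun t g F hF => ?_
  rw [hF, starFun_starFun]
  exact starFun_mem_elems_setFun

theorem IsInternal.image {S : Set (N.Obj σ)} (hS : IsInternal S) (f : σ.Carrier → τ.Carrier) :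
    IsInternal (N.starFun f '' S) := by
  obtain ⟨A, rfl⟩ := hS
  have hA : N.setFun (fun F : Set σ.Carrier => F) A = A := N.starFun_id (σ := pow σ) A
  exact ⟨_, (elems_setFun_image f (fun F : Set σ.Carrier => F) A).trans (by rw [hA])⟩

theorem exists_forall_mem_of_isInternal {S : ℕ → Set (N.Obj σ)} (hS : ∀ n, IsInternal (S n))
    (h : ∀ n, ∃ x, ∀ k ≤ n, x ∈ S k) : ∃ x, ∀ n, x ∈ S n := by
  choose A hA using hS
  obtain rfl : (fun n => N.elems (A n)) = S := funext hA
  exact N.saturation A h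

end NonstandardUniverse

/-! ### Internal relations and bijections -/

namespace NonstandardUniverse

open FinType TypedStructure Filter

variable {N : NonstandardUniverse.{u}} {σ τ ρ : FinType}

/-- First component of an internal pair. -/
noncomputable def fst (p : N.Obj (prod σ τ)) : N.Obj σ :=
  N.starFun (σ := prod σ τ) (τ := σ) Prod.fst p

/-- Second component of an internal pair. -/
noncomputable def snd (p : N.Obj (prod σ τ)) : N.Obj τ :=
  N.starFun (σ := prod σ τ) (τ := τ) Prod.snd p

@[simp] theorem fst_pair (x : N.Obj σ) (y : N.Obj τ) : fst (N.pair x y) = x := N.starFun_fst x y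

@[simp] theorem snd_pair (x : N.Obj σ) (y : N.Obj τ) : snd (N.pair x y) = y := N.starFun_snd x y

@[simp] theorem pair_fst_snd (p : N.Obj (prod σ τ)) : N.pair (fst p) (snd p) = p :=
  (N.pair_starFun _ _ p).trans (N.starFun_id p)

theorem exists_pair (p : N.Obj (prod σ τ)) : ∃ x y, p = N.pair x y :=
  ⟨_, _, (pair_fst_snd p).symm⟩

theorem fst_starFun (f : ρ.Carrier → (prod σ τ).Carrier) (t : N.Obj ρ) :
    fst (N.starFun f t) = N.starFun (fun i => Prod.fst (f i)) t :=
  N.starFun_starFun (τ := prod σ τ) Prod.fst f t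

theorem snd_starFun (f : ρ.Carrier → (prod σ τ).Carrier) (t : N.Obj ρ) :
    snd (N.starFun f t) = N.starFun (fun i => Prod.snd (f i)) t :=
  N.starFun_starFun (τ := prod σ τ) Prod.snd f t

theorem starFun_prodMk {σ₁ σ₂ : FinType} (f : σ.Carrier → σ₁.Carrier) (g : σ.Carrier → σ₂.Carrier)
    (x : N.Obj σ) :
    N.starFun (σ := σ) (τ := prod σ₁ σ₂) (fun i => (f i, g i)) x =
      N.pair (N.starFun f x) (N.starFun g x) :=
  (N.pair_starFun f g x).symm

theorem IsInternal.preimage_fst {S : Set (N.Obj σ)} (hS : IsInternal S) :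
    IsInternal (fst ⁻¹' S : Set (N.Obj (prod σ τ))) :=
  hS.preimage (σ := prod σ τ) Prod.fst

theorem IsInternal.preimage_snd {S : Set (N.Obj τ)} (hS : IsInternal S) :
    IsInternal (snd ⁻¹' S : Set (N.Obj (prod σ τ))) :=
  hS.preimage (σ := prod σ τ) Prod.snd

theorem IsInternal.image_fst {R : Set (N.Obj (prod σ τ))} (hR : IsInternal R) :
    IsInternal (fst '' R) :=
  hR.image (σ := prod σ τ) (τ := σ) Prod.fst

theorem IsInternal.image_snd {R : Set (N.Obj (prod σ τ))} (hR : IsInternal R) :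
    IsInternal (snd '' R) :=
  hR.image (σ := prod σ τ) (τ := τ) Prod.snd

/-- The image of a set under a relation. -/
def relImage (R : Set (N.Obj (prod σ τ))) (B : Set (N.Obj σ)) : Set (N.Obj τ) :=
  {y | ∃ x ∈ B, N.pair x y ∈ R}

theorem relImage_eq_image_snd (R : Set (N.Obj (prod σ τ))) (B : Set (N.Obj σ)) :
    relImage R B = snd '' (R ∩ fst ⁻¹' B) := by
  ext y
  constructor
  · rintro ⟨x, hx, hxy⟩
    exact ⟨N.pair x y, ⟨hxy, by rwa [Set.mem_preimage, fst_pair]⟩, snd_pair x y⟩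
  · rintro ⟨p, ⟨hp, hpB⟩, rfl⟩
    exact ⟨fst p, hpB, by rwa [pair_fst_snd]⟩

theorem IsInternal.relImage {R : Set (N.Obj (prod σ τ))} {B : Set (N.Obj σ)} (hR : IsInternal R)
    (hB : IsInternal B) : IsInternal (relImage R B) :=
  relImage_eq_image_snd R B ▸ (hR.inter hB.preimage_fst).image_snd

/-- The converse of a relation. -/
def relInv (R : Set (N.Obj (prod σ τ))) : Set (N.Obj (prod τ σ)) :=
  {p | N.pair (snd p) (fst p) ∈ R}

@[simp] theorem pair_mem_relInv {R : Set (N.Obj (prod σ τ))} {x : N.Obj σ} {y : N.Obj τ} :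
    N.pair y x ∈ relInv R ↔ N.pair x y ∈ R := by
  simp [relInv]

theorem IsInternal.relInv {R : Set (N.Obj (prod σ τ))} (hR : IsInternal R) :
    IsInternal (relInv R) := by
  convert hR.preimage (σ := prod τ σ) (τ := prod σ τ) fun p : τ.Carrier × σ.Carrier => (p.2, p.1)
    using 1
  ext p
  exact iff_of_eq (congrArg (· ∈ R) (starFun_prodMk (σ := prod τ σ) _ _ p).symm)

/-- The composition of two relations, the first one being applied first. -/
def relComp (R : Set (N.Obj (prod σ τ))) (Q : Set (N.Obj (prod τ ρ))) : Set (N.Obj (prod σ ρ)) :=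
  {p | ∃ y, N.pair (fst p) y ∈ R ∧ N.pair y (snd p) ∈ Q}

@[simp] theorem pair_mem_relComp {R : Set (N.Obj (prod σ τ))} {Q : Set (N.Obj (prod τ ρ))}
    {x : N.Obj σ} {z : N.Obj ρ} :
    N.pair x z ∈ relComp R Q ↔ ∃ y, N.pair x y ∈ R ∧ N.pair y z ∈ Q := by
  simp [relComp]

theorem IsInternal.relComp {R : Set (N.Obj (prod σ τ))} {Q : Set (N.Obj (prod τ ρ))}
    (hR : IsInternal R) (hQ : IsInternal Q) : IsInternal (relComp R Q) := by
  let f : (prod (prod σ τ) ρ).Carrier → (prod τ ρ).Carrier :=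
    fun p : (σ.Carrier × τ.Carrier) × ρ.Carrier => (p.1.2, p.2)
  let g : (prod (prod σ τ) ρ).Carrier → (prod σ ρ).Carrier :=
    fun p : (σ.Carrier × τ.Carrier) × ρ.Carrier => (p.1.1, p.2)
  have hf (p : N.Obj (prod (prod σ τ) ρ)) : N.starFun f p = N.pair (snd (fst p)) (snd p) :=
    (starFun_prodMk (σ := prod (prod σ τ) ρ) _ _ p).trans
      (congrArg (N.pair · _) (snd_starFun (ρ := prod (prod σ τ) ρ) Prod.fst p).symm)
  have hg (p : N.Obj (prod (prod σ τ) ρ)) : N.starFun g p = N.pair (fst (fst p)) (snd p) :=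
    (starFun_prodMk (σ := prod (prod σ τ) ρ) _ _ p).trans
      (congrArg (N.pair · _) (fst_starFun (ρ := prod (prod σ τ) ρ) Prod.fst p).symm)
  convert ((hR.preimage_fst (τ := ρ)).inter (hQ.preimage f)).image g using 1
  ext p
  constructor
  · rintro ⟨y, hxy, hyz⟩
    refine ⟨N.pair (N.pair (fst p) y) (snd p), ⟨?_, ?_⟩, ?_⟩
    · rwa [Set.mem_preimage, fst_pair]
    · rwa [Set.mem_preimage, hf, fst_pair, snd_pair, snd_pair]
    · rw [hg, fst_pair, fst_pair, snd_pair, pair_fst_snd]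
  · rintro ⟨q, ⟨hqR, hqQ⟩, rfl⟩
    rw [Set.mem_preimage, hf] at hqQ
    exact ⟨snd (fst q), by rwa [hg, fst_pair, pair_fst_snd], by rwa [hg, snd_pair]⟩

/-- A relation that is the graph of an injective partial map. -/
def BiUnique (R : Set (N.Obj (prod σ τ))) : Prop := Set.InjOn fst R ∧ Set.InjOn snd R

section BiUnique

variable {R : Set (N.Obj (prod σ τ))} {Q : Set (N.Obj (prod τ ρ))}

theorem BiUnique.right_unique (h : BiUnique R) {x : N.Obj σ} {y y' : N.Obj τ}
    (hy : N.pair x y ∈ R) (hy' : N.pair x y' ∈ R) : y = y' :=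
  (N.pair_inj.1 (h.1 hy hy' (by simp only [fst_pair]))).2

theorem BiUnique.left_unique (h : BiUnique R) {x x' : N.Obj σ} {y : N.Obj τ}
    (hx : N.pair x y ∈ R) (hx' : N.pair x' y ∈ R) : x = x' :=
  (N.pair_inj.1 (h.2 hx hx' (by simp only [snd_pair]))).1

theorem biUnique_of_unique (hright : ∀ {x y y'}, N.pair x y ∈ R → N.pair x y' ∈ R → y = y')
    (hleft : ∀ {x x' y}, N.pair x y ∈ R → N.pair x' y ∈ R → x = x') : BiUnique R := by
  constructor
  · intro p hp q hq hpq
    obtain ⟨x, y, rfl⟩ := exists_pair p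
    obtain ⟨x', y', rfl⟩ := exists_pair q
    rw [fst_pair, fst_pair] at hpq
    subst hpq
    rw [hright hp hq]
  · intro p hp q hq hpq
    obtain ⟨x, y, rfl⟩ := exists_pair p
    obtain ⟨x', y', rfl⟩ := exists_pair q
    rw [snd_pair, snd_pair] at hpq
    subst hpq
    rw [hleft hp hq]

theorem BiUnique.relInv (h : BiUnique R) : BiUnique (relInv R) :=
  biUnique_of_unique
    (fun hx hx' => h.left_unique (pair_mem_relInv.1 hx) (pair_mem_relInv.1 hx'))
    fun hy hy' => h.right_unique (pair_mem_relInv.1 hy) (pair_mem_relInv.1 hy')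

theorem BiUnique.relComp (hR : BiUnique R) (hQ : BiUnique Q) : BiUnique (relComp R Q) := by
  refine biUnique_of_unique (fun h h' => ?_) fun h h' => ?_
  · obtain ⟨y, hxy, hyz⟩ := pair_mem_relComp.1 h
    obtain ⟨y', hxy', hyz'⟩ := pair_mem_relComp.1 h'
    obtain rfl := hR.right_unique hxy hxy'
    exact hQ.right_unique hyz hyz'
  · obtain ⟨y, hxy, hyz⟩ := pair_mem_relComp.1 h
    obtain ⟨y', hxy', hyz'⟩ := pair_mem_relComp.1 h'
    obtain rfl := hQ.left_unique hyz hyz'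
    exact hR.left_unique hxy hxy'

end BiUnique

theorem isInternal_diagonal : IsInternal {p : N.Obj (prod σ σ) | fst p = snd p} := by
  refine isInternal_setOf_of_eventually (σ := nat) (0 : N.HNat)
    (fun (p : σ.Carrier × σ.Carrier) _ => p.1 = p.2) fun t f _ _ => ?_
  rw [fst_starFun, snd_starFun, starFun_eq_iff]

theorem biUnique_diagonal : BiUnique {p : N.Obj (prod σ σ) | fst p = snd p} := by
  refine biUnique_of_unique (fun h h' => ?_) fun h h' => ?_ <;>
    rw [Set.mem_ofPred_eq, fst_pair, snd_pair] at h h'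
  exacts [h.symm.trans h', h.trans h'.symm]

/-- The graph of `x ↦ x + a - b`, written as `y + b = x + a` to avoid truncated subtraction. -/
def translation (a b : N.HNat) : Set (N.Obj (prod nat nat)) :=
  {p | (snd p : N.HNat) + b = (fst p : N.HNat) + a}

@[simp] theorem pair_mem_translation {a b x y : N.HNat} :
    N.pair x y ∈ translation a b ↔ y + b = x + a := by
  simp [translation]

theorem isInternal_translation (a b : N.HNat) : IsInternal (translation a b) := by
  refine isInternal_setOf_of_eventually₂ (σ₁ := nat) (σ₂ := nat) a b
    (fun (p : ℕ × ℕ) (m n : ℕ) => p.2 + n = p.1 + m) fun t f g k hg hk => ?_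
  rw [fst_starFun, snd_starFun, hg, hk]
  exact (iff_of_eq (congrArg₂ (· = ·) (natFun_add _ _ t) (natFun_add _ _ t))).trans natFun_eq_iff

theorem biUnique_translation (a b : N.HNat) : BiUnique (translation a b) := by
  refine biUnique_of_unique (fun h h' => ?_) fun h h' => ?_ <;>
    rw [pair_mem_translation] at h h'
  exacts [add_right_cancel (h.trans h'.symm), add_right_cancel (h.symm.trans h')]

/-- `R` is the graph of a bijection of `S` onto `T`. -/
def IsBij (R : Set (N.Obj (prod σ τ))) (S : Set (N.Obj σ)) (T : Set (N.Obj τ)) : Prop :=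
  Set.BijOn fst R S ∧ Set.BijOn snd R T

section IsBij

variable {R : Set (N.Obj (prod σ τ))} {S : Set (N.Obj σ)} {T : Set (N.Obj τ)}

theorem IsBij.biUnique (h : IsBij R S T) : BiUnique R := ⟨h.1.injOn, h.2.injOn⟩

theorem IsBij.left_mem (h : IsBij R S T) {x : N.Obj σ} {y : N.Obj τ} (hxy : N.pair x y ∈ R) :
    x ∈ S :=
  fst_pair x y ▸ h.1.mapsTo hxy

theorem IsBij.right_mem (h : IsBij R S T) {x : N.Obj σ} {y : N.Obj τ} (hxy : N.pair x y ∈ R) :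
    y ∈ T :=
  snd_pair x y ▸ h.2.mapsTo hxy

theorem IsBij.exists_right (h : IsBij R S T) {x : N.Obj σ} (hx : x ∈ S) :
    ∃ y, N.pair x y ∈ R := by
  obtain ⟨p, hp, rfl⟩ := h.1.surjOn hx
  exact ⟨snd p, by rwa [pair_fst_snd]⟩

theorem IsBij.exists_left (h : IsBij R S T) {y : N.Obj τ} (hy : y ∈ T) :
    ∃ x, N.pair x y ∈ R := by
  obtain ⟨p, hp, rfl⟩ := h.2.surjOn hy
  exact ⟨fst p, by rwa [pair_fst_snd]⟩

theorem isBij_iff : IsBij R S T ↔ BiUnique R ∧ (∀ x, x ∈ S ↔ ∃ y, N.pair x y ∈ R) ∧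
    ∀ y, y ∈ T ↔ ∃ x, N.pair x y ∈ R := by
  refine ⟨fun h => ⟨h.biUnique, fun x => ⟨h.exists_right, fun ⟨y, hxy⟩ => h.left_mem hxy⟩,
    fun y => ⟨h.exists_left, fun ⟨x, hxy⟩ => h.right_mem hxy⟩⟩, fun ⟨h, hS, hT⟩ => ?_⟩
  refine ⟨⟨fun p hp => (hS _).2 ⟨snd p, ?_⟩, h.1, fun x hx => ?_⟩,
    ⟨fun p hp => (hT _).2 ⟨fst p, ?_⟩, h.2, fun y hy => ?_⟩⟩
  · rwa [pair_fst_snd]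
  · obtain ⟨y, hy⟩ := (hS x).1 hx
    exact ⟨_, hy, fst_pair x y⟩
  · rwa [pair_fst_snd]
  · obtain ⟨x, hx⟩ := (hT y).1 hy
    exact ⟨_, hx, snd_pair x y⟩

theorem IsBij.relInv (h : IsBij R S T) : IsBij (relInv R) T S := by
  rw [isBij_iff] at h ⊢
  simp only [pair_mem_relInv]
  exact ⟨h.1.relInv, h.2.2, h.2.1⟩

theorem IsBij.restrict (h : IsBij R S T) {A : Set (N.Obj σ)} (hA : A ⊆ S) :
    IsBij (fst ⁻¹' A ∩ R) A (NonstandardUniverse.relImage R A) := by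
  refine isBij_iff.2 ⟨⟨h.1.injOn.mono Set.inter_subset_right, h.2.injOn.mono
    Set.inter_subset_right⟩, fun x => ⟨fun hx => ?_, fun ⟨y, hxy⟩ => ?_⟩, fun y => ?_⟩
  · obtain ⟨y, hxy⟩ := h.exists_right (hA hx)
    exact ⟨y, by rwa [Set.mem_preimage, fst_pair], hxy⟩
  · exact fst_pair x y ▸ hxy.1
  · simp only [NonstandardUniverse.relImage, Set.mem_ofPred_eq, Set.mem_inter_iff,
      Set.mem_preimage, fst_pair]

theorem IsBij.union {R' : Set (N.Obj (prod σ τ))} {S' : Set (N.Obj σ)} {T' : Set (N.Obj τ)}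
    (h : IsBij R S T) (h' : IsBij R' S' T') (hS : Disjoint S S') (hT : Disjoint T T') :
    IsBij (R ∪ R') (S ∪ S') (T ∪ T') := by
  have hinjOn : ∀ {ρ : FinType} {f : N.Obj (prod σ τ) → N.Obj ρ} {U U' : Set (N.Obj ρ)},
      Set.BijOn f R U → Set.BijOn f R' U' → Disjoint U U' → Set.InjOn f (R ∪ R') := by
    rintro ρ f U U' hU hU' hdisj p (hp | hp) q (hq | hq) hpq
    · exact hU.injOn hp hq hpq
    · exact absurd (hpq ▸ hU'.mapsTo hq) (Set.disjoint_left.1 hdisj (hU.mapsTo hp))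
    · exact absurd (hU'.mapsTo hp) (Set.disjoint_left.1 hdisj (hpq ▸ hU.mapsTo hq))
    · exact hU'.injOn hp hq hpq
  exact ⟨h.1.union h'.1 (hinjOn h.1 h'.1 hS), h.2.union h'.2 (hinjOn h.2 h'.2 hT)⟩

end IsBij

theorem IsBij.relComp {R : Set (N.Obj (prod σ τ))} {Q : Set (N.Obj (prod τ ρ))} {S : Set (N.Obj σ)}
    {T U : Set (N.Obj τ)} {V : Set (N.Obj ρ)} (hR : IsBij R S T) (hTU : T ⊆ U) (hQ : IsBij Q U V) :
    IsBij (relComp R Q) S (NonstandardUniverse.relImage Q T) := by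
  refine isBij_iff.2 ⟨hR.biUnique.relComp hQ.biUnique, fun x => ?_, fun z => ?_⟩
  · simp only [pair_mem_relComp]
    refine ⟨fun hx => ?_, fun ⟨_, y, hxy, _⟩ => hR.left_mem hxy⟩
    obtain ⟨y, hxy⟩ := hR.exists_right hx
    obtain ⟨z, hyz⟩ := hQ.exists_right (hTU (hR.right_mem hxy))
    exact ⟨z, y, hxy, hyz⟩
  · simp only [pair_mem_relComp]
    refine ⟨fun ⟨y, hy, hyz⟩ => ?_, fun ⟨x, y, hxy, hyz⟩ => ⟨y, hR.right_mem hxy, hyz⟩⟩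
    obtain ⟨x, hxy⟩ := hR.exists_left hy
    exact ⟨x, y, hxy, hyz⟩

/-- The standard counterpart of `IsBij`. -/
def StdBij (r : Set (σ.Carrier × τ.Carrier)) (S : Set σ.Carrier) (T : Set τ.Carrier) : Prop :=
  Set.BijOn Prod.fst r S ∧ Set.BijOn Prod.snd r T

theorem isBij_relFun {r : ρ.Carrier → Set (σ.Carrier × τ.Carrier)} {F : ρ.Carrier → Set σ.Carrier}
    {G : ρ.Carrier → Set τ.Carrier} {t : N.Obj ρ} :
    IsBij (N.elems (N.relFun r t)) (N.elems (N.setFun F t)) (N.elems (N.setFun G t)) ↔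
      ∀ᶠ i in N.ult t, StdBij (r i) (F i) (G i) :=
  (and_congr (bijOn_elems_setFun (τ := prod σ τ)) (bijOn_elems_setFun (τ := prod σ τ))).trans
    eventually_and.symm

theorem isInternal_isBij {S : Set (N.Obj σ)} {T : Set (N.Obj τ)} (hS : IsInternal S)
    (hT : IsInternal T) : IsInternal {R : N.Obj (pow (prod σ τ)) | IsBij (N.elems R) S T} := by
  obtain ⟨A, rfl⟩ := hS
  obtain ⟨B, rfl⟩ := hT
  exact isInternal_setOf_of_eventually₂ (σ₁ := pow σ) (σ₂ := pow τ) (τ := pow (prod σ τ)) A B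
    (fun (r : Set (σ.Carrier × τ.Carrier)) (F : Set σ.Carrier) (G : Set τ.Carrier) => StdBij r F G)
    fun _ _ _ _ hA hB => hA ▸ hB ▸ isBij_relFun

end NonstandardUniverse

/-! ### Internal cardinalities -/

namespace NonstandardUniverse

open FinType TypedStructure Filter

variable {N : NonstandardUniverse.{u}} {σ τ ρ : FinType}

/-- `S` is an internal set with at most `d` elements, in the sense of the nonstandard universe. -/
def CardLE (S : Set (N.Obj σ)) (d : N.HNat) : Prop :=
  ∃ A, N.elems A = S ∧ N.Mem (N.pair A d) (N.starSet (σ := prod (pow σ) nat)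
    {p : Set σ.Carrier × ℕ | p.1.encard ≤ p.2})

/-- `S` is an internal set with exactly `d` elements, in the sense of the nonstandard universe. -/
def HasCard (S : Set (N.Obj σ)) (d : N.HNat) : Prop :=
  ∃ A, N.elems A = S ∧ N.Mem (N.pair A d) (N.starSet (σ := prod (pow σ) nat)
    {p : Set σ.Carrier × ℕ | p.1.encard = p.2})

theorem cardLE_setFun {F : ρ.Carrier → Set σ.Carrier} {f : ρ.Carrier → ℕ} {t : N.Obj ρ} :
    CardLE (N.elems (N.setFun F t)) (N.natFun f t) ↔ ∀ᶠ i in N.ult t, (F i).encard ≤ f i := by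
  have h := N.pair_mem_starSet_starFun (τ := pow σ) (ρ := nat)
    {p : Set σ.Carrier × ℕ | p.1.encard ≤ p.2} F f t
  refine ⟨fun ⟨A, hA, hmem⟩ => ?_, fun hF => ⟨_, rfl, h.2 hF⟩⟩
  rw [elems_injective hA] at hmem
  exact h.1 hmem

theorem hasCard_setFun {F : ρ.Carrier → Set σ.Carrier} {f : ρ.Carrier → ℕ} {t : N.Obj ρ} :
    HasCard (N.elems (N.setFun F t)) (N.natFun f t) ↔ ∀ᶠ i in N.ult t, (F i).encard = f i := by
  have h := N.pair_mem_starSet_starFun (τ := pow σ) (ρ := nat)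
    {p : Set σ.Carrier × ℕ | p.1.encard = p.2} F f t
  refine ⟨fun ⟨A, hA, hmem⟩ => ?_, fun hF => ⟨_, rfl, h.2 hF⟩⟩
  rw [elems_injective hA] at hmem
  exact h.1 hmem

theorem CardLE.isInternal {S : Set (N.Obj σ)} {d : N.HNat} (h : CardLE S d) : IsInternal S :=
  ⟨h.choose, h.choose_spec.1⟩

theorem HasCard.isInternal {S : Set (N.Obj σ)} {d : N.HNat} (h : HasCard S d) : IsInternal S :=
  ⟨h.choose, h.choose_spec.1⟩

theorem exists_setFun_natFun (A : N.Obj (pow σ)) (x : N.HNat) : ∃ (ρ : FinType) (t : N.Obj ρ)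
    (F : ρ.Carrier → Set σ.Carrier) (f : ρ.Carrier → ℕ), A = N.setFun F t ∧ x = N.natFun f t :=
  exists_starFun₂ A x

theorem exists_setFun₂_natFun₂ (A : N.Obj (pow σ)) (B : N.Obj (pow τ)) (x y : N.HNat) :
    ∃ (ρ : FinType) (t : N.Obj ρ) (F : ρ.Carrier → Set σ.Carrier) (G : ρ.Carrier → Set τ.Carrier)
      (f g : ρ.Carrier → ℕ),
      A = N.setFun F t ∧ B = N.setFun G t ∧ x = N.natFun f t ∧ y = N.natFun g t :=
  exists_starFun₄ A B x y

theorem HasCard.cardLE {S : Set (N.Obj σ)} {d : N.HNat} (h : HasCard S d) : CardLE S d := by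
  obtain ⟨A, rfl⟩ := h.isInternal
  obtain ⟨ρ, t, F, f, rfl, rfl⟩ := exists_setFun_natFun A d
  rw [hasCard_setFun] at h
  exact cardLE_setFun.2 (h.mono fun i h => h.le)

theorem CardLE.union {S T : Set (N.Obj σ)} {x y : N.HNat} (hS : CardLE S x) (hT : CardLE T y) :
    CardLE (S ∪ T) (x + y) := by
  obtain ⟨A, rfl⟩ := hS.isInternal
  obtain ⟨B, rfl⟩ := hT.isInternal
  obtain ⟨ρ, t, F, G, f, g, rfl, rfl, rfl, rfl⟩ := exists_setFun₂_natFun₂ A B x y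
  rw [← elems_setFun_union, natFun_add, cardLE_setFun]
  rw [cardLE_setFun] at hS hT
  filter_upwards [hS, hT] with i hF hG
  push_cast
  exact (Set.encard_union_le _ _).trans (add_le_add hF hG)

theorem HasCard.union {S T : Set (N.Obj σ)} {x y : N.HNat} (hS : HasCard S x) (hT : HasCard T y)
    (h : Disjoint S T) : HasCard (S ∪ T) (x + y) := by
  obtain ⟨A, rfl⟩ := hS.isInternal
  obtain ⟨B, rfl⟩ := hT.isInternal
  obtain ⟨ρ, t, F, G, f, g, rfl, rfl, rfl, rfl⟩ := exists_setFun₂_natFun₂ A B x y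
  have hdisj : ∀ᶠ i in N.ult t, F i \ G i = F i := by
    rw [← elems_setFun_eq, elems_setFun_diff, h.sdiff_eq_left]
  rw [← elems_setFun_union, natFun_add, hasCard_setFun]
  rw [hasCard_setFun] at hS hT
  filter_upwards [hS, hT, hdisj] with i hF hG hFG
  rw [Set.encard_union_eq (sdiff_eq_left.1 hFG), hF, hG, Nat.cast_add]

theorem CardLE.mono {S T : Set (N.Obj σ)} {x y : N.HNat} (hS : CardLE S x) (hT : IsInternal T)
    (h : T ⊆ S) (hxy : x ≤ y) : CardLE T y := by
  obtain ⟨A, rfl⟩ := hS.isInternal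
  obtain ⟨B, rfl⟩ := hT
  obtain ⟨ρ, t, F, G, f, g, rfl, rfl, rfl, rfl⟩ := exists_setFun₂_natFun₂ A B x y
  rw [cardLE_setFun] at hS ⊢
  rw [elems_setFun_subset] at h
  rw [natFun_le] at hxy
  filter_upwards [hS, h, hxy] with i hF hGF hfg
  exact (Set.encard_le_encard hGF).trans (hF.trans (by exact_mod_cast hfg))

theorem CardLE.mono_right {S : Set (N.Obj σ)} {x y : N.HNat} (hS : CardLE S x)
    (hxy : x ≤ y) : CardLE S y :=
  hS.mono hS.isInternal subset_rfl hxy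

theorem CardLE.exists_hasCard {S : Set (N.Obj σ)} {x : N.HNat} (hS : CardLE S x) :
    ∃ y ≤ x, HasCard S y := by
  obtain ⟨A, rfl⟩ := hS.isInternal
  obtain ⟨ρ, t, F, f, rfl, rfl⟩ := exists_setFun_natFun A x
  rw [cardLE_setFun] at hS
  refine ⟨N.natFun (fun i => (F i).ncard) t, ?_, ?_⟩
  · rw [natFun_le]
    filter_upwards [hS] with i hi
    rw [← (Set.finite_of_encard_le_coe hi).cast_ncard_eq] at hi
    exact_mod_cast hi
  · rw [hasCard_setFun]
    filter_upwards [hS] with i hi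
    exact (Set.finite_of_encard_le_coe hi).cast_ncard_eq.symm

theorem HasCard.le_of_subset {S T : Set (N.Obj σ)} {x y : N.HNat} (hS : HasCard S x)
    (hT : CardLE T y) (h : S ⊆ T) : x ≤ y := by
  obtain ⟨A, rfl⟩ := hS.isInternal
  obtain ⟨B, rfl⟩ := hT.isInternal
  obtain ⟨ρ, t, F, G, f, g, rfl, rfl, rfl, rfl⟩ := exists_setFun₂_natFun₂ A B x y
  rw [cardLE_setFun] at hT
  rw [hasCard_setFun] at hS
  rw [elems_setFun_subset] at h
  rw [natFun_le]
  filter_upwards [hS, h, hT] with i hF hFG hG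
  exact_mod_cast hF.symm.trans_le ((Set.encard_le_encard hFG).trans hG)

theorem HasCard.unique {S : Set (N.Obj σ)} {x y : N.HNat} (hx : HasCard S x) (hy : HasCard S y) :
    x = y :=
  le_antisymm (hx.le_of_subset hy.cardLE subset_rfl) (hy.le_of_subset hx.cardLE subset_rfl)

theorem HasCard.diff {S T : Set (N.Obj σ)} {x y : N.HNat} (hS : HasCard S x) (hT : HasCard T y)
    (h : S ⊆ T) : HasCard (T \ S) (y - x) := by
  obtain ⟨z, -, hz⟩ := (hT.cardLE.mono (hT.isInternal.diff hS.isInternal)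
    Set.sdiff_subset le_rfl).exists_hasCard
  have hunion := hz.union hS disjoint_sdiff_self_left
  rw [Set.sdiff_union_of_subset h] at hunion
  rwa [hT.unique hunion, add_tsub_cancel_right]

theorem exists_hasCard_of_not_cardLE {S : Set (N.Obj σ)} {d : N.HNat} (hS : IsInternal S)
    (h : ¬ CardLE S d) : ∃ T ⊆ S, HasCard T (d + 1) := by
  obtain ⟨A, rfl⟩ := hS
  obtain ⟨ρ, t, F, f, rfl, rfl⟩ := exists_setFun_natFun A d
  rw [cardLE_setFun, ← Ultrafilter.eventually_not] at h
  have hsub : ∀ᶠ i in N.ult t, ∃ B ⊆ F i, B.encard = (f i + 1 : ℕ) := h.mono fun i hi => by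
    refine Set.exists_subset_encard_eq ?_
    rw [Nat.cast_add, Nat.cast_one]
    exact Order.add_one_le_of_lt (not_le.1 hi)
  obtain ⟨G, hG⟩ := exists_eventually_mem_of_eventually_nonempty (τ := pow σ)
    (R := fun i => {B : Set σ.Carrier | B ⊆ F i ∧ B.encard = (f i + 1 : ℕ)}) hsub
  refine ⟨N.elems (N.setFun G t), elems_setFun_subset.2 (hG.mono fun i hi => hi.1), ?_⟩
  rw [one_eq_natFun t, natFun_add]
  exact hasCard_setFun.2 (hG.mono fun i hi => hi.2)

theorem HasCard.exists_subset {S : Set (N.Obj σ)} {x y : N.HNat} (hS : HasCard S y) (h : x ≤ y) :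
    ∃ T ⊆ S, HasCard T x := by
  rcases eq_or_ne x 0 with rfl | hx
  · refine ⟨∅, Set.empty_subset _, ?_⟩
    simpa only [Set.sdiff_self, tsub_self] using hS.diff hS subset_rfl
  · have hpred : x - 1 + 1 = x := tsub_add_cancel_of_le (Order.one_le_iff_ne_zero.2 hx)
    rw [← hpred]
    refine exists_hasCard_of_not_cardLE hS.isInternal fun hcard => ?_
    exact (lt_add_one (x - 1)).not_ge (hpred.trans_le (h.trans (hS.le_of_subset hcard subset_rfl)))

theorem HasCard.exists_between {S T : Set (N.Obj σ)} {x y : N.HNat} (hS : HasCard S x)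
    (hT : HasCard T y) (h : x ≤ y) : ∃ D, S ⊆ D ∧ D ⊆ S ∪ T ∧ HasCard D y := by
  obtain ⟨z, -, hz⟩ := (hT.cardLE.mono (hT.isInternal.diff hS.isInternal)
    Set.sdiff_subset le_rfl).exists_hasCard
  have hle : y ≤ x + z := by
    refine hT.le_of_subset (hS.cardLE.union hz.cardLE) ?_
    rw [Set.union_sdiff_self]
    exact Set.subset_union_right
  obtain ⟨E, hE, hEcard⟩ := hz.exists_subset (x := y - x) (tsub_le_iff_left.2 hle)
  refine ⟨S ∪ E, Set.subset_union_left,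
    Set.union_subset_union_right _ (hE.trans Set.sdiff_subset), ?_⟩
  have hunion := hS.union hEcard (Set.disjoint_left.2 fun a ha haE => (hE haE).2 ha)
  rwa [add_tsub_cancel_of_le h] at hunion

theorem isInternal_hasCard (d : N.HNat) : IsInternal {A : N.Obj (pow σ) | HasCard (N.elems A) d} :=
  isInternal_setOf_of_eventually (τ := pow σ) (σ := nat) d
    (fun (F : Set σ.Carrier) (n : ℕ) => F.encard = n) fun _ _ _ hd => hd ▸ hasCard_setFun

theorem isInternal_cardLE_diff {S : Set (N.Obj σ)} (hS : IsInternal S) (d : N.HNat) :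
    IsInternal {A : N.Obj (pow σ) | CardLE (N.elems A \ S) d} := by
  obtain ⟨B, rfl⟩ := hS
  refine isInternal_setOf_of_eventually₂ (τ := pow σ) (σ₁ := pow σ) (σ₂ := nat) B d
    (fun (F G : Set σ.Carrier) (n : ℕ) => (F \ G).encard ≤ n) fun t F G f hG hf => ?_
  rw [hG, hf]
  exact (iff_of_eq (congrArg (CardLE · _) (elems_setFun_diff F G t).symm)).trans cardLE_setFun

theorem isInternal_cardLE (d : N.HNat) : IsInternal {A : N.Obj (pow σ) | CardLE (N.elems A) d} := by
  simpa only [Set.sdiff_empty] using isInternal_cardLE_diff (isInternal_empty (N := N)) d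

theorem elems_setFun_Ico (f g : ρ.Carrier → ℕ) (t : N.Obj ρ) :
    N.elems (N.setFun (τ := nat) (fun i => (Set.Ico (f i) (g i) : Set ℕ)) t) =
      Set.Ico (N.natFun f t) (N.natFun g t) := by
  ext x
  obtain ⟨ρ', t', π, h, rfl, rfl⟩ : ∃ (ρ' : FinType) (t' : N.Obj ρ') (π : ρ'.Carrier → ρ.Carrier)
    (h : ρ'.Carrier → ℕ), t = N.starFun π t' ∧ x = N.natFun h t' := exists_starFun₂ t x
  simp only [natFun_starFun, Set.mem_Ico, natFun_le, natFun_lt, ← eventually_and]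
  rw [N.setFun_starFun (ρ := nat) (fun i => (Set.Ico (f i) (g i) : Set ℕ))]
  exact starFun_mem_elems_setFun (τ := nat)

theorem hasCard_Ico (a d : N.HNat) : HasCard (Set.Ico a (a + d)) d := by
  obtain ⟨ρ, t, f, g, rfl, rfl⟩ := exists_natFun₂ a d
  rw [natFun_add, ← elems_setFun_Ico]
  refine (hasCard_setFun (σ := nat)).2 (.of_forall fun i => ?_)
  change (Set.Ico (f i) (f i + g i)).encard = _
  rw [← Finset.coe_Ico, Set.encard_coe_eq_coe_finsetCard, Nat.card_Ico, add_tsub_cancel_left]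

theorem hasCard_Iio (d : N.HNat) : HasCard (Set.Iio d) d := by
  have hIco : Set.Ico 0 d = Set.Iio d := Set.ext fun x => and_iff_right zero_le
  simpa only [zero_add, hIco] using hasCard_Ico 0 d

theorem exists_stdBij {S : Set σ.Carrier} {T : Set τ.Carrier} (e : S ≃ T) :
    ∃ r, StdBij r S T := by
  refine ⟨Set.range fun x : S => (x.1, (e x).1), ⟨?_, ?_, ?_⟩, ⟨?_, ?_, ?_⟩⟩
  · rintro _ ⟨x, rfl⟩
    exact x.2
  · rintro _ ⟨x, rfl⟩ _ ⟨y, rfl⟩ hxy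
    rw [Subtype.ext hxy]
  · exact fun x hx => ⟨_, ⟨⟨x, hx⟩, rfl⟩, rfl⟩
  · rintro _ ⟨x, rfl⟩
    exact (e x).2
  · rintro _ ⟨x, rfl⟩ _ ⟨y, rfl⟩ hxy
    rw [e.injective (Subtype.ext hxy)]
  · exact fun y hy => ⟨_, ⟨e.symm ⟨y, hy⟩, rfl⟩, congrArg Subtype.val (e.apply_symm_apply ⟨y, hy⟩)⟩

theorem exists_isBij_setFun {F : ρ.Carrier → Set σ.Carrier} {G : ρ.Carrier → Set τ.Carrier}
    {t : N.Obj ρ} (h : ∀ᶠ i in N.ult t, Nonempty (F i ≃ G i)) :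
    ∃ R, IsInternal R ∧ IsBij R (N.elems (N.setFun F t)) (N.elems (N.setFun G t)) := by
  obtain ⟨r, hr⟩ := exists_eventually_mem_of_eventually_nonempty (τ := pow (prod σ τ))
    (R := fun i => {r : Set (σ.Carrier × τ.Carrier) | StdBij r (F i) (G i)})
    (h.mono fun i ⟨e⟩ => exists_stdBij e)
  exact ⟨N.elems (N.relFun r t), isInternal_elems _, isBij_relFun.2 hr⟩

theorem nonempty_equiv_of_encard_eq {α β : Type*} {S : Set α} {T : Set β} {n : ℕ}
    (hS : S.encard = n) (hT : T.encard = n) : Nonempty (S ≃ T) := by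
  have := (Set.finite_of_encard_eq_coe hS).to_subtype
  have := (Set.finite_of_encard_eq_coe hT).to_subtype
  rw [← Finite.card_eq, Nat.card_coe_set_eq, Nat.card_coe_set_eq, Set.ncard_def, Set.ncard_def,
    hS, hT]

theorem nonempty_equiv_of_infinite {S T : Set ℕ} (hS : S.Infinite) (hT : T.Infinite) :
    Nonempty (S ≃ T) := by
  have := hS.to_subtype
  have := hT.to_subtype
  exact nonempty_equiv_of_countable

theorem HasCard.exists_isBij {S : Set (N.Obj σ)} {T : Set (N.Obj τ)} {d : N.HNat}
    (hS : HasCard S d) (hT : HasCard T d) : ∃ R, IsInternal R ∧ IsBij R S T := by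
  obtain ⟨A, rfl⟩ := hS.isInternal
  obtain ⟨B, rfl⟩ := hT.isInternal
  obtain ⟨ρ, t, F, G, f, g, rfl, rfl, rfl, -⟩ := exists_setFun₂_natFun₂ A B d d
  rw [hasCard_setFun] at hS hT
  refine exists_isBij_setFun ?_
  filter_upwards [hS, hT] with i hF hG using nonempty_equiv_of_encard_eq hF hG

theorem forall_not_cardLE_setFun {F : ρ.Carrier → Set σ.Carrier} {t : N.Obj ρ} :
    (∀ d, ¬ CardLE (N.elems (N.setFun F t)) d) ↔ ∀ᶠ i in N.ult t, (F i).Infinite := by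
  constructor
  · intro h
    refine Ultrafilter.eventually_not.2 fun hfin => ?_
    exact h (N.natFun (fun i => (F i).ncard) t)
      (cardLE_setFun.2 (hfin.mono fun i hi => hi.cast_ncard_eq.ge))
  · intro hinf d hd
    obtain ⟨ρ', t', π, f, rfl, rfl⟩ : ∃ (ρ' : FinType) (t' : N.Obj ρ') (π : ρ'.Carrier → ρ.Carrier)
      (f : ρ'.Carrier → ℕ), t = N.starFun π t' ∧ d = N.natFun f t' := exists_starFun₂ t d
    rw [setFun_starFun, cardLE_setFun] at hd
    rw [ult_starFun] at hinf
    have hinf' : ∀ᶠ i in N.ult t', (F (π i)).Infinite := hinf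
    obtain ⟨i, hle, hi⟩ := (hd.and hinf').exists
    exact hi (Set.finite_of_encard_le_coe hle)

theorem exists_isBij_univ {S : Set N.HNat} (hS : IsInternal S) (h : ∀ d, ¬ CardLE S d) :
    ∃ R, IsInternal R ∧ IsBij R S (Set.univ : Set N.HNat) := by
  obtain ⟨A, rfl⟩ := hS
  obtain ⟨ρ, t, F, f, rfl, -⟩ := exists_setFun_natFun A 0
  rw [forall_not_cardLE_setFun] at h
  rw [← elems_setFun_univ t]
  exact exists_isBij_setFun (h.mono fun i hi => nonempty_equiv_of_infinite hi Set.infinite_univ)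

theorem isInternal_forall_not_cardLE :
    IsInternal {A : N.Obj (pow σ) | ∀ d, ¬ CardLE (N.elems A) d} :=
  isInternal_setOf_of_eventually (τ := pow σ) (σ := nat) (0 : N.HNat)
    (fun (F : Set σ.Carrier) _ => F.Infinite) fun _ _ _ _ => forall_not_cardLE_setFun

theorem CardLE.image {S : Set (N.Obj σ)} {d : N.HNat} (h : CardLE S d)
    (f : σ.Carrier → τ.Carrier) : CardLE (N.starFun f '' S) d := by
  obtain ⟨A, rfl⟩ := h.isInternal
  obtain ⟨ρ, t, F, g, rfl, rfl⟩ := exists_setFun_natFun A d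
  rw [cardLE_setFun] at h
  rw [← elems_setFun_image, cardLE_setFun]
  exact h.mono fun i hi => (Set.encard_image_le _ _).trans hi

theorem CardLE.of_image {S : Set (N.Obj σ)} {d : N.HNat} {f : σ.Carrier → τ.Carrier}
    (h : CardLE (N.starFun f '' S) d) (hS : IsInternal S) (hf : Set.InjOn (N.starFun f) S) :
    CardLE S d := by
  obtain ⟨A, rfl⟩ := hS
  obtain ⟨ρ, t, F, g, rfl, rfl⟩ := exists_setFun_natFun A d
  rw [← elems_setFun_image, cardLE_setFun] at h
  rw [injOn_elems_setFun] at hf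
  rw [cardLE_setFun]
  filter_upwards [h, hf] with i hle hinj
  rwa [hinj.encard_image] at hle

end NonstandardUniverse

/-! ### Borel sets and their approximation by internal sets -/

namespace NonstandardUniverse

open FinType Filter

variable {N : NonstandardUniverse.{u}} {σ : FinType}

theorem IsInternal.isBorel {S : Set (N.Obj σ)} (h : IsInternal S) : N.IsBorel S :=
  MeasurableSpace.measurableSet_generateFrom h

theorem IsBorel.compl {S : Set (N.Obj σ)} (h : N.IsBorel S) : N.IsBorel Sᶜ :=
  @MeasurableSet.compl _ _ (MeasurableSpace.generateFrom _) h

theorem IsBorel.iUnion {S : ℕ → Set (N.Obj σ)} (h : ∀ n, N.IsBorel (S n)) :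
    N.IsBorel (⋃ n, S n) :=
  @MeasurableSet.iUnion _ _ (MeasurableSpace.generateFrom _) _ _ h

theorem IsBorel.iInter {S : ℕ → Set (N.Obj σ)} (h : ∀ n, N.IsBorel (S n)) :
    N.IsBorel (⋂ n, S n) :=
  @MeasurableSet.iInter _ _ (MeasurableSpace.generateFrom _) _ _ h

theorem IsBorel.inter {S T : Set (N.Obj σ)} (h : N.IsBorel S) (h' : N.IsBorel T) :
    N.IsBorel (S ∩ T) :=
  @MeasurableSet.inter _ (MeasurableSpace.generateFrom _) _ _ h h'

theorem IsBorel.diff {S T : Set (N.Obj σ)} (h : N.IsBorel S) (h' : N.IsBorel T) :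
    N.IsBorel (S \ T) :=
  @MeasurableSet.diff _ (MeasurableSpace.generateFrom _) _ _ h h'

@[elab_as_elim]
theorem IsBorel.induction {P : ∀ S : Set (N.Obj σ), N.IsBorel S → Prop}
    (isInternal : ∀ S (hS : IsInternal S), P S hS.isBorel)
    (compl : ∀ S (hS : N.IsBorel S), P S hS → P Sᶜ hS.compl)
    (iUnion : ∀ (S : ℕ → Set (N.Obj σ)) (hS : ∀ n, N.IsBorel (S n)), (∀ n, P (S n) (hS n)) →
      P (⋃ n, S n) (IsBorel.iUnion hS))
    {S : Set (N.Obj σ)} (hS : N.IsBorel S) : P S hS :=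
  MeasurableSpace.generateFrom_induction _ P (fun S hS _ => isInternal S hS)
    (isInternal _ isInternal_empty) compl iUnion S hS

theorem IsBorel.exists_determining {X : Set (N.Obj σ)} (hX : N.IsBorel X) :
    ∃ A : ℕ → Set (N.Obj σ), (∀ n, IsInternal (A n)) ∧
      ∀ x y, (∀ n, x ∈ A n ↔ y ∈ A n) → (x ∈ X ↔ y ∈ X) := by
  induction hX using IsBorel.induction with
  | isInternal S hS => exact ⟨fun _ => S, fun _ => hS, fun x y h => h 0⟩
  | compl S _ ih =>
    obtain ⟨A, hA, h⟩ := ih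
    exact ⟨A, hA, fun x y hxy => not_congr (h x y hxy)⟩
  | iUnion S _ ih =>
    choose A hA h using ih
    refine ⟨fun n => A n.unpair.1 n.unpair.2, fun n => hA _ _, fun x y hxy => ?_⟩
    simp only [Set.mem_iUnion]
    refine exists_congr fun n => h n x y fun m => ?_
    simpa only [Nat.unpair_pair] using hxy (Nat.pair n m)

/-- The atom of the algebra generated by `A 0, …, A (n - 1)` whose points lie in `A k` exactly for
`k ∈ s`; a point of `⋂ n, atom A s n` is thus known up to the internal sets `A k`. -/
def atom (A : ℕ → Set (N.Obj σ)) (s : Set ℕ) (n : ℕ) : Set (N.Obj σ) :=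
  {y | ∀ k < n, (k ∈ s ↔ y ∈ A k)}

theorem antitone_atom (A : ℕ → Set (N.Obj σ)) (s : Set ℕ) : Antitone (atom A s) :=
  fun _ _ hmn _ hy k hk => hy k (hk.trans_le hmn)

theorem isInternal_atom {A : ℕ → Set (N.Obj σ)} (hA : ∀ n, IsInternal (A n)) (s : Set ℕ) (n : ℕ) :
    IsInternal (atom A s n) := by
  have hcompl : atom A s n = (⋃ k < n, {y | ¬ (k ∈ s ↔ y ∈ A k)})ᶜ := by
    ext y
    simp only [atom, Set.mem_ofPred_eq, Set.mem_compl_iff, Set.mem_iUnion, not_exists, not_not]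
  rw [hcompl]
  refine (isInternal_iUnion_lt (fun k => ?_) n).compl
  by_cases hk : k ∈ s
  · simp only [hk, true_iff]
    exact (hA k).compl
  · simp only [hk, false_iff, not_not]
    exact hA k

theorem atom_inter_Iio (A : ℕ → Set (N.Obj σ)) (s : Set ℕ) (n : ℕ) :
    atom A (s ∩ Set.Iio n) n = atom A s n := by
  ext y
  exact forall₂_congr fun k hk => by rw [Set.mem_inter_iff, Set.mem_Iio, and_iff_left hk]

theorem IsBorel.exists_cover_or_exists_iInter_subset {X : Set (N.Obj σ)} (hX : N.IsBorel X)
    {P : Set (N.Obj σ) → Prop} (hP : P ∅) :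
    (∃ E : ℕ → Set (N.Obj σ), (∀ n, IsInternal (E n)) ∧ (∀ n, P (E n)) ∧ X ⊆ ⋃ n, E n) ∨
      ∃ D : ℕ → Set (N.Obj σ), (∀ n, IsInternal (D n)) ∧ Antitone D ∧ (∀ n, ¬ P (D n)) ∧
        ⋂ n, D n ⊆ X := by
  obtain ⟨A, hA, hdet⟩ := hX.exists_determining
  by_cases h : ∃ x ∈ X, ∀ n, ¬ P (atom A {k | x ∈ A k} n)
  · obtain ⟨x, hx, hnot⟩ := h
    refine .inr ⟨_, isInternal_atom hA _, antitone_atom A _, hnot, fun y hy => ?_⟩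
    exact (hdet x y fun k => Set.mem_iInter.1 hy (k + 1) k k.lt_succ_self).1 hx
  · push Not at h
    -- Only countably many sets are atoms, since the `n`-th one is given by a finite set of indices.
    let 𝓒 : Set (Set (N.Obj σ)) :=
      insert ∅ ({S | P S} ∩ Set.range fun p : Finset ℕ × ℕ => atom A p.1 p.2)
    have h𝓒 : 𝓒.Countable := ((Set.countable_range _).mono Set.inter_subset_right).insert ∅
    obtain ⟨E, hE⟩ := h𝓒.exists_eq_range ⟨∅, Set.mem_insert _ _⟩
    have hmem : ∀ n, E n ∈ 𝓒 := fun n => hE ▸ Set.mem_range_self n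
    refine .inl ⟨E, fun n => ?_, fun n => ?_, fun x hx => ?_⟩
    · obtain hn | ⟨-, p, hp⟩ := hmem n
      · exact hn ▸ isInternal_empty
      · exact hp ▸ isInternal_atom hA _ _
    · obtain hn | ⟨hn, -⟩ := hmem n
      · exact hn ▸ hP
      · exact hn
    · obtain ⟨n, hn⟩ := h x hx
      have hfin : ({k | x ∈ A k} ∩ Set.Iio n).Finite :=
        (Set.finite_Iio n).subset Set.inter_subset_right
      have hrange : atom A {k | x ∈ A k} n ∈ 𝓒 :=
        .inr ⟨hn, (hfin.toFinset, n), by simp only [hfin.coe_toFinset, atom_inter_Iio]⟩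
      rw [hE] at hrange
      obtain ⟨m, hm⟩ := hrange
      exact Set.mem_iUnion.2 ⟨m, hm ▸ fun k _ => Iff.rfl⟩

theorem exists_hasCard_subset_iInter {D : ℕ → Set (N.Obj σ)} (hD : ∀ n, IsInternal (D n))
    (hanti : Antitone D) {d : N.HNat} (h : ∀ n, ∃ T ⊆ D n, HasCard T d) :
    ∃ T ⊆ ⋂ n, D n, HasCard T d := by
  obtain ⟨A, hA⟩ := exists_forall_mem_of_isInternal
    (S := fun n => {A : N.Obj (pow σ) | HasCard (N.elems A) d} ∩ {A | N.elems A ⊆ D n})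
    (fun n => (isInternal_hasCard d).inter (isInternal_subset (hD n))) fun n => by
      obtain ⟨T, hsub, hcard⟩ := h n
      obtain ⟨A, rfl⟩ := hcard.isInternal
      exact ⟨A, fun k hk => ⟨hcard, hsub.trans (hanti hk)⟩⟩
  exact ⟨N.elems A, Set.subset_iInter fun n => (hA n).2, (hA 0).1⟩

theorem exists_isInternal_superset_of_forall_cardLE {E : ℕ → Set (N.Obj σ)}
    (hE : ∀ n, IsInternal (E n)) {S H : Set (N.Obj σ)} (hS : IsInternal S) (hH : IsInternal H)
    (hEH : ∀ n, E n ⊆ H) {d : N.HNat} (h : ∀ n, CardLE ((⋃ i < n, E i) \ S) d) :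
    ∃ C, IsInternal C ∧ C ⊆ H ∧ (∀ n, E n ⊆ C) ∧ CardLE (C \ S) d := by
  obtain ⟨A, hA⟩ := exists_forall_mem_of_isInternal
    (S := fun n => {A : N.Obj (pow σ) | CardLE (N.elems A \ S) d} ∩
      ({A | N.elems A ⊆ H} ∩ {A | E n ⊆ N.elems A}))
    (fun n => (isInternal_cardLE_diff hS d).inter
      ((isInternal_subset hH).inter (isInternal_superset (hE n)))) fun n => by
      obtain ⟨A, hA⟩ := isInternal_iUnion_lt hE (n + 1)
      simp only [Set.mem_inter_iff, Set.mem_ofPred_eq]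
      refine ⟨A, fun k hk => ?_⟩
      rw [hA]
      exact ⟨h _, Set.iUnion₂_subset fun i _ => hEH i,
        Set.subset_biUnion_of_mem (u := E) (Nat.lt_succ_of_le hk)⟩
  exact ⟨N.elems A, isInternal_elems A, (hA 0).2.1, fun n => (hA n).2.2, (hA 0).1⟩

theorem exists_forall_natCast_mul_le_add {a : ℕ → N.HNat} {h : N.HNat} (ha : ∀ n, a n ≤ h) (p : ℕ) :
    ∃ k, ∀ m, k ≤ m → p * a m ≤ p * a k + h := by
  by_contra! hjump
  have hgrowth : ∀ j : ℕ, ∃ k, j * h ≤ p * a k := by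
    intro j
    induction j with
    | zero => exact ⟨0, by rw [Nat.cast_zero, zero_mul]; exact zero_le⟩
    | succ j ih =>
      obtain ⟨k, hk⟩ := ih
      obtain ⟨m, -, hm⟩ := hjump k
      refine ⟨m, ?_⟩
      rw [Nat.cast_succ, add_mul, one_mul]
      exact (add_le_add_left hk h).trans hm.le
  obtain ⟨k, hk⟩ := hgrowth p
  obtain ⟨m, -, hm⟩ := hjump k
  have hbound : (p : N.HNat) * a m ≤ p * h := mul_le_mul_of_nonneg_left (ha m) zero_le
  exact (hbound.trans (hk.trans le_self_add)).not_gt hm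

theorem cardLE_empty (d : N.HNat) : CardLE (∅ : Set (N.Obj σ)) d := by
  by_contra h
  obtain ⟨T, hT, hcard⟩ := exists_hasCard_of_not_cardLE isInternal_empty h
  rw [Set.subset_empty_iff] at hT
  subst hT
  have hzero := hcard.diff hcard subset_rfl
  rw [Set.sdiff_self, tsub_self] at hzero
  exact h (hzero.cardLE.mono_right zero_le)

theorem cardLE_iUnion_lt {E : ℕ → Set (N.Obj σ)} {e : ℕ → N.HNat} (h : ∀ n, CardLE (E n) (e n))
    (n : ℕ) : CardLE (⋃ i < n, E i) (∑ i ∈ Finset.range n, e i) := by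
  induction n with
  | zero =>
    simp only [not_lt_zero, Set.iUnion_of_empty, Set.iUnion_empty]
    exact cardLE_empty _
  | succ n ih =>
    rw [Set.biUnion_lt_succ, Finset.sum_range_succ]
    exact ih.union (h n)

theorem mul_sum_le_of_forall_mul_two_pow_le {p : ℕ} {h : N.HNat} {e : ℕ → N.HNat}
    (he : ∀ i, ((p * 2 ^ (i + 1) : ℕ) : N.HNat) * e i ≤ h) (n : ℕ) :
    p * ∑ i ∈ Finset.range n, e i ≤ h := by
  have hgeom : ((2 ^ n : ℕ) : N.HNat) * (p * ∑ i ∈ Finset.range n, e i) + h ≤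
      ((2 ^ n : ℕ) : N.HNat) * h := by
    induction n with
    | zero => simp
    | succ n ih =>
      calc ((2 ^ (n + 1) : ℕ) : N.HNat) * (p * ∑ i ∈ Finset.range (n + 1), e i) + h
          = 2 * (((2 ^ n : ℕ) : N.HNat) * (p * ∑ i ∈ Finset.range n, e i)) +
            ((p * 2 ^ (n + 1) : ℕ) : N.HNat) * e n + h := by
              rw [Finset.sum_range_succ]; push_cast; ring
        _ ≤ 2 * (((2 ^ n : ℕ) : N.HNat) * (p * ∑ i ∈ Finset.range n, e i)) + h + h := by
              gcongr; exact he n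
        _ = 2 * (((2 ^ n : ℕ) : N.HNat) * (p * ∑ i ∈ Finset.range n, e i) + h) := by ring
        _ ≤ 2 * (((2 ^ n : ℕ) : N.HNat) * h) := by gcongr
        _ = ((2 ^ (n + 1) : ℕ) : N.HNat) * h := by push_cast; ring
  exact le_of_mul_le_mul_left (le_self_add.trans hgeom) (by positivity)

theorem cardLE_iUnion_lt_diff {A B : ℕ → Set (N.Obj σ)} {a e : ℕ → N.HNat}
    (hA : ∀ m, HasCard (⋃ i < m, A i) (a m)) (hB : ∀ i, IsInternal (B i))
    (he : ∀ i, CardLE (B i \ A i) (e i)) {k m : ℕ} (hkm : k ≤ m) :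
    CardLE ((⋃ i < m, B i) \ ⋃ i < k, A i) (a m - a k + ∑ i ∈ Finset.range m, e i) := by
  have hmono : (⋃ i < k, A i) ⊆ ⋃ i < m, A i :=
    Set.biUnion_subset_biUnion_left fun i hi => lt_of_lt_of_le hi hkm
  refine (((hA k).diff (hA m) hmono).cardLE.union (cardLE_iUnion_lt he m)).mono
    ((isInternal_iUnion_lt hB m).diff (hA k).isInternal) ?_ le_rfl
  rintro x ⟨hx, hxA⟩
  obtain ⟨i, hi, hxi⟩ := Set.mem_iUnion₂.1 hx
  by_cases hxAi : x ∈ A i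
  · exact .inl ⟨Set.mem_iUnion₂.2 ⟨i, hi, hxAi⟩, hxA⟩
  · exact .inr (Set.mem_iUnion₂.2 ⟨i, hi, hxi, hxAi⟩)

/-- `X ⊆ H` is squeezed between internal sets which differ in at most the fraction `1 / n` of `h`
elements, for every standard `n`: with `h` the number of elements of `H`, this is measurability of
`X` with respect to the Loeb measure of the normalised counting measure on `H`. -/
def IsApproximable (h : N.HNat) (H X : Set (N.Obj σ)) : Prop :=
  ∀ n : ℕ, 0 < n → ∃ A B e, IsInternal A ∧ IsInternal B ∧ A ⊆ X ∧ X ⊆ B ∧ B ⊆ H ∧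
    CardLE (B \ A) e ∧ n * e ≤ h

theorem IsInternal.isApproximable {X H : Set (N.Obj σ)} (hX : IsInternal X) (hXH : X ⊆ H)
    (h : N.HNat) : IsApproximable h H X := by
  refine fun n _ => ⟨X, X, 0, hX, hX, subset_rfl, subset_rfl, hXH, ?_, ?_⟩
  · rw [Set.sdiff_self]
    exact cardLE_empty 0
  · rw [mul_zero]
    exact zero_le

theorem IsApproximable.diff {h : N.HNat} {H X : Set (N.Obj σ)} (hX : IsApproximable h H X)
    (hH : IsInternal H) : IsApproximable h H (H \ X) := by
  intro n hn
  obtain ⟨A, B, e, hA, hB, hAX, hXB, hBH, hcard, hle⟩ := hX n hn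
  refine ⟨H \ B, H \ A, e, hH.diff hB, hH.diff hA, Set.sdiff_subset_sdiff_right hXB,
    Set.sdiff_subset_sdiff_right hAX, Set.sdiff_subset, ?_, hle⟩
  rwa [sdiff_sdiff_sdiff_cancel_left hBH]

/-- The lower approximation of the union is the finite union at which the cardinalities of the
lower approximations stabilise up to a small fraction of `h`; the upper one comes from countable
saturation. -/
theorem IsApproximable.iUnion {h : N.HNat} {H : Set (N.Obj σ)} (hH : HasCard H h)
    {X : ℕ → Set (N.Obj σ)} (hX : ∀ i, IsApproximable h H (X i)) :
    IsApproximable h H (⋃ i, X i) := by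
  intro n hn
  choose A B e hA hB hAX hXB hBH hcard hle using
    fun i => hX i ((2 * n) * 2 ^ (i + 1)) (by positivity)
  have hAH : ∀ m, (⋃ i < m, A i) ⊆ H := fun m =>
    Set.iUnion₂_subset fun i _ => (hAX i).trans ((hXB i).trans (hBH i))
  choose a hah ha using fun m =>
    (hH.cardLE.mono (isInternal_iUnion_lt hA m) (hAH m) le_rfl).exists_hasCard
  obtain ⟨k, hk⟩ := exists_forall_natCast_mul_le_add hah (2 * n)
  obtain ⟨q, hq⟩ := exists_forall_natCast_mul_le_iff h hn
  have herror : ∀ m, k ≤ m → a m - a k + ∑ i ∈ Finset.range m, e i ≤ q := by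
    intro m hkm
    have hincrease : ((2 * n : ℕ) : N.HNat) * (a m - a k) ≤ h := by
      rw [mul_tsub, tsub_le_iff_left]
      exact hk m hkm
    rw [← hq]
    refine le_of_mul_le_mul_left (a := (2 : N.HNat)) ?_ (by positivity)
    calc 2 * (n * (a m - a k + ∑ i ∈ Finset.range m, e i))
        = ((2 * n : ℕ) : N.HNat) * (a m - a k) +
          ((2 * n : ℕ) : N.HNat) * ∑ i ∈ Finset.range m, e i := by push_cast; ring
      _ ≤ h + h := add_le_add hincrease (mul_sum_le_of_forall_mul_two_pow_le hle m)
      _ = 2 * h := (two_mul h).symm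
  obtain ⟨C, hC, hCH, hBC, hCcard⟩ := exists_isInternal_superset_of_forall_cardLE hB
    (isInternal_iUnion_lt hA k) hH.isInternal hBH (d := q) fun m =>
      (cardLE_iUnion_lt_diff ha hB hcard (le_max_right m k)).mono
        ((isInternal_iUnion_lt hB m).diff (isInternal_iUnion_lt hA k))
        (Set.sdiff_subset_sdiff_left (Set.biUnion_subset_biUnion_left
          fun _ hi => lt_of_lt_of_le hi (le_max_left m k))) (herror _ (le_max_right m k))
  exact ⟨_, C, q, isInternal_iUnion_lt hA k, hC,
    Set.iUnion₂_subset fun i _ => (hAX i).trans (Set.subset_iUnion X i),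
    Set.iUnion_subset fun i => (hXB i).trans (hBC i), hCH, hCcard, (hq q).2 le_rfl⟩

theorem IsBorel.isApproximable {X : Set (N.Obj σ)} (hX : N.IsBorel X) {H : Set (N.Obj σ)}
    {h : N.HNat} (hH : HasCard H h) : IsApproximable h H (X ∩ H) := by
  induction hX using IsBorel.induction with
  | isInternal S hS => exact (hS.inter hH.isInternal).isApproximable Set.inter_subset_right h
  | compl S _ ih =>
    have hcompl : Sᶜ ∩ H = H \ (S ∩ H) := by
      rw [Set.sdiff_inter_self_eq_sdiff, Set.sdiff_eq, Set.inter_comm]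
    exact hcompl ▸ ih.diff hH.isInternal
  | iUnion S _ ih =>
    rw [Set.iUnion_inter]
    exact .iUnion hH ih

theorem exists_cover_of_subset_iUnion {X : Set (N.Obj σ)} (hX : N.IsBorel X) {d : N.HNat}
    (h : ∀ Y ⊆ X, IsInternal Y → CardLE Y d) {E : ℕ → Set (N.Obj σ)} (hE : ∀ i, CardLE (E i) d)
    (hXE : X ⊆ ⋃ i, E i) {n : ℕ} (hn : 0 < n) :
    ∃ C e, X ⊆ C ∧ CardLE C e ∧ n * e ≤ (n + 1) * d := by
  choose f hfd hf using fun i => (hE i).exists_hasCard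
  choose A B e hA hB hAX hXB _ hcard hle using
    fun i => hX.isApproximable (hf i) (n * 2 ^ (i + 1)) (by positivity)
  obtain ⟨q, hq⟩ := exists_forall_natCast_mul_le_iff d hn
  have hBcard : ∀ m, CardLE (⋃ i < m, B i) (d + q) := by
    intro m
    have hAcard : CardLE (⋃ i < m, A i) d :=
      h _ (Set.iUnion₂_subset fun i _ => (hAX i).trans Set.inter_subset_left)
        (isInternal_iUnion_lt hA m)
    have hsum : ∑ i ∈ Finset.range m, e i ≤ q :=
      (hq _).1 (mul_sum_le_of_forall_mul_two_pow_le (fun i => (hle i).trans (hfd i)) m)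
    refine (hAcard.union (cardLE_iUnion_lt hcard m)).mono (isInternal_iUnion_lt hB m) ?_
      (add_le_add_right hsum d)
    refine Set.iUnion₂_subset fun i hi x hx => ?_
    by_cases hxA : x ∈ A i
    · exact .inl (Set.mem_iUnion₂.2 ⟨i, hi, hxA⟩)
    · exact .inr (Set.mem_iUnion₂.2 ⟨i, hi, hx, hxA⟩)
  obtain ⟨C, -, -, hBC, hCcard⟩ := exists_isInternal_superset_of_forall_cardLE hB isInternal_empty
    isInternal_univ (fun _ => Set.subset_univ _) (d := d + q)
    fun m => by simpa only [Set.sdiff_empty] using hBcard m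
  rw [Set.sdiff_empty] at hCcard
  refine ⟨C, d + q, fun x hx => ?_, hCcard, ?_⟩
  · obtain ⟨i, hi⟩ := Set.mem_iUnion.1 (hXE hx)
    exact hBC i (hXB i ⟨hx, hi⟩)
  · rw [mul_add, add_mul, one_mul]
    exact add_le_add_right ((hq q).2 le_rfl) _

theorem IsBorel.exists_cover {X : Set (N.Obj σ)} (hX : N.IsBorel X) {d : N.HNat}
    (h : ∀ Y ⊆ X, IsInternal Y → CardLE Y d) {n : ℕ} (hn : 0 < n) :
    ∃ C e, X ⊆ C ∧ CardLE C e ∧ n * e ≤ (n + 1) * d := by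
  obtain ⟨E, -, hE, hXE⟩ | ⟨D, hD, hanti, hDd, hDX⟩ :=
    hX.exists_cover_or_exists_iInter_subset (P := (CardLE · d)) (cardLE_empty d)
  · exact exists_cover_of_subset_iUnion hX h hE hXE hn
  · obtain ⟨T, hT, hTcard⟩ := exists_hasCard_subset_iInter hD hanti
      fun n => exists_hasCard_of_not_cardLE (hD n) (hDd n)
    exact absurd (hTcard.le_of_subset (h T (hT.trans hDX) hTcard.isInternal) subset_rfl)
      (lt_add_one d).not_ge

end NonstandardUniverse

/-! ### Piecewise internal injections -/

namespace NonstandardUniverse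

open FinType

variable {N : NonstandardUniverse.{u}} {σ τ ρ : FinType}

theorem IsBij.relImage_subset {R : Set (N.Obj (prod σ τ))} {S : Set (N.Obj σ)} {T : Set (N.Obj τ)}
    (h : IsBij R S T) (A : Set (N.Obj σ)) : relImage R A ⊆ T :=
  fun _ ⟨_, _, hxy⟩ => h.right_mem hxy

theorem IsBij.relImage_eq {R : Set (N.Obj (prod σ τ))} {S : Set (N.Obj σ)} {T : Set (N.Obj τ)}
    (h : IsBij R S T) : relImage R S = T :=
  (h.relImage_subset S).antisymm fun _ hy =>
    have ⟨x, hxy⟩ := h.exists_left hy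
    ⟨x, h.left_mem hxy, hxy⟩

theorem set_ext_pair {R Q : Set (N.Obj (prod σ τ))} (h : ∀ x y, N.pair x y ∈ R ↔ N.pair x y ∈ Q) :
    R = Q := by
  ext p
  obtain ⟨x, y, rfl⟩ := exists_pair p
  exact h x y

theorem relImage_iUnion {ι : Type*} (R : Set (N.Obj (prod σ τ))) (B : ι → Set (N.Obj σ)) :
    relImage R (⋃ n, B n) = ⋃ n, relImage R (B n) := by
  simp only [relImage_eq_image_snd, Set.preimage_iUnion, Set.inter_iUnion, Set.image_iUnion]

theorem relInv_relInv (R : Set (N.Obj (prod σ τ))) : relInv (relInv R) = R :=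
  set_ext_pair fun x y => by rw [pair_mem_relInv, pair_mem_relInv]

theorem relInv_relComp (R : Set (N.Obj (prod σ τ))) (Q : Set (N.Obj (prod τ ρ))) :
    relInv (relComp R Q) = relComp (relInv Q) (relInv R) :=
  set_ext_pair fun x z => by simp only [pair_mem_relInv, pair_mem_relComp, and_comm]

theorem IsBorel.relImage {B : Set (N.Obj σ)} (hB : N.IsBorel B) {R : Set (N.Obj (prod σ τ))}
    (hR : IsInternal R) (hbi : BiUnique R) : N.IsBorel (relImage R B) := by
  induction hB using IsBorel.induction with
  | isInternal S hS => exact (hR.relImage hS).isBorel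
  | compl S _ ih =>
    have hcompl : NonstandardUniverse.relImage R Sᶜ =
        NonstandardUniverse.relImage R Set.univ \ NonstandardUniverse.relImage R S := by
      ext y
      constructor
      · rintro ⟨x, hx, hxy⟩
        exact ⟨⟨x, trivial, hxy⟩, fun ⟨x', hx', hxy'⟩ => hx (hbi.left_unique hxy hxy' ▸ hx')⟩
      · rintro ⟨⟨x, -, hxy⟩, h⟩
        exact ⟨x, fun hx => h ⟨x, hx, hxy⟩, hxy⟩
    rw [hcompl]
    exact (hR.relImage isInternal_univ).isBorel.diff ih
  | iUnion S _ ih =>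
    rw [relImage_iUnion]
    exact .iUnion ih

theorem IsBorel.preimage_fst {B : Set (N.Obj σ)} (hB : N.IsBorel B) :
    N.IsBorel (fst ⁻¹' B : Set (N.Obj (prod σ τ))) := by
  induction hB using IsBorel.induction with
  | isInternal S hS => exact hS.preimage_fst.isBorel
  | compl S _ ih => exact ih.compl
  | iUnion S _ ih =>
    rw [Set.preimage_iUnion]
    exact .iUnion ih

theorem IsBorel.relInv {Γ : Set (N.Obj (prod σ τ))} (hΓ : N.IsBorel Γ) : N.IsBorel (relInv Γ) := by
  induction hΓ using IsBorel.induction with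
  | isInternal S hS => exact hS.relInv.isBorel
  | compl S _ ih => exact ih.compl
  | iUnion S _ ih =>
    have hunion : NonstandardUniverse.relInv (⋃ n, S n) = ⋃ n, NonstandardUniverse.relInv (S n) :=
      Set.preimage_iUnion
    exact hunion ▸ .iUnion ih

theorem IsBorel.relComp_left {Γ : Set (N.Obj (prod τ ρ))} (hΓ : N.IsBorel Γ)
    {F : Set (N.Obj (prod σ τ))} (hF : IsInternal F) (hbi : BiUnique F) :
    N.IsBorel (relComp F Γ) := by
  induction hΓ using IsBorel.induction with
  | isInternal S hS => exact (hF.relComp hS).isBorel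
  | compl S _ ih =>
    have hcompl : relComp F Sᶜ = fst ⁻¹' (fst '' F) \ relComp F S := by
      refine set_ext_pair fun x z => ?_
      simp only [Set.mem_sdiff, Set.mem_preimage, fst_pair, pair_mem_relComp]
      constructor
      · rintro ⟨y, hxy, hyz⟩
        refine ⟨⟨_, hxy, fst_pair x y⟩, fun ⟨y', hxy', hyz'⟩ => hyz ?_⟩
        rwa [hbi.right_unique hxy hxy']
      · rintro ⟨⟨p, hp, rfl⟩, hnot⟩
        have hp' : N.pair (fst p) (snd p) ∈ F := by rwa [pair_fst_snd]
        exact ⟨snd p, hp', fun h => hnot ⟨_, hp', h⟩⟩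
    rw [hcompl]
    exact hF.image_fst.preimage_fst.isBorel.diff ih
  | iUnion S _ ih =>
    have hunion : relComp F (⋃ n, S n) = ⋃ n, relComp F (S n) := set_ext_pair fun x z => by
      simp only [pair_mem_relComp, Set.mem_iUnion, ← exists_and_left]
      exact exists_comm
    rw [hunion]
    exact .iUnion ih

/-- `G` is a countable union of restrictions to Borel sets of internal relations, each of which is
the graph of an injection; `G` itself need not be the graph of an injection. -/
def PiecewiseInternal (G : Set (N.Obj (prod σ τ))) : Prop :=
  ∃ (B : ℕ → Set (N.Obj σ)) (F : ℕ → Set (N.Obj (prod σ τ))), (∀ n, N.IsBorel (B n)) ∧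
    (∀ n, IsInternal (F n)) ∧ (∀ n, BiUnique (F n)) ∧ G = ⋃ n, fst ⁻¹' B n ∩ F n

theorem IsInternal.piecewiseInternal {F : Set (N.Obj (prod σ τ))} (hF : IsInternal F)
    (hbi : BiUnique F) : PiecewiseInternal F :=
  ⟨fun _ => Set.univ, fun _ => F, fun _ => isInternal_univ.isBorel, fun _ => hF, fun _ => hbi, by
    simp only [Set.preimage_univ, Set.univ_inter, Set.iUnion_const]⟩

theorem PiecewiseInternal.iUnion {G : ℕ → Set (N.Obj (prod σ τ))}
    (h : ∀ n, PiecewiseInternal (G n)) : PiecewiseInternal (⋃ n, G n) := by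
  choose B F hB hF hbi hG using h
  refine ⟨fun n => B n.unpair.1 n.unpair.2, fun n => F n.unpair.1 n.unpair.2, fun n => hB _ _,
    fun n => hF _ _, fun n => hbi _ _, ?_⟩
  simp only [hG]
  exact (Set.iUnion_unpair fun i j => fst ⁻¹' B i j ∩ F i j).symm

theorem PiecewiseInternal.union {G H : Set (N.Obj (prod σ τ))} (hG : PiecewiseInternal G)
    (hH : PiecewiseInternal H) : PiecewiseInternal (G ∪ H) := by
  have hunion : G ∪ H = ⋃ n : ℕ, if n = 0 then G else H := by
    rw [← Set.union_iUnion_nat_succ]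
    simp only [if_true, Nat.succ_ne_zero, if_false, Set.iUnion_const]
  rw [hunion]
  exact .iUnion fun n => by split_ifs <;> assumption

theorem PiecewiseInternal.restrict {G : Set (N.Obj (prod σ τ))} (hG : PiecewiseInternal G)
    {A : Set (N.Obj σ)} (hA : N.IsBorel A) : PiecewiseInternal (fst ⁻¹' A ∩ G) := by
  obtain ⟨B, F, hB, hF, hbi, rfl⟩ := hG
  refine ⟨fun n => A ∩ B n, F, fun n => hA.inter (hB n), hF, hbi, ?_⟩
  simp only [Set.inter_iUnion, Set.preimage_inter, Set.inter_assoc]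

theorem PiecewiseInternal.isBorel {G : Set (N.Obj (prod σ τ))} (hG : PiecewiseInternal G) :
    N.IsBorel G := by
  obtain ⟨B, F, hB, hF, -, rfl⟩ := hG
  exact .iUnion fun n => (hB n).preimage_fst.inter (hF n).isBorel

theorem PiecewiseInternal.isBorel_relImage {G : Set (N.Obj (prod σ τ))} (hG : PiecewiseInternal G)
    {A : Set (N.Obj σ)} (hA : N.IsBorel A) : N.IsBorel (relImage G A) := by
  obtain ⟨B, F, hB, hF, hbi, rfl⟩ := hG
  have himage : relImage (⋃ n, fst ⁻¹' B n ∩ F n) A = ⋃ n, relImage (F n) (A ∩ B n) := by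
    simp only [relImage_eq_image_snd, Set.iUnion_inter, Set.image_iUnion, Set.preimage_inter]
    exact Set.iUnion_congr fun n => by rw [Set.inter_comm, ← Set.inter_assoc, Set.inter_comm]
  rw [himage]
  exact .iUnion fun n => (hA.inter (hB n)).relImage (hF n) (hbi n)

theorem PiecewiseInternal.relInv {G : Set (N.Obj (prod σ τ))} (hG : PiecewiseInternal G) :
    PiecewiseInternal (relInv G) := by
  obtain ⟨B, F, hB, hF, hbi, rfl⟩ := hG
  refine ⟨fun n => NonstandardUniverse.relImage (F n) (B n),
    fun n => NonstandardUniverse.relInv (F n), fun n => (hB n).relImage (hF n) (hbi n),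
    fun n => (hF n).relInv, fun n => (hbi n).relInv, set_ext_pair fun y x => ?_⟩
  simp only [pair_mem_relInv, Set.mem_iUnion, Set.mem_inter_iff, Set.mem_preimage, fst_pair]
  refine exists_congr fun n => ⟨fun h => ⟨⟨x, h⟩, h.2⟩, fun ⟨⟨x', hx', hxy'⟩, hxy⟩ => ⟨?_, hxy⟩⟩
  exact (hbi n).left_unique hxy' hxy ▸ hx'

theorem PiecewiseInternal.isBorel_relComp_left {G : Set (N.Obj (prod σ τ))}
    (hG : PiecewiseInternal G) {Γ : Set (N.Obj (prod τ ρ))} (hΓ : N.IsBorel Γ) :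
    N.IsBorel (relComp G Γ) := by
  obtain ⟨B, F, hB, hF, hbi, rfl⟩ := hG
  have hcomp : relComp (⋃ n, fst ⁻¹' B n ∩ F n) Γ = ⋃ n, fst ⁻¹' B n ∩ relComp (F n) Γ := by
    refine set_ext_pair fun x z => ?_
    simp only [pair_mem_relComp, Set.mem_iUnion, Set.mem_inter_iff, Set.mem_preimage, fst_pair,
      ← exists_and_left, ← exists_and_right, and_assoc]
    exact exists_comm
  rw [hcomp]
  exact .iUnion fun n => (hB n).preimage_fst.inter (hΓ.relComp_left (hF n) (hbi n))

theorem PiecewiseInternal.isBorel_relComp_right {G : Set (N.Obj (prod τ ρ))}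
    (hG : PiecewiseInternal G) {Γ : Set (N.Obj (prod σ τ))} (hΓ : N.IsBorel Γ) :
    N.IsBorel (relComp Γ G) := by
  rw [← relInv_relInv (relComp Γ G), relInv_relComp]
  exact (hG.relInv.isBorel_relComp_left hΓ.relInv).relInv

theorem PiecewiseInternal.relComp {G : Set (N.Obj (prod σ τ))} {H : Set (N.Obj (prod τ ρ))}
    (hG : PiecewiseInternal G) (hH : PiecewiseInternal H) : PiecewiseInternal (relComp G H) := by
  obtain ⟨B, F, hB, hF, hbi, rfl⟩ := hG
  obtain ⟨B', F', hB', hF', hbi', rfl⟩ := hH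
  have hcomp : NonstandardUniverse.relComp (⋃ n, fst ⁻¹' B n ∩ F n) (⋃ m, fst ⁻¹' B' m ∩ F' m) =
      ⋃ n, ⋃ m, fst ⁻¹' (B n ∩ relImage (NonstandardUniverse.relInv (F n)) (B' m)) ∩
        NonstandardUniverse.relComp (F n) (F' m) := by
    refine set_ext_pair fun x z => ?_
    simp only [pair_mem_relComp, Set.mem_iUnion, Set.mem_inter_iff, Set.mem_preimage, fst_pair]
    constructor
    · rintro ⟨y, ⟨n, hx, hxy⟩, m, hy, hyz⟩
      exact ⟨n, m, ⟨hx, y, hy, pair_mem_relInv.2 hxy⟩, y, hxy, hyz⟩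
    · rintro ⟨n, m, ⟨hx, y', hy', hyx⟩, y, hxy, hyz⟩
      obtain rfl := (hbi n).right_unique (pair_mem_relInv.1 hyx) hxy
      exact ⟨y', ⟨n, hx, hxy⟩, m, hy', hyz⟩
  rw [hcomp]
  refine .iUnion fun n => .iUnion fun m => PiecewiseInternal.restrict ?_ ?_
  · exact ((hF n).relComp (hF' m)).piecewiseInternal ((hbi n).relComp (hbi' m))
  · exact (hB n).inter ((hB' m).relImage (hF n).relInv (hbi n).relInv)

/-- There is a piecewise internal injection of `X` into `Y`. -/
def PiecewiseLE (X : Set (N.Obj σ)) (Y : Set (N.Obj τ)) : Prop :=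
  ∃ Z ⊆ Y, ∃ G, PiecewiseInternal G ∧ IsBij G X Z

theorem PiecewiseLE.trans {X : Set (N.Obj σ)} {Y : Set (N.Obj τ)} {Z : Set (N.Obj ρ)}
    (h : PiecewiseLE X Y) (h' : PiecewiseLE Y Z) : PiecewiseLE X Z := by
  obtain ⟨Y', hY', G, hG, hbij⟩ := h
  obtain ⟨Z', hZ', H, hH, hbij'⟩ := h'
  exact ⟨_, (hbij'.relImage_subset Y').trans hZ', _, hG.relComp hH,
    hbij.relComp hY' hbij'⟩

theorem IsBij.piecewiseLE {G : Set (N.Obj (prod σ τ))} {S X : Set (N.Obj σ)} {T Y : Set (N.Obj τ)}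
    (h : IsBij G S T) (hG : PiecewiseInternal G) (hX : N.IsBorel X) (hXS : X ⊆ S)
    (hY : relImage G X ⊆ Y) : PiecewiseLE X Y :=
  ⟨relImage G X, hY, _, hG.restrict hX, h.restrict hXS⟩

theorem isBij_diagonal : IsBij {p : N.Obj (prod σ σ) | fst p = snd p} Set.univ Set.univ :=
  isBij_iff.2 ⟨biUnique_diagonal, by simp, by simp⟩

theorem IsBorel.piecewiseLE_of_subset {X Y : Set (N.Obj σ)} (hX : N.IsBorel X) (h : X ⊆ Y) :
    PiecewiseLE X Y := by
  refine isBij_diagonal.piecewiseLE (isInternal_diagonal.piecewiseInternal biUnique_diagonal) hX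
    (Set.subset_univ X) ?_
  rintro y ⟨x, hx, hxy⟩
  rw [Set.mem_ofPred_eq, fst_pair, snd_pair] at hxy
  exact hxy ▸ h hx

theorem isBij_graphOn {f : N.HNat → N.HNat} {X Y : Set N.HNat} (h : Set.BijOn f X Y) :
    IsBij (N.graphOn f X) X Y := by
  have hmem : ∀ x y, N.pair x y ∈ N.graphOn f X ↔ x ∈ X ∧ f x = y := by
    intro x y
    refine ⟨fun ⟨x', hx', hxy⟩ => ?_, fun ⟨hx, hxy⟩ => ⟨x, hx, hxy ▸ rfl⟩⟩
    obtain ⟨rfl, rfl⟩ := N.pair_inj.1 hxy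
    exact ⟨hx', rfl⟩
  refine isBij_iff.2 ⟨biUnique_of_unique ?_ ?_, fun x => ?_, fun y => ?_⟩ <;> simp only [hmem]
  · exact fun hy hy' => hy.2.symm.trans hy'.2
  · exact fun hx hx' => h.injOn hx.1 hx'.1 (hx.2.trans hx'.2.symm)
  · exact ⟨fun hx => ⟨_, hx, rfl⟩, fun ⟨_, hx, _⟩ => hx⟩
  · exact ⟨fun hy => h.surjOn hy, fun ⟨x, hx, hxy⟩ => hxy ▸ h.mapsTo hx⟩

theorem IsBij.exists_graphOn_eq {G : Set (N.Obj (prod nat nat))} {X Y : Set N.HNat}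
    (h : IsBij G X Y) : ∃ f, Set.BijOn f X Y ∧ N.graphOn f X = G := by
  choose! f hf using fun x (hx : x ∈ X) => h.exists_right hx
  refine ⟨f, ⟨fun x hx => h.right_mem (hf x hx), fun x hx x' hx' hxx' => ?_, fun y hy => ?_⟩,
    set_ext_pair fun x y => ⟨?_, fun hxy => ?_⟩⟩
  · exact h.biUnique.left_unique (hf x hx) (hxx' ▸ hf x' hx')
  · obtain ⟨x, hxy⟩ := h.exists_left hy
    have hx := h.left_mem hxy
    exact ⟨x, hx, h.biUnique.right_unique (hf x hx) hxy⟩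
  · rintro ⟨x', hx', hxy⟩
    exact hxy ▸ hf x' hx'
  · have hx := h.left_mem hxy
    exact ⟨x, hx, by rw [h.biUnique.right_unique hxy (hf x hx)]⟩

theorem borelBijective_iff_exists_isBij {X Y : Set N.HNat} :
    N.BorelBijective X Y ↔ ∃ G, N.IsBorel G ∧ IsBij G X Y := by
  constructor
  · rintro ⟨f, hf, hborel⟩
    exact ⟨_, hborel, isBij_graphOn hf⟩
  · rintro ⟨G, hborel, hbij⟩
    obtain ⟨f, hf, rfl⟩ := hbij.exists_graphOn_eq
    exact ⟨f, hf, hborel⟩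

theorem borelLE_iff_exists_isBij {X Y : Set N.HNat} :
    N.BorelLE X Y ↔ ∃ Z ⊆ Y, ∃ G, N.IsBorel G ∧ IsBij G X Z := by
  simp only [← borelBijective_iff_exists_isBij]
  constructor
  · rintro ⟨f, hmaps, hinj, hborel⟩
    exact ⟨f '' X, hmaps.image_subset, f, hinj.bijOn_image, hborel⟩
  · rintro ⟨Z, hZ, f, hf, hborel⟩
    exact ⟨f, hf.mapsTo.mono_right hZ, hf.injOn, hborel⟩

theorem PiecewiseLE.borelLE {X Y : Set N.HNat} (h : PiecewiseLE X Y) : N.BorelLE X Y := by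
  obtain ⟨Z, hZ, G, hG, hbij⟩ := h
  exact borelLE_iff_exists_isBij.2 ⟨Z, hZ, G, hG.isBorel, hbij⟩

theorem PiecewiseLE.trans_borelLE {X Y Z : Set N.HNat} (h : PiecewiseLE X Y)
    (h' : N.BorelLE Y Z) : N.BorelLE X Z := by
  obtain ⟨Y', hY', G, hG, hbij⟩ := h
  obtain ⟨Z', hZ', Γ, hΓ, hbij'⟩ := borelLE_iff_exists_isBij.1 h'
  exact borelLE_iff_exists_isBij.2 ⟨_, (hbij'.relImage_subset Y').trans hZ', _,
    hG.isBorel_relComp_left hΓ, hbij.relComp hY' hbij'⟩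

theorem BorelLE.trans_piecewiseLE {X Y Z : Set N.HNat} (h : N.BorelLE X Y)
    (h' : PiecewiseLE Y Z) : N.BorelLE X Z := by
  obtain ⟨Y', hY', Γ, hΓ, hbij⟩ := borelLE_iff_exists_isBij.1 h
  obtain ⟨Z', hZ', G, hG, hbij'⟩ := h'
  exact borelLE_iff_exists_isBij.2 ⟨_, (hbij'.relImage_subset Y').trans hZ', _,
    hG.isBorel_relComp_right hΓ, hbij.relComp hY' hbij'⟩

theorem isBij_of_eq_union_relImage {G : Set (N.Obj (prod σ τ))} {H : Set (N.Obj (prod τ σ))}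
    {X W C : Set (N.Obj σ)} {Y Z : Set (N.Obj τ)} (hG : IsBij G X Z) (hZ : Z ⊆ Y)
    (hH : IsBij H Y W) (hW : W ⊆ X) (hC : C = X \ W ∪ relImage H (relImage G C)) :
    IsBij (fst ⁻¹' C ∩ G ∪ fst ⁻¹' (X \ C) ∩ relInv H) X Y := by
  have hCX : C ⊆ X := by
    rw [hC]
    exact Set.union_subset Set.sdiff_subset ((hH.relImage_subset _).trans hW)
  have hXC : X \ C ⊆ W := fun x hx => by_contra fun hxW => hx.2 (hC ▸ .inl ⟨hx.1, hxW⟩)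
  have hdisj : Disjoint (relImage G C) (relImage (relInv H) (X \ C)) := by
    refine Set.disjoint_left.2 fun y hy ⟨x, hx, hxy⟩ => hx.2 ?_
    rw [hC]
    exact .inr ⟨y, hy, pair_mem_relInv.1 hxy⟩
  have hcover : relImage G C ∪ relImage (relInv H) (X \ C) = Y := by
    refine subset_antisymm (Set.union_subset ((hG.relImage_subset C).trans hZ)
      (hH.relInv.relImage_subset _)) fun y hy => ?_
    obtain ⟨x, hyx⟩ := hH.exists_right hy
    have hxW := hH.right_mem hyx
    by_cases hx : x ∈ C
    · rw [hC] at hx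
      obtain hx | ⟨y', hy', hyx'⟩ := hx
      · exact absurd hxW hx.2
      · exact .inl (hH.biUnique.left_unique hyx hyx' ▸ hy')
    · exact .inr ⟨x, ⟨hW hxW, hx⟩, pair_mem_relInv.2 hyx⟩
  have hunion := (hG.restrict hCX).union (hH.relInv.restrict hXC) Set.disjoint_sdiff_right hdisj
  rwa [Set.union_sdiff_cancel hCX, hcover] at hunion

theorem PiecewiseLE.borelBijective {X Y : Set N.HNat} (hX : N.IsBorel X) (hY : N.IsBorel Y)
    (h : PiecewiseLE X Y) (h' : PiecewiseLE Y X) : N.BorelBijective X Y := by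
  obtain ⟨Z, hZ, G, hG, hGbij⟩ := h
  obtain ⟨W, hW, H, hH, hHbij⟩ := h'
  have hWborel : N.IsBorel W := hHbij.relImage_eq ▸ hH.isBorel_relImage hY
  let A : ℕ → Set N.HNat := fun n => (fun S => relImage H (relImage G S))^[n] (X \ W)
  have hA_succ : ∀ n, A (n + 1) = relImage H (relImage G (A n)) :=
    fun n => Function.iterate_succ_apply' _ n _
  have hAborel : ∀ n, N.IsBorel (A n) := by
    intro n
    induction n with
    | zero => exact hX.diff hWborel
    | succ n ih => exact hA_succ n ▸ hH.isBorel_relImage (hG.isBorel_relImage ih)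
  have hfix : ⋃ n, A n = X \ W ∪ relImage H (relImage G (⋃ n, A n)) := by
    rw [relImage_iUnion, relImage_iUnion, ← Set.union_iUnion_nat_succ]
    simp only [hA_succ]
    rfl
  have hC : N.IsBorel (⋃ n, A n) := .iUnion hAborel
  exact borelBijective_iff_exists_isBij.2 ⟨_,
    ((hG.restrict hC).union (hH.relInv.restrict (hX.diff hC))).isBorel,
    isBij_of_eq_union_relImage hGbij hZ hHbij hW hfix⟩

end NonstandardUniverse

/-! ### Gluing internal bijections -/

namespace NonstandardUniverse

open FinType

variable {N : NonstandardUniverse.{u}} {σ τ : FinType}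

theorem BiUnique.isBij {R : Set (N.Obj (prod σ τ))} (h : BiUnique R) :
    IsBij R (fst '' R) (snd '' R) :=
  ⟨h.1.bijOn_image, h.2.bijOn_image⟩

theorem IsBij.iUnion {R : ℕ → Set (N.Obj (prod σ τ))} {S : ℕ → Set (N.Obj σ)}
    {T : ℕ → Set (N.Obj τ)} (h : ∀ n, IsBij (R n) (S n) (T n))
    (hS : Pairwise (Function.onFun Disjoint S)) (hT : Pairwise (Function.onFun Disjoint T)) :
    IsBij (⋃ n, R n) (⋃ n, S n) (⋃ n, T n) := by
  have hinjOn : ∀ {ρ : FinType} {f : N.Obj (prod σ τ) → N.Obj ρ} {U : ℕ → Set (N.Obj ρ)},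
      (∀ n, Set.BijOn f (R n) (U n)) → Pairwise (Function.onFun Disjoint U) →
        Set.InjOn f (⋃ n, R n) := by
    intro ρ f U hbij hdisj p hp q hq hpq
    obtain ⟨m, hm⟩ := Set.mem_iUnion.1 hp
    obtain ⟨n, hn⟩ := Set.mem_iUnion.1 hq
    obtain rfl : m = n := hdisj.eq
      (Set.not_disjoint_iff.2 ⟨f p, (hbij m).mapsTo hm, hpq ▸ (hbij n).mapsTo hn⟩)
    exact (hbij m).injOn hm hn hpq
  exact ⟨Set.bijOn_iUnion (fun n => (h n).1) (hinjOn (fun n => (h n).1) hS),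
    Set.bijOn_iUnion (fun n => (h n).2) (hinjOn (fun n => (h n).2) hT)⟩

theorem PiecewiseLE.mono_right {X : Set (N.Obj σ)} {Y Y' : Set (N.Obj τ)} (h : PiecewiseLE X Y)
    (hY : Y ⊆ Y') : PiecewiseLE X Y' := by
  obtain ⟨Z, hZ, hG⟩ := h
  exact ⟨Z, hZ.trans hY, hG⟩

theorem PiecewiseLE.union {X X' : Set (N.Obj σ)} {Y Y' : Set (N.Obj τ)} (h : PiecewiseLE X Y)
    (h' : PiecewiseLE X' Y') (hX : Disjoint X X') (hY : Disjoint Y Y') :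
    PiecewiseLE (X ∪ X') (Y ∪ Y') := by
  obtain ⟨Z, hZ, G, hG, hbij⟩ := h
  obtain ⟨Z', hZ', G', hG', hbij'⟩ := h'
  exact ⟨Z ∪ Z', Set.union_subset_union hZ hZ', G ∪ G', hG.union hG',
    hbij.union hbij' hX (hY.mono hZ hZ')⟩

theorem PiecewiseLE.iUnion {X : ℕ → Set (N.Obj σ)} {Y : ℕ → Set (N.Obj τ)}
    (h : ∀ n, PiecewiseLE (X n) (Y n)) (hX : Pairwise (Function.onFun Disjoint X))
    (hY : Pairwise (Function.onFun Disjoint Y)) : PiecewiseLE (⋃ n, X n) (⋃ n, Y n) := by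
  choose Z hZ G hG hbij using h
  exact ⟨⋃ n, Z n, Set.iUnion_mono hZ, ⋃ n, G n, .iUnion hG,
    .iUnion hbij hX fun m n hmn => (hY hmn).mono (hZ m) (hZ n)⟩

theorem HasCard.piecewiseLE {S : Set (N.Obj σ)} {T : Set (N.Obj τ)} {d : N.HNat}
    (hS : HasCard S d) (hT : HasCard T d) : PiecewiseLE S T := by
  obtain ⟨R, hR, hbij⟩ := hS.exists_isBij hT
  exact ⟨T, subset_rfl, R, hR.piecewiseInternal hbij.biUnique, hbij⟩

theorem HasCard.disjointed {Y : ℕ → Set (N.Obj σ)} (hY : Monotone Y) {w : ℕ → N.HNat}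
    (hw : ∀ n, HasCard (Y n) (w n)) (n : ℕ) :
    HasCard (disjointed Y n) (if n = 0 then w 0 else w n - w (n - 1)) := by
  cases n with
  | zero => simpa only [disjointed_zero, if_true] using hw 0
  | succ n =>
    rw [hY.disjointed_add_one, if_neg n.succ_ne_zero, Nat.add_sub_cancel]
    exact (hw n).diff (hw (n + 1)) (hY n.le_succ)

theorem piecewiseLE_iUnion_of_hasCard {Y : ℕ → Set (N.Obj σ)} {Z : ℕ → Set (N.Obj τ)}
    {w : ℕ → N.HNat} (hY : Monotone Y) (hZ : Monotone Z) (hYw : ∀ n, HasCard (Y n) (w n))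
    (hZw : ∀ n, HasCard (Z n) (w n)) : PiecewiseLE (⋃ n, Y n) (⋃ n, Z n) := by
  rw [← iUnion_disjointed, ← iUnion_disjointed (f := Z)]
  exact .iUnion (fun n => (HasCard.disjointed hY hYw n).piecewiseLE (HasCard.disjointed hZ hZw n))
    (disjoint_disjointed Y) (disjoint_disjointed Z)

theorem piecewiseLE_of_subset_iUnion {X : Set (N.Obj σ)} (hX : N.IsBorel X)
    {E : ℕ → Set (N.Obj σ)} {e : ℕ → N.HNat} (hE : ∀ n, CardLE (E n) (e n))
    (hXE : X ⊆ ⋃ n, E n) {U : Set N.HNat} (hU : ∀ n, Set.Iio (∑ i ∈ Finset.range n, e i) ⊆ U) :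
    PiecewiseLE X U := by
  choose w hw hcard using fun n => (cardLE_iUnion_lt hE n).exists_hasCard
  have hY : Monotone fun n => ⋃ i < n, E i := fun m n hmn =>
    Set.biUnion_subset_biUnion_left fun i hi => lt_of_lt_of_le hi hmn
  have hZ : Monotone fun n => Set.Iio (w n) := fun m n hmn =>
    Set.Iio_subset_Iio ((hcard m).le_of_subset (hcard n).cardLE (hY hmn))
  have hXY : X ⊆ ⋃ n, ⋃ i < n, E i := fun x hx => by
    obtain ⟨i, hi⟩ := Set.mem_iUnion.1 (hXE hx)
    exact Set.mem_iUnion.2 ⟨i + 1, Set.mem_iUnion₂.2 ⟨i, i.lt_succ_self, hi⟩⟩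
  refine (hX.piecewiseLE_of_subset hXY).trans ((piecewiseLE_iUnion_of_hasCard hY hZ hcard
    fun n => hasCard_Iio (w n)).mono_right ?_)
  exact Set.iUnion_subset fun n => (Set.Iio_subset_Iio (hw n)).trans (hU n)

theorem exists_monotone_hasCard {X : Set (N.Obj σ)} {w : ℕ → N.HNat} (hw : Monotone w)
    (hX : ∀ n, ∃ Y ⊆ X, HasCard Y (w n)) :
    ∃ Y : ℕ → Set (N.Obj σ), Monotone Y ∧ (∀ n, Y n ⊆ X) ∧ ∀ n, HasCard (Y n) (w n) := by
  have hstep : ∀ n (Y : {Y : Set (N.Obj σ) // Y ⊆ X ∧ HasCard Y (w n)}),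
      ∃ Y' : {Y : Set (N.Obj σ) // Y ⊆ X ∧ HasCard Y (w (n + 1))}, Y.1 ⊆ Y'.1 := by
    rintro n ⟨Y, hYX, hY⟩
    obtain ⟨Z, hZX, hZ⟩ := hX (n + 1)
    obtain ⟨D, hYD, hDYZ, hD⟩ := hY.exists_between hZ (hw n.le_succ)
    exact ⟨⟨D, hDYZ.trans (Set.union_subset hYX hZX), hD⟩, hYD⟩
  choose next hnext using hstep
  obtain ⟨Y₀, hY₀⟩ := hX 0
  let Y : (n : ℕ) → {Y : Set (N.Obj σ) // Y ⊆ X ∧ HasCard Y (w n)} :=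
    fun n => Nat.rec ⟨Y₀, hY₀⟩ next n
  exact ⟨fun n => (Y n).1, monotone_nat_of_le_succ fun n => hnext n (Y n), fun n => (Y n).2.1,
    fun n => (Y n).2.2⟩

theorem piecewiseLE_of_subset_iUnion_Iio {W : Set N.HNat} (hW : N.IsBorel W) {w : ℕ → N.HNat}
    (hw : Monotone w) (hWw : W ⊆ ⋃ n, Set.Iio (w n)) {X : Set (N.Obj σ)}
    (hX : ∀ n, ∃ Y ⊆ X, HasCard Y (w n)) : PiecewiseLE W X := by
  obtain ⟨Y, hY, hYX, hYw⟩ := exists_monotone_hasCard hw hX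
  have hIio : Monotone fun n => Set.Iio (w n) := fun m n hmn => Set.Iio_subset_Iio (hw hmn)
  exact (hW.piecewiseLE_of_subset hWw).trans ((piecewiseLE_iUnion_of_hasCard hIio hY
    (fun n => hasCard_Iio (w n)) hYw).mono_right (Set.iUnion_subset hYX))

/-- The pairs whose first entry lies in `C` exactly when the second lies in `D`; a relation
contained in it respects `C` and `D`. -/
def matchingPairs (C : Set (N.Obj σ)) (D : Set (N.Obj τ)) : Set (N.Obj (prod σ τ)) :=
  {p | fst p ∈ C ↔ snd p ∈ D}

theorem pair_mem_matchingPairs {C : Set (N.Obj σ)} {D : Set (N.Obj τ)} {x : N.Obj σ}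
    {y : N.Obj τ} : N.pair x y ∈ matchingPairs C D ↔ (x ∈ C ↔ y ∈ D) := by
  rw [matchingPairs, Set.mem_ofPred_eq, fst_pair, snd_pair]

theorem IsInternal.matchingPairs {C : Set (N.Obj σ)} {D : Set (N.Obj τ)} (hC : IsInternal C)
    (hD : IsInternal D) : IsInternal (matchingPairs C D) := by
  have heq : NonstandardUniverse.matchingPairs C D =
      fst ⁻¹' C ∩ snd ⁻¹' D ∪ (fst ⁻¹' C)ᶜ ∩ (snd ⁻¹' D)ᶜ :=
    Set.ext fun _ => iff_iff_and_or_not_and_not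
  rw [heq]
  exact (hC.preimage_fst.inter hD.preimage_snd).union
    (hC.preimage_fst.compl.inter hD.preimage_snd.compl)

theorem IsBij.subset_matchingPairs {R : Set (N.Obj (prod σ τ))} {S : Set (N.Obj σ)}
    {T : Set (N.Obj τ)} (h : IsBij R S T) : R ⊆ matchingPairs S T :=
  fun _ hp => iff_of_true (h.1.mapsTo hp) (h.2.mapsTo hp)

theorem exists_isBij_forall_le_subset_matchingPairs {C : ℕ → Set (N.Obj σ)}
    {D : ℕ → Set (N.Obj τ)} {b : ℕ → N.HNat} (hC : Antitone C) (hD : Antitone D)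
    (hCb : ∀ n, HasCard (C n) (b n)) (hDb : ∀ n, HasCard (D n) (b n)) (n : ℕ) :
    ∃ R, IsInternal R ∧ IsBij R (C 0) (D 0) ∧ ∀ k ≤ n, R ⊆ matchingPairs (C k) (D k) := by
  induction n generalizing C D b with
  | zero =>
    obtain ⟨R, hR, hbij⟩ := (hCb 0).exists_isBij (hDb 0)
    exact ⟨R, hR, hbij, fun k hk => Nat.le_zero.1 hk ▸ hbij.subset_matchingPairs⟩
  | succ n ih =>
    obtain ⟨R, hR, hbij, hmatch⟩ := ih (C := fun k => C (k + 1)) (D := fun k => D (k + 1))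
      (hC.comp_monotone fun _ _ => Nat.succ_le_succ) (hD.comp_monotone fun _ _ => Nat.succ_le_succ)
      (fun k => hCb (k + 1)) (fun k => hDb (k + 1))
    obtain ⟨Q, hQ, hQbij⟩ := ((hCb 1).diff (hCb 0) (hC zero_le_one)).exists_isBij
      ((hDb 1).diff (hDb 0) (hD zero_le_one))
    have hunion := hbij.union hQbij Set.disjoint_sdiff_right Set.disjoint_sdiff_right
    rw [zero_add, Set.union_sdiff_cancel (hC zero_le_one),
      Set.union_sdiff_cancel (hD zero_le_one)] at hunion
    refine ⟨R ∪ Q, hR.union hQ, hunion, fun k hk => ?_⟩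
    cases k with
    | zero => exact hunion.subset_matchingPairs
    | succ k =>
      refine Set.union_subset (hmatch k (Nat.le_of_succ_le_succ hk)) fun p hp => iff_of_false ?_ ?_
      · exact fun hCk => (hQbij.1.mapsTo hp).2 (hC (Nat.succ_le_succ k.zero_le) hCk)
      · exact fun hDk => (hQbij.2.mapsTo hp).2 (hD (Nat.succ_le_succ k.zero_le) hDk)

theorem exists_isBij_forall_subset_matchingPairs {C : ℕ → Set (N.Obj σ)} {D : ℕ → Set (N.Obj τ)}
    {b : ℕ → N.HNat} (hC : Antitone C) (hD : Antitone D) (hCb : ∀ n, HasCard (C n) (b n))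
    (hDb : ∀ n, HasCard (D n) (b n)) :
    ∃ R, IsInternal R ∧ IsBij R (C 0) (D 0) ∧ ∀ n, R ⊆ matchingPairs (C n) (D n) := by
  obtain ⟨A, hA⟩ := exists_forall_mem_of_isInternal
    (S := fun n => {A : N.Obj (pow (prod σ τ)) | IsBij (N.elems A) (C 0) (D 0)} ∩
      {A | N.elems A ⊆ matchingPairs (C n) (D n)})
    (fun n => (isInternal_isBij (hCb 0).isInternal (hDb 0).isInternal).inter
      (isInternal_subset ((hCb n).isInternal.matchingPairs (hDb n).isInternal))) fun n => by
        obtain ⟨_, ⟨A, rfl⟩, hbij, hmatch⟩ :=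
          exists_isBij_forall_le_subset_matchingPairs hC hD hCb hDb n
        exact ⟨A, fun k hk => ⟨hbij, hmatch k hk⟩⟩
  exact ⟨N.elems A, isInternal_elems A, (hA 0).1, fun n => (hA n).2⟩

theorem piecewiseLE_of_subset_iInter {X : Set (N.Obj σ)} (hX : N.IsBorel X)
    {C : ℕ → Set (N.Obj σ)} {D : ℕ → Set (N.Obj τ)} {b : ℕ → N.HNat} (hC : Antitone C)
    (hD : Antitone D) (hCb : ∀ n, HasCard (C n) (b n)) (hDb : ∀ n, HasCard (D n) (b n))
    (hXC : X ⊆ ⋂ n, C n) : PiecewiseLE X (⋂ n, D n) := by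
  obtain ⟨R, hR, hbij, hmatch⟩ := exists_isBij_forall_subset_matchingPairs hC hD hCb hDb
  refine hbij.piecewiseLE (hR.piecewiseInternal hbij.biUnique) hX
    (hXC.trans (Set.iInter_subset C 0)) ?_
  rintro y ⟨x, hx, hxy⟩
  exact Set.mem_iInter.2 fun n =>
    (pair_mem_matchingPairs.1 (hmatch n hxy)).1 (Set.mem_iInter.1 (hXC hx) n)

end NonstandardUniverse

/-! ### Finite sets -/

namespace NonstandardUniverse

variable {N : NonstandardUniverse.{u}} {σ τ : FinType}

theorem elems_setFun_singleton (f : σ.Carrier → τ.Carrier) (t : N.Obj σ) :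
    N.elems (N.setFun (fun i => {f i}) t) = {N.starFun f t} := by
  ext y
  obtain ⟨ρ, t, π, g, rfl, rfl⟩ := exists_starFun₂ t y
  rw [setFun_starFun, starFun_mem_elems_setFun, starFun_starFun, Set.mem_singleton_iff,
    starFun_eq_iff]
  rfl

theorem hasCard_singleton (x : N.Obj σ) : HasCard {x} 1 := by
  rw [← N.starFun_id x, ← elems_setFun_singleton, one_eq_natFun x, hasCard_setFun]
  exact .of_forall fun i => by rw [Set.encard_singleton, Nat.cast_one]

theorem hasCard_empty : HasCard (∅ : Set (N.Obj σ)) 0 := by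
  obtain ⟨y, hy, hcard⟩ := (cardLE_empty (N := N) (σ := σ) 0).exists_hasCard
  rwa [nonpos_iff_eq_zero.1 hy] at hcard

theorem hasCard_of_finite {S : Set (N.Obj σ)} (hS : S.Finite) : HasCard S S.ncard := by
  induction S, hS using Set.Finite.induction_on with
  | empty => simpa only [Set.ncard_empty, Nat.cast_zero] using hasCard_empty
  | @insert a S ha hS ih =>
    rw [Set.ncard_insert_of_notMem ha hS, Set.insert_eq, Set.union_comm, Nat.cast_add, Nat.cast_one]
    exact ih.union (hasCard_singleton a) (Set.disjoint_singleton_right.2 ha)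

theorem exists_eq_natCast_of_lt {x : N.HNat} {n : ℕ} (h : x < n) :
    ∃ k < n, x = (k : N.HNat) := by
  induction n with
  | zero => exact absurd h (Nat.cast_zero (R := N.HNat) ▸ not_lt_zero)
  | succ n ih =>
    rw [Nat.cast_succ, Order.lt_add_one_iff] at h
    obtain h | h := h.lt_or_eq
    · obtain ⟨k, hk, rfl⟩ := ih h
      exact ⟨k, hk.trans n.lt_succ_self, rfl⟩
    · exact ⟨n, n.lt_succ_self, h⟩

end NonstandardUniverse

/-! ### Standard parts of quotients -/

namespace NonstandardUniverse

open FinType Filter Topology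

variable {N : NonstandardUniverse.{u}} {σ : FinType}

/-- The ultrafilter on `ℕ × ℕ` of the pair `(c, x)`, along which standard functions of two numbers
are evaluated at `(c, x)`. -/
def pairUlt (c x : N.HNat) : Ultrafilter (ℕ × ℕ) := N.ult (N.pair c x)

theorem pairUlt_natFun (f g : σ.Carrier → ℕ) (t : N.Obj σ) :
    pairUlt (N.natFun f t) (N.natFun g t) = (N.ult t).map (fun i => (f i, g i)) :=
  (congrArg N.ult (N.pair_starFun (τ := nat) (ρ := nat) f g t)).trans
    (N.ult_starFun (τ := prod nat nat) (fun i => (f i, g i)) t)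

/-- The standard part of `x / c` is `r`. Since `*ℕ` has no quotients, this is expressed as
convergence of the standard quotients along `pairUlt c x`. The junk value
`0` of division by zero makes `0` the standard part of every `x / 0`. -/
def IsSt (c x : N.HNat) (r : ℝ) : Prop :=
  Tendsto (fun p : ℕ × ℕ => (p.2 : ℝ) / p.1) (pairUlt c x) (𝓝 r)

theorem isSt_natFun {f g : σ.Carrier → ℕ} {t : N.Obj σ} {r : ℝ} :
    IsSt (N.natFun f t) (N.natFun g t) r ↔
      Tendsto (fun i => (g i : ℝ) / f i) (N.ult t) (𝓝 r) := by
  rw [IsSt, pairUlt_natFun, Ultrafilter.coe_map, tendsto_map'_iff]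
  rfl

theorem natFun_ne_zero {f : σ.Carrier → ℕ} {t : N.Obj σ} :
    N.natFun f t ≠ 0 ↔ ∀ᶠ i in N.ult t, f i ≠ 0 := by
  rw [zero_eq_natFun t, Ne, natFun_eq_iff, Ultrafilter.eventually_not]

theorem exists_isSt {c x : N.HNat} {n : ℕ} (h : x ≤ n * c) : ∃ r, IsSt c x r := by
  obtain ⟨ρ, t, f, g, rfl, rfl⟩ := exists_natFun₂ c x
  simp only [natCast_eq_natFun n t, natFun_mul, natFun_le] at h
  have hquot : ∀ᶠ i in N.ult t, (g i : ℝ) / f i ∈ Set.Icc (0 : ℝ) n := by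
    filter_upwards [h] with i hi
    exact ⟨by positivity, div_le_of_le_mul₀ (by positivity) (by positivity) (by exact_mod_cast hi)⟩
  obtain ⟨r, -, hr⟩ := (isCompact_Icc (a := (0 : ℝ)) (b := n)).ultrafilter_le_nhds
    ((N.ult t).map fun i => (g i : ℝ) / f i) (le_principal_iff.2 hquot)
  exact ⟨r, isSt_natFun.2 hr⟩

namespace IsSt

variable {c x y : N.HNat} {r s : ℝ}

theorem nonneg (h : IsSt c x r) : 0 ≤ r :=
  ge_of_tendsto' h fun p => by positivity

theorem unique (h : IsSt c x r) (h' : IsSt c x s) : r = s :=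
  tendsto_nhds_unique h h'

theorem add (h : IsSt c x r) (h' : IsSt c y s) : IsSt c (x + y) (r + s) := by
  obtain ⟨ρ, t, f, g, k, rfl, rfl, rfl⟩ := exists_natFun₃ c x y
  rw [isSt_natFun] at h h'
  rw [natFun_add, isSt_natFun]
  refine (h.add h').congr fun i => ?_
  push_cast
  ring

theorem natCast_mul (h : IsSt c x r) (n : ℕ) : IsSt c (n * x) (n * r) := by
  obtain ⟨ρ, t, f, g, rfl, rfl⟩ := exists_natFun₂ c x
  rw [isSt_natFun] at h
  rw [natCast_eq_natFun n t, natFun_mul, isSt_natFun]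
  refine (h.const_mul _).congr fun i => ?_
  push_cast
  ring

theorem mono (h : IsSt c x r) (h' : IsSt c y s) (hxy : x ≤ y) : r ≤ s := by
  obtain ⟨ρ, t, f, g, k, rfl, rfl, rfl⟩ := exists_natFun₃ c x y
  rw [isSt_natFun] at h h'
  refine le_of_tendsto_of_tendsto h h' ((natFun_le.1 hxy).mono fun i hi => ?_)
  exact div_le_div_of_nonneg_right (Nat.cast_le.2 hi) (Nat.cast_nonneg _)

theorem lt (h : IsSt c x r) (h' : IsSt c y s) (hrs : r < s) : x < y :=
  lt_of_not_ge fun hyx => hrs.not_ge (h'.mono h hyx)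

theorem trans (hx : x ≠ 0) (h : IsSt c x r) (h' : IsSt x y s) : IsSt c y (s * r) := by
  obtain ⟨ρ, t, f, g, k, rfl, rfl, rfl⟩ := exists_natFun₃ c x y
  rw [isSt_natFun] at h h' ⊢
  refine (h'.mul h).congr' ((natFun_ne_zero.1 hx).mono fun i hi => ?_)
  exact div_mul_div_cancel₀ (Nat.cast_ne_zero.2 hi)

theorem inv (hr : r ≠ 0) (h : IsSt c x r) : IsSt x c r⁻¹ := by
  obtain ⟨ρ, t, f, g, rfl, rfl⟩ := exists_natFun₂ c x
  rw [isSt_natFun] at h ⊢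
  exact (h.inv₀ hr).congr fun i => inv_div _ _

end IsSt

theorem isSt_self {c : N.HNat} (hc : c ≠ 0) : IsSt c c 1 := by
  obtain ⟨ρ, t, f, rfl⟩ := exists_natFun₁ c
  refine isSt_natFun.2 (tendsto_const_nhds.congr' ((natFun_ne_zero.1 hc).mono fun i hi => ?_))
  exact (div_self (Nat.cast_ne_zero.2 hi)).symm

theorem IsSt.exists_of_le {c x y : N.HNat} {r : ℝ} (hc : c ≠ 0) (h : IsSt c y r) (hxy : x ≤ y) :
    ∃ s ≤ r, IsSt c x s := by
  obtain ⟨n, hn⟩ := exists_nat_gt r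
  have hnc : IsSt c (n * c) n := by simpa only [mul_one] using (isSt_self hc).natCast_mul n
  obtain ⟨s, hs⟩ := exists_isSt (hxy.trans (h.lt hnc hn).le)
  exact ⟨s, hs.mono h hxy, hs⟩

theorem IsNonstandard.natCast_lt {c : N.HNat} (hc : N.IsNonstandard c) (n : ℕ) :
    (n : N.HNat) < c := by
  by_contra! h
  obtain ⟨k, -, hk⟩ := exists_eq_natCast_of_lt (h.trans_lt (Nat.cast_lt.2 n.lt_succ_self))
  exact hc k hk

theorem IsNonstandard.ne_zero {c : N.HNat} (hc : N.IsNonstandard c) : c ≠ 0 :=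
  (zero_le.trans_lt (hc.natCast_lt 0)).ne'

theorem IsNonstandard.tendsto {f : σ.Carrier → ℕ} {t : N.Obj σ}
    (hc : N.IsNonstandard (N.natFun f t)) : Tendsto f (N.ult t) atTop := by
  refine tendsto_atTop.2 fun n => ?_
  have hn := hc.natCast_lt n
  rw [natCast_eq_natFun n t, natFun_lt] at hn
  exact hn.mono fun i hi => hi.le

theorem floorMul_natFun (f : σ.Carrier → ℕ) (t : N.Obj σ) (r : ℝ) :
    N.floorMul (N.natFun f t) r = N.natFun (fun i => ⌊(f i : ℝ) * r⌋₊) t :=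
  N.starFun_starFun (τ := nat) (ρ := nat) _ f t

theorem isSt_floorMul {c : N.HNat} (hc : N.IsNonstandard c) {r : ℝ} (hr : 0 ≤ r) :
    IsSt c (N.floorMul c r) r := by
  obtain ⟨ρ, t, f, rfl⟩ := exists_natFun₁ c
  rw [floorMul_natFun, isSt_natFun]
  refine ((tendsto_nat_floor_mul_div_atTop hr).comp
    (tendsto_natCast_atTop_atTop.comp hc.tendsto)).congr fun i => ?_
  simp only [Function.comp_apply, mul_comm]

theorem floorMul_of_nonpos (c : N.HNat) {r : ℝ} (hr : r ≤ 0) : N.floorMul c r = 0 := by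
  obtain ⟨ρ, t, f, rfl⟩ := exists_natFun₁ c
  rw [floorMul_natFun, zero_eq_natFun t, natFun_eq_iff]
  exact .of_forall fun i =>
    Nat.floor_of_nonpos (mul_nonpos_of_nonneg_of_nonpos (Nat.cast_nonneg _) hr)

theorem floorMul_mono (c : N.HNat) {r s : ℝ} (h : r ≤ s) : N.floorMul c r ≤ N.floorMul c s := by
  obtain ⟨ρ, t, f, rfl⟩ := exists_natFun₁ c
  rw [floorMul_natFun, floorMul_natFun, natFun_le]
  exact .of_forall fun i => Nat.floor_mono (mul_le_mul_of_nonneg_left h (Nat.cast_nonneg _))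

/-- The set of `x` for which `x / c` is finite of standard part less than `r`. -/
def stLT (c : N.HNat) (r : ℝ) : Set N.HNat := {x | ∃ s < r, IsSt c x s}

/-- The set of `x` for which `x / c` is finite of standard part at most `r`. -/
def stLE (c : N.HNat) (r : ℝ) : Set N.HNat := {x | ∃ s ≤ r, IsSt c x s}

theorem stLT_eq_iUnion {c : N.HNat} (hc : N.IsNonstandard c) (r : ℝ) :
    stLT c r = ⋃ n : ℕ, Set.Iio (N.floorMul c (r - 1 / (n + 1))) := by
  ext x
  rw [Set.mem_iUnion]
  constructor
  · rintro ⟨s, hs, hx⟩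
    obtain ⟨n, hn⟩ := exists_nat_one_div_lt (sub_pos.2 hs)
    have hs' : s < r - 1 / (n + 1) := by linarith
    exact ⟨n, hx.lt (isSt_floorMul hc (hx.nonneg.trans hs'.le)) hs'⟩
  · rintro ⟨n, hn⟩
    rcases le_total (r - 1 / (n + 1)) 0 with h | h
    · rw [floorMul_of_nonpos c h] at hn
      exact absurd (Set.mem_Iio.1 hn) not_lt_zero
    · obtain ⟨s, hs, hx⟩ := (isSt_floorMul hc h).exists_of_le hc.ne_zero (le_of_lt hn)
      exact ⟨s, hs.trans_lt (sub_lt_self _ (by positivity)), hx⟩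

theorem stLE_eq_iInter {c : N.HNat} (hc : N.IsNonstandard c) {r : ℝ} (hr : 0 ≤ r) :
    stLE c r = ⋂ n : ℕ, Set.Iio (N.floorMul c (r + 1 / (n + 1))) := by
  have hst : ∀ n : ℕ, IsSt c (N.floorMul c (r + 1 / (n + 1))) (r + 1 / (n + 1)) :=
    fun n => isSt_floorMul hc (by positivity)
  ext x
  rw [Set.mem_iInter]
  constructor
  · rintro ⟨s, hs, hx⟩ n
    exact hx.lt (hst n) (hs.trans_lt (lt_add_of_pos_right _ (by positivity)))
  · intro h
    obtain ⟨s, -, hs⟩ := (hst 0).exists_of_le hc.ne_zero (le_of_lt (h 0))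
    refine ⟨s, le_of_forall_pos_le_add fun ε hε => ?_, hs⟩
    obtain ⟨n, hn⟩ := exists_nat_one_div_lt hε
    have hsn := hs.mono (hst n) (le_of_lt (h n))
    linarith

theorem isBorel_stLT {c : N.HNat} (hc : N.IsNonstandard c) (r : ℝ) : N.IsBorel (stLT c r) := by
  rw [stLT_eq_iUnion hc]
  exact .iUnion fun n => (isInternal_Iio _).isBorel

theorem isBorel_stLE {c : N.HNat} (hc : N.IsNonstandard c) {r : ℝ} (hr : 0 ≤ r) :
    N.IsBorel (stLE c r) := by
  rw [stLE_eq_iInter hc hr]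
  exact .iInter fun n => (isInternal_Iio _).isBorel

theorem setOf_isSt_eq_diff (c : N.HNat) (r : ℝ) : {x | IsSt c x r} = stLE c r \ stLT c r := by
  ext x
  constructor
  · exact fun h => ⟨⟨r, le_rfl, h⟩, fun ⟨s, hs, h'⟩ => hs.ne (h'.unique h)⟩
  · rintro ⟨⟨s, hs, h⟩, h'⟩
    obtain rfl : s = r := hs.antisymm (not_lt.1 fun hlt => h' ⟨s, hlt, h⟩)
    exact h

theorem isBorel_setOf_isSt {c : N.HNat} (hc : N.IsNonstandard c) {r : ℝ} (hr : 0 ≤ r) :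
    N.IsBorel {x | IsSt c x r} := by
  rw [setOf_isSt_eq_diff]
  exact (isBorel_stLE hc hr).diff (isBorel_stLT hc r)

theorem quotNearOne_iff_forall_mul_le {x y : N.HNat} (hxy : x ≤ y) :
    N.QuotNearOne x y ↔ ∀ n : ℕ, n * y ≤ n * x + y :=
  forall_congr' fun _ => and_iff_right ((mul_le_mul_right hxy _).trans le_self_add)

theorem IsSt.quotNearOne_iff {c x y : N.HNat} {r s : ℝ} (hs : 0 < s)
    (hx : IsSt c x r) (hy : IsSt c y s) (hxy : x ≤ y) : N.QuotNearOne x y ↔ r = s := by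
  rw [quotNearOne_iff_forall_mul_le hxy]
  constructor
  · intro hnear
    refine (hx.mono hy hxy).eq_of_not_lt fun hlt => ?_
    obtain ⟨n, hn⟩ := exists_nat_gt (s / (s - r))
    have hle := (hy.natCast_mul n).mono ((hx.natCast_mul n).add hy) (hnear n)
    rw [div_lt_iff₀ (sub_pos.2 hlt)] at hn
    linarith
  · rintro rfl n
    exact ((hy.natCast_mul n).lt ((hx.natCast_mul n).add hy) (lt_add_of_pos_right _ hs)).le

theorem realCut_eq_stLT {c : N.HNat} (hc : N.IsNonstandard c) {r : ℝ} (hr : 0 < r) :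
    N.realCut c r = stLT c r := by
  have hF := isSt_floorMul hc hr.le
  ext x
  constructor
  · rintro ⟨hx, y, hy, hxy, hnear⟩
    obtain ⟨s, hsr, hs⟩ := hF.exists_of_le hc.ne_zero hx
    obtain ⟨q, hqr, hq⟩ := hF.exists_of_le hc.ne_zero hy
    have hsq : s ≤ q := hs.mono hq (le_of_lt hxy)
    refine ⟨s, hsr.lt_of_ne ?_, hs⟩
    rintro rfl
    exact hnear ((hs.quotNearOne_iff (hr.trans_le hsq) hq (le_of_lt hxy)).2 (hsq.antisymm hqr))
  · rintro ⟨s, hs, hx⟩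
    have hlt := hx.lt hF hs
    exact ⟨hlt.le, _, le_rfl (a := N.floorMul c r), hlt, fun hnear =>
      hs.ne ((hx.quotNearOne_iff hr hF hlt.le).1 hnear)⟩

theorem setOf_isSt_piecewiseLE {c : N.HNat} (hc : N.IsNonstandard c) {r s : ℝ} (hr : 0 ≤ r)
    (hs : 0 < s) : PiecewiseLE {x | IsSt c x r} {x | IsSt c x s} := by
  have ha := isSt_floorMul hc hr
  have hb := isSt_floorMul hc hs.le
  set a := N.floorMul c r
  set b := N.floorMul c s
  refine (biUnique_translation b a).isBij.piecewiseLE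
    ((isInternal_translation b a).piecewiseInternal (biUnique_translation b a))
    (isBorel_setOf_isSt hc hr) ?_ ?_
  · intro x hx
    have hle : a ≤ x + b := (ha.lt (IsSt.add hx hb) (lt_add_of_pos_right r hs)).le
    exact ⟨N.pair x (x + b - a), pair_mem_translation.2 (tsub_add_cancel_of_le hle), fst_pair _ _⟩
  · rintro y ⟨x, hx, hxy⟩
    have hadd : IsSt c (y + a) (r + s) := pair_mem_translation.1 hxy ▸ IsSt.add hx hb
    obtain ⟨q, -, hq⟩ := hadd.exists_of_le hc.ne_zero le_self_add
    obtain rfl : q = s := by linarith [(hq.add ha).unique hadd]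
    exact hq

theorem stLE_piecewiseLE_stLT {c : N.HNat} (hc : N.IsNonstandard c) {r : ℝ} (hr : 0 < r) :
    PiecewiseLE (stLE c r) (stLT c r) := by
  -- Hilbert's hotel: shift the monads of `r, r / 2, r / 4, …` one step and fix everything else.
  let M : ℕ → Set N.HNat := fun j => {x | IsSt c x (r / 2 ^ j)}
  have hpos : ∀ j : ℕ, 0 < r / 2 ^ j := fun j => by positivity
  have hM : ∀ j, N.IsBorel (M j) := fun j => isBorel_setOf_isSt hc (hpos j).le
  have hanti : StrictAnti fun j : ℕ => r / 2 ^ j :=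
    fun i j hij => div_lt_div_of_pos_left hr (by positivity) (pow_lt_pow_right₀ one_lt_two hij)
  have hdisj : Pairwise (Function.onFun Disjoint M) := fun i j hij =>
    Set.disjoint_left.2 fun x hi hj => hij (hanti.injective (IsSt.unique (c := c) (x := x) hi hj))
  have hdisj' : Pairwise (Function.onFun Disjoint fun j => M (j + 1)) :=
    fun i j hij => hdisj (Nat.succ_injective.ne hij)
  have hshift : PiecewiseLE (⋃ j, M j) (⋃ j, M (j + 1)) :=
    .iUnion (fun j => setOf_isSt_piecewiseLE hc (hpos j).le (hpos (j + 1))) hdisj hdisj'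
  have hfix : PiecewiseLE (stLE c r \ ⋃ j, M j) (stLE c r \ ⋃ j, M j) :=
    ((isBorel_stLE hc hr.le).diff (.iUnion hM)).piecewiseLE_of_subset subset_rfl
  have hsub : ⋃ j, M j ⊆ stLE c r := Set.iUnion_subset fun j x hx =>
    ⟨_, (div_le_self hr.le (one_le_pow₀ one_le_two)), hx⟩
  rw [← Set.union_sdiff_cancel hsub]
  refine (hshift.union hfix Set.disjoint_sdiff_right (Set.disjoint_sdiff_right.mono_left
    (Set.iUnion_subset fun j => Set.subset_iUnion M (j + 1)))).mono_right ?_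
  refine Set.union_subset (Set.iUnion_subset fun j x hx => ?_) fun x hx => ?_
  · exact ⟨_, div_lt_self hr (one_lt_pow₀ one_lt_two j.succ_ne_zero), hx⟩
  · obtain ⟨⟨s, hs, hst⟩, hxM⟩ := hx
    refine ⟨s, hs.lt_of_ne ?_, hst⟩
    rintro rfl
    exact hxM (Set.mem_iUnion.2 ⟨0, by simpa [M] using hst⟩)

end NonstandardUniverse

/-! ### Minimal cuts -/

namespace NonstandardUniverse

variable {N : NonstandardUniverse.{u}}

theorem BorelLE.exists_cover {S T : Set N.HNat} (h : N.BorelLE S T) {d : N.HNat}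
    (hT : T ⊆ Set.Iio d) {n : ℕ} (hn : 0 < n) :
    ∃ C e, S ⊆ C ∧ CardLE C e ∧ n * e ≤ (n + 1) * d := by
  obtain ⟨Z, hZ, G, hG, hbij⟩ := borelLE_iff_exists_isBij.1 h
  have hsnd : ∀ Y ⊆ G, snd '' Y ⊆ Set.Iio d := fun Y hY =>
    (Set.image_mono hY).trans (hbij.2.image_eq.subset.trans (hZ.trans hT))
  have hcard : ∀ Y ⊆ G, IsInternal Y → CardLE Y d := fun Y hY hYint =>
    .of_image ((hasCard_Iio d).cardLE.mono hYint.image_snd (hsnd Y hY) le_rfl) hYint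
      (hbij.2.injOn.mono hY)
  obtain ⟨C, e, hGC, hCe, hed⟩ := hG.exists_cover hcard hn
  exact ⟨fst '' C, e, hbij.1.image_eq.symm.subset.trans (Set.image_mono hGC),
    hCe.image Prod.fst, hed⟩

theorem isMinimalBorelCut_of_forall_exists {U : Set N.HNat} (hU : N.IsBorelCut U)
    (h : ∀ u ∈ U, ∃ (k : ℕ) (w : N.HNat), 0 < k ∧ Set.Iio w ⊆ U ∧ (k + 1) * u < k * w) :
    N.IsMinimalBorelCut U := by
  refine ⟨hU, fun V hV hVU hequiv => ?_⟩
  obtain ⟨u, hu, huV⟩ := Set.exists_of_ssubset hVU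
  obtain ⟨k, w, hk, hw, hkw⟩ := h u hu
  have hVu : V ⊆ Set.Iio u := fun v hv =>
    Set.mem_Iio.2 (lt_of_not_ge fun huv => huV (hV v hv u huv))
  obtain ⟨C, e, hUC, hCe, hed⟩ := hequiv.2.exists_cover hVu hk
  have hwe : w ≤ e := (hasCard_Iio w).le_of_subset hCe (hw.trans hUC)
  exact (hkw.trans_le (mul_le_mul_right hwe _)).not_ge hed

theorem isMinimalBorelCut_of_isAdditive {U : Set N.HNat} (hU : N.IsBorelCut U)
    (h : N.IsAdditive U) : N.IsMinimalBorelCut U := by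
  refine isMinimalBorelCut_of_forall_exists hU fun u hu =>
    ⟨1, u + u + 1, one_pos, fun x hx => ?_, ?_⟩
  · exact hU.1 _ (h u hu u hu) x (Order.lt_add_one_iff (α := N.HNat).1 hx)
  · rw [Nat.cast_one, one_mul, add_mul, one_mul, Order.lt_add_one_iff]

theorem isBorelCut_below (c : N.HNat) : N.IsBorelCut (N.below c) :=
  ⟨fun _ hx _ hy => lt_of_le_of_lt (α := N.HNat) hy hx, (isInternal_Iio c).isBorel⟩

theorem isMinimalBorelCut_below_ofNat (n : ℕ) : N.IsMinimalBorelCut (N.below (N.ofNat n)) := by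
  refine isMinimalBorelCut_of_forall_exists (isBorelCut_below _) fun u hu => ?_
  obtain ⟨k, hk, rfl⟩ := exists_eq_natCast_of_lt (n := n) hu
  refine ⟨k + 1, n, k.succ_pos, subset_rfl, ?_⟩
  have hlt : (k + 1 + 1) * k < (k + 1) * n := by nlinarith
  exact_mod_cast hlt

theorem isCut_stLT {c : N.HNat} (hc : c ≠ 0) (r : ℝ) : N.IsCut (stLT c r) := by
  rintro x ⟨s, hs, hx⟩ y hy
  obtain ⟨q, hq, hyq⟩ := hx.exists_of_le hc hy
  exact ⟨q, hq.trans_lt hs, hyq⟩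

theorem isBorelCut_stLT {c : N.HNat} (hc : N.IsNonstandard c) (r : ℝ) :
    N.IsBorelCut (stLT c r) :=
  ⟨isCut_stLT hc.ne_zero r, isBorel_stLT hc r⟩

theorem isMinimalBorelCut_stLT {c : N.HNat} (hc : N.IsNonstandard c) (r : ℝ) :
    N.IsMinimalBorelCut (stLT c r) := by
  refine isMinimalBorelCut_of_forall_exists (isBorelCut_stLT hc r) ?_
  rintro u ⟨s, hs, hu⟩
  have hs0 := hu.nonneg
  obtain ⟨q, hsq, hqr⟩ := exists_between hs
  have hw := isSt_floorMul hc (hs0.trans hsq.le)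
  obtain ⟨k, hk⟩ := exists_nat_gt (s / (q - s))
  have hk0 : 0 < k := Nat.cast_pos.1 ((div_nonneg hs0 (sub_nonneg.2 hsq.le)).trans_lt hk)
  rw [div_lt_iff₀ (sub_pos.2 hsq)] at hk
  have hku := hu.natCast_mul (k + 1)
  push_cast at hku
  exact ⟨k, N.floorMul c q, hk0,
    fun x hx => isCut_stLT hc.ne_zero r _ ⟨q, hqr, hw⟩ x (le_of_lt (α := N.HNat) hx),
    hku.lt (hw.natCast_mul k) (by linarith)⟩

end NonstandardUniverse

/-! ### The cut of a Borel set -/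

namespace NonstandardUniverse

open FinType

variable {N : NonstandardUniverse.{u}} {σ : FinType}

/-- The inner cut of `X`, consisting of all `x` such that some internal subset of `X` has `x + 1`
elements; it measures `X` from the inside, and `[0, x]` then embeds in `X`. -/
def innerCut (X : Set (N.Obj σ)) : Set N.HNat := {x | ∃ Y ⊆ X, HasCard Y (x + 1)}

section

variable {X : Set (N.Obj σ)}

theorem mem_innerCut_of_le {x y : N.HNat} (hx : x ∈ innerCut X) (h : y ≤ x) :
    y ∈ innerCut X := by
  obtain ⟨Y, hYX, hY⟩ := hx
  obtain ⟨T, hTY, hT⟩ := hY.exists_subset (add_le_add_left h 1)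
  exact ⟨T, hTY.trans hYX, hT⟩

theorem isCut_innerCut (X : Set (N.Obj σ)) : N.IsCut (innerCut X) :=
  fun _ hx _ h => mem_innerCut_of_le hx h

theorem exists_hasCard_of_mem_innerCut {x : N.HNat} (hx : x ∈ innerCut X) :
    ∃ Y ⊆ X, HasCard Y x := by
  obtain ⟨Y, hYX, hY⟩ := hx
  obtain ⟨T, hTY, hT⟩ := hY.exists_subset le_self_add
  exact ⟨T, hTY.trans hYX, hT⟩

theorem cardLE_of_notMem_innerCut {Y : Set (N.Obj σ)} {d : N.HNat} (hd : d ∉ innerCut X)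
    (hYX : Y ⊆ X) (hY : IsInternal Y) : CardLE Y d := by
  by_contra h
  obtain ⟨T, hTY, hT⟩ := exists_hasCard_of_not_cardLE hY h
  exact hd ⟨T, hTY.trans hYX, hT⟩

theorem natCast_mem_innerCut (hX : X.Infinite) (n : ℕ) : (n : N.HNat) ∈ innerCut X := by
  obtain ⟨T, hTX, hT⟩ := hX.exists_subset_card_eq (n + 1)
  refine ⟨T, hTX, ?_⟩
  rw [← Nat.cast_add_one, ← hT, ← Set.ncard_coe_finset]
  exact hasCard_of_finite T.finite_toSet

theorem zero_mem_innerCut (hX : X.Infinite) : 0 ∈ innerCut X :=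
  Nat.cast_zero (R := N.HNat) ▸ natCast_mem_innerCut hX 0

theorem add_one_mem_innerCut (hX : X.Infinite) (hadd : N.IsAdditive (innerCut X)) {x : N.HNat}
    (hx : x ∈ innerCut X) : x + 1 ∈ innerCut X :=
  hadd _ hx _ (Nat.cast_one (R := N.HNat) ▸ natCast_mem_innerCut hX 1)

theorem sum_mem_innerCut (hX : X.Infinite) (hadd : N.IsAdditive (innerCut X)) {e : ℕ → N.HNat}
    (he : ∀ n, e n ∈ innerCut X) (n : ℕ) : ∑ i ∈ Finset.range n, e i ∈ innerCut X := by
  induction n with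
  | zero => simpa only [Finset.range_zero, Finset.sum_empty] using zero_mem_innerCut hX
  | succ n ih =>
    rw [Finset.sum_range_succ]
    exact hadd _ ih _ (he n)

theorem exists_mem_innerCut_cardLE (hX : X.Infinite) (hadd : N.IsAdditive (innerCut X))
    {d : N.HNat} (hd : d ∉ innerCut X) {Y : Set (N.Obj σ)} (hYX : Y ⊆ X) (hY : IsInternal Y) :
    ∃ e ∈ innerCut X, CardLE Y e := by
  obtain ⟨y, -, hcard⟩ := (cardLE_of_notMem_innerCut hd hYX hY).exists_hasCard
  refine ⟨y, ?_, hcard.cardLE⟩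
  rcases eq_or_ne y 0 with rfl | hy
  · exact zero_mem_innerCut hX
  · have hpred : y - 1 + 1 = y := tsub_add_cancel_of_le (Order.one_le_iff_ne_zero.2 hy)
    rw [← hpred] at hcard ⊢
    exact add_one_mem_innerCut hX hadd ⟨Y, hYX, hcard⟩

theorem piecewiseLE_iInter_Iio (hX : N.IsBorel X) {b : ℕ → N.HNat}
    (h : ∀ n, ∃ C, X ⊆ C ∧ CardLE C (b n)) : PiecewiseLE X (⋂ n, Set.Iio (b n)) := by
  choose C hXC hC using h
  have hinter : ∀ n, CardLE (⋂ i < n + 1, C i) (b n) := fun n => by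
    refine (hC n).mono ?_ (Set.biInter_subset_of_mem n.lt_succ_self) le_rfl
    rw [← compl_compl (⋂ i < n + 1, C i)]
    simp only [Set.compl_iInter]
    exact (isInternal_iUnion_lt (fun i => (hC i).isInternal.compl) _).compl
  choose k hk hcard using fun n => (hinter n).exists_hasCard
  have hanti : Antitone fun n => ⋂ i < n + 1, C i := fun m n hmn =>
    Set.biInter_subset_biInter_left fun i hi => lt_of_lt_of_le hi (Nat.succ_le_succ hmn)
  have hantik : Antitone fun n => Set.Iio (k n) := fun m n hmn =>
    Set.Iio_subset_Iio ((hcard n).le_of_subset (hcard m).cardLE (hanti hmn))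
  exact (piecewiseLE_of_subset_iInter hX hanti hantik hcard (fun n => hasCard_Iio (k n))
    (Set.subset_iInter fun n => Set.subset_iInter₂ fun i _ => hXC i)).mono_right
    (Set.iInter_mono fun n => Set.Iio_subset_Iio (hk n))

theorem exists_forall_lt (u : ℕ → N.HNat) : ∃ x, ∀ n, u n < x := by
  refine exists_forall_mem_of_isInternal (S := fun n => Set.Ioi (u n))
    (fun n => Set.compl_Iic (a := u n) ▸ (isInternal_Iic _).compl) fun n =>
      ⟨∑ i ∈ Finset.range (n + 1), u i + 1, fun k hk =>
        Set.mem_Ioi.2 (Order.lt_add_one_iff.2 ?_)⟩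
  exact Finset.single_le_sum (f := u) (fun _ _ => zero_le)
    (Finset.mem_range.2 (Nat.lt_succ_of_le hk))

theorem exists_isInternal_subset_iInter {D : ℕ → Set (N.Obj σ)} (hD : ∀ n, IsInternal (D n))
    (hanti : Antitone D) {P : ℕ → Set (N.Obj σ) → Prop}
    (hP : ∀ n, IsInternal {A : N.Obj (pow σ) | P n (N.elems A)}) (h : ∀ m n, P m (D n)) :
    ∃ T ⊆ ⋂ n, D n, IsInternal T ∧ ∀ n, P n T := by
  obtain ⟨A, hA⟩ := exists_forall_mem_of_isInternal
    (fun n => (hP n).inter (isInternal_subset (hD n))) fun n => by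
      obtain ⟨A, hA⟩ := hD n
      exact ⟨A, fun k hk => ⟨(congrArg (P k) hA).mpr (h k n), hA.subset.trans (hanti hk)⟩⟩
  exact ⟨N.elems A, Set.subset_iInter fun n => (hA n).2, isInternal_elems A, fun n => (hA n).1⟩

end

/-! ### Canonical cuts -/

/-- Each of `X` and `Y` embeds in the other by a countable union of internal partial bijections;
such a pair is Borel equivalent. -/
def PiecewiseEquiv {τ : FinType} (X : Set (N.Obj σ)) (Y : Set (N.Obj τ)) : Prop :=
  PiecewiseLE X Y ∧ PiecewiseLE Y X

/-- The cuts which represent all Borel cardinalities: the additive Borel cuts, the finite segments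
`[0, n)`, and the cuts `N.realCut c r`. -/
def IsCanonicalCut (W : Set N.HNat) : Prop :=
  (N.IsBorelCut W ∧ N.IsAdditive W) ∨ (∃ n : ℕ, W = N.below (N.ofNat n)) ∨
    ∃ c : N.HNat, N.IsNonstandard c ∧ ∃ r : ℝ, 0 < r ∧ W = N.realCut c r

theorem exists_isCanonicalCut_of_finite {X : Set (N.Obj σ)} (hX : X.Finite) :
    ∃ W, IsCanonicalCut W ∧ PiecewiseEquiv X W := by
  have hcard := hasCard_of_finite hX
  exact ⟨Set.Iio (X.ncard : N.HNat), Or.inr (Or.inl ⟨_, rfl⟩),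
    hcard.piecewiseLE (hasCard_Iio _), (hasCard_Iio _).piecewiseLE hcard⟩

section Cofinal

variable {X : Set (N.Obj σ)} {u : ℕ → N.HNat}

theorem innerCut_eq_iUnion_Iic (hu : ∀ n, u n ∈ innerCut X)
    (hcof : ∀ x ∈ innerCut X, ∃ n, x ≤ u n) : innerCut X = ⋃ n, Set.Iic (u n) := by
  ext x
  rw [Set.mem_iUnion]
  exact ⟨hcof x, fun ⟨n, hn⟩ => mem_innerCut_of_le (hu n) hn⟩

theorem IsBorel.exists_cover_of_cofinal (hX : N.IsBorel X) (hinf : X.Infinite)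
    (hadd : N.IsAdditive (innerCut X)) (hu : ∀ n, u n ∈ innerCut X)
    (hcof : ∀ x ∈ innerCut X, ∃ n, x ≤ u n) :
    ∃ E : ℕ → Set (N.Obj σ), (∀ n, ∃ e ∈ innerCut X, CardLE (E n) e) ∧ X ⊆ ⋃ n, E n := by
  obtain ⟨E, -, hE, hXE⟩ | ⟨D, hD, hanti, hnot, hDX⟩ := hX.exists_cover_or_exists_iInter_subset
    (P := fun E => ∃ e ∈ innerCut X, CardLE E e) ⟨0, zero_mem_innerCut hinf, cardLE_empty 0⟩
  · exact ⟨E, hE, hXE⟩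
  · exfalso
    obtain ⟨T, hTD, hT, hTu⟩ := exists_isInternal_subset_iInter hD hanti
      (P := fun k T => ¬ CardLE T (u k)) (fun k => (isInternal_cardLE (u k)).compl)
      fun k n h => hnot n ⟨u k, hu k, h⟩
    obtain ⟨d, hd⟩ := exists_forall_lt u
    have hdX : d ∉ innerCut X := fun h =>
      let ⟨n, hn⟩ := hcof d h
      (hd n).not_ge hn
    obtain ⟨e, he, hTe⟩ := exists_mem_innerCut_cardLE hinf hadd hdX (hTD.trans hDX) hT
    obtain ⟨n, hn⟩ := hcof e he
    exact hTu n (hTe.mono_right hn)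

theorem piecewiseEquiv_innerCut_of_cofinal (hX : N.IsBorel X) (hinf : X.Infinite)
    (hadd : N.IsAdditive (innerCut X)) (hu : ∀ n, u n ∈ innerCut X)
    (hcof : ∀ x ∈ innerCut X, ∃ n, x ≤ u n) :
    N.IsBorel (innerCut X) ∧ PiecewiseEquiv X (innerCut X) := by
  have hW : N.IsBorel (innerCut X) := by
    rw [innerCut_eq_iUnion_Iic hu hcof]
    exact .iUnion fun n => (isInternal_Iic _).isBorel
  refine ⟨hW, ?_, ?_⟩
  · obtain ⟨E, hE, hXE⟩ := hX.exists_cover_of_cofinal hinf hadd hu hcof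
    choose e he hEe using hE
    exact piecewiseLE_of_subset_iUnion hX hEe hXE fun n x hx =>
      mem_innerCut_of_le (sum_mem_innerCut hinf hadd he n) (le_of_lt hx)
  · refine piecewiseLE_of_subset_iUnion_Iio hW
      (w := fun n => ∑ i ∈ Finset.range n, (u i + 1)) ?_ ?_ ?_
    · exact fun m n hmn => Finset.sum_le_sum_of_subset (Finset.range_mono hmn)
    · intro x hx
      obtain ⟨n, hn⟩ := hcof x hx
      refine Set.mem_iUnion.2 ⟨n + 1, ?_⟩
      rw [Set.mem_Iio, Finset.sum_range_succ]
      exact (Order.lt_add_one_iff.2 hn).trans_le le_add_self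
    · exact fun n => exists_hasCard_of_mem_innerCut
        (sum_mem_innerCut hinf hadd (fun i => add_one_mem_innerCut hinf hadd (hu i)) n)

end Cofinal

section NotCofinal

variable {X : Set (N.Obj σ)} {D : ℕ → Set (N.Obj σ)}

theorem IsBorel.exists_iInter_subset_of_not_cofinal (hX : N.IsBorel X) (hinf : X.Infinite)
    (hadd : N.IsAdditive (innerCut X))
    (hcof : ∀ u : ℕ → N.HNat, (∀ n, u n ∈ innerCut X) → ∃ x ∈ innerCut X, ∀ n, u n < x) :
    ∃ D : ℕ → Set (N.Obj σ), (∀ n, IsInternal (D n)) ∧ Antitone D ∧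
      (∀ n, ∀ e ∈ innerCut X, ¬ CardLE (D n) e) ∧ ⋂ n, D n ⊆ X := by
  obtain ⟨E, hEint, hE, hXE⟩ | ⟨D, hD, hanti, hnot, hDX⟩ := hX.exists_cover_or_exists_iInter_subset
    (P := fun E => ∃ e ∈ innerCut X, CardLE E e) ⟨0, zero_mem_innerCut hinf, cardLE_empty 0⟩
  · exfalso
    choose e he hEe using hE
    obtain ⟨x, ⟨Y, hYX, hY⟩, hx⟩ := hcof _ (sum_mem_innerCut hinf hadd he)
    obtain ⟨C, -, -, hEC, hC⟩ := exists_isInternal_superset_of_forall_cardLE hEint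
      isInternal_empty isInternal_univ (fun n => Set.subset_univ _) (d := x) fun n => by
        rw [Set.sdiff_empty]
        exact (cardLE_iUnion_lt hEe n).mono_right (hx n).le
    rw [Set.sdiff_empty] at hC
    have hle := hY.le_of_subset hC (hYX.trans (hXE.trans (Set.iUnion_subset hEC)))
    exact (Order.lt_add_one_iff.2 le_rfl).not_ge hle
  · exact ⟨D, hD, hanti, fun n e he h => hnot n ⟨e, he, h⟩, hDX⟩

theorem innerCut_eq_iInter_Iio {b : ℕ → N.HNat} (hanti : Antitone D)
    (hD : ∀ n, HasCard (D n) (b n)) (hDX : ⋂ n, D n ⊆ X) (hb : ∀ n, b n ∉ innerCut X) :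
    innerCut X = ⋂ n, Set.Iio (b n) := by
  ext x
  rw [Set.mem_iInter]
  constructor
  · exact fun hx n => not_le.1 fun h => hb n (mem_innerCut_of_le hx h)
  · intro hx
    obtain ⟨T, hTD, hT⟩ := exists_hasCard_subset_iInter (fun n => (hD n).isInternal) hanti
      (d := x + 1) fun n => (hD n).exists_subset (Order.add_one_le_of_lt (hx n))
    exact ⟨T, hTD.trans hDX, hT⟩

theorem IsBorel.exists_cover_of_notMem_innerCut (hX : N.IsBorel X) (hinf : X.Infinite)
    (hadd : N.IsAdditive (innerCut X)) {b : N.HNat} (hb : b ∉ innerCut X) :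
    ∃ C, X ⊆ C ∧ CardLE C b := by
  obtain ⟨q, hq⟩ := exists_forall_natCast_mul_le_iff b two_pos
  have hqX : q ∉ innerCut X := fun h => by
    have hq1 := add_one_mem_innerCut hinf hadd h
    have hlt : b < (2 : ℕ) * (q + 1) :=
      not_le.1 fun hle => (Order.lt_add_one_iff.2 le_rfl).not_ge ((hq _).1 hle)
    rw [Nat.cast_two, two_mul] at hlt
    exact hb (mem_innerCut_of_le (hadd _ hq1 _ hq1) hlt.le)
  obtain ⟨C, e, hXC, hC, hCe⟩ := hX.exists_cover (fun Y => cardLE_of_notMem_innerCut hqX) one_pos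
  rw [Nat.cast_one, one_mul, one_add_one_eq_two] at hCe
  exact ⟨C, hXC, hC.mono_right (hCe.trans (Nat.cast_two (R := N.HNat) ▸ (hq q).2 le_rfl))⟩

theorem piecewiseEquiv_innerCut_of_bounded (hX : N.IsBorel X) (hinf : X.Infinite)
    (hadd : N.IsAdditive (innerCut X)) (hanti : Antitone D) {b : ℕ → N.HNat}
    (hD : ∀ n, HasCard (D n) (b n)) (hDX : ⋂ n, D n ⊆ X) (hb : ∀ n, b n ∉ innerCut X) :
    N.IsBorel (innerCut X) ∧ PiecewiseEquiv X (innerCut X) := by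
  rw [innerCut_eq_iInter_Iio hanti hD hDX hb]
  have hW : N.IsBorel (⋂ n, Set.Iio (b n)) := .iInter fun n => (isInternal_Iio _).isBorel
  have hIio : Antitone fun n => Set.Iio (b n) := fun m n hmn =>
    Set.Iio_subset_Iio ((hD n).le_of_subset (hD m).cardLE (hanti hmn))
  exact ⟨hW, piecewiseLE_iInter_Iio hX fun n => hX.exists_cover_of_notMem_innerCut hinf hadd (hb n),
    (piecewiseLE_of_subset_iInter hW hIio hanti (fun n => hasCard_Iio (b n)) hD
      subset_rfl).mono_right hDX⟩

theorem piecewiseEquiv_univ_of_unbounded {X : Set N.HNat} {D : ℕ → Set N.HNat} (hX : N.IsBorel X)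
    (hD : ∀ n, IsInternal (D n)) (hanti : Antitone D) (hunb : ∀ n d, ¬ CardLE (D n) d)
    (hDX : ⋂ n, D n ⊆ X) : PiecewiseEquiv X (Set.univ : Set N.HNat) := by
  obtain ⟨T, hTD, hT, hTunb⟩ := exists_isInternal_subset_iInter hD hanti
    (P := fun _ T => ∀ d, ¬ CardLE T d) (fun _ => isInternal_forall_not_cardLE) fun _ => hunb
  obtain ⟨R, hR, hbij⟩ := exists_isBij_univ hT (hTunb 0)
  exact ⟨hX.piecewiseLE_of_subset (Set.subset_univ X), T, hTD.trans hDX, relInv R,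
    (hR.piecewiseInternal hbij.biUnique).relInv, hbij.relInv⟩

theorem exists_isCanonicalCut_of_not_cofinal {X : Set N.HNat} (hX : N.IsBorel X)
    (hinf : X.Infinite) (hadd : N.IsAdditive (innerCut X))
    (hcof : ∀ u : ℕ → N.HNat, (∀ n, u n ∈ innerCut X) → ∃ x ∈ innerCut X, ∀ n, u n < x) :
    ∃ W, IsCanonicalCut W ∧ PiecewiseEquiv X W := by
  obtain ⟨D, hD, hanti, hnot, hDX⟩ := hX.exists_iInter_subset_of_not_cofinal hinf hadd hcof
  by_cases hbdd : ∃ m d, CardLE (D m) d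
  · obtain ⟨m, d, hd⟩ := hbdd
    have hanti' : Antitone fun n => D (m + n) := fun i j hij => hanti (Nat.add_le_add_left hij m)
    have hDX' : ⋂ n, D (m + n) ⊆ X :=
      (Set.iInter_mono fun n => hanti (Nat.le_add_left n m)).trans hDX
    choose b _ hb using fun n =>
      (hd.mono (hD (m + n)) (hanti (Nat.le_add_right m n)) le_rfl).exists_hasCard
    obtain ⟨hW, hequiv⟩ := piecewiseEquiv_innerCut_of_bounded hX hinf hadd hanti' hb hDX'
      fun n h => hnot _ _ h (hb n).cardLE
    exact ⟨innerCut X, Or.inl ⟨⟨isCut_innerCut X, hW⟩, hadd⟩, hequiv⟩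
  · push Not at hbdd
    exact ⟨Set.univ, Or.inl ⟨⟨fun _ _ _ _ => trivial, isInternal_univ.isBorel⟩,
      fun _ _ _ _ => trivial⟩, piecewiseEquiv_univ_of_unbounded hX hD hanti hbdd hDX⟩

end NotCofinal

section NotAdditive

theorem IsCut.exists_add_notMem {U : Set N.HNat} (hU : N.IsCut U) (h : ¬ N.IsAdditive U) :
    ∃ c ∈ U, c + c ∉ U := by
  simp only [IsAdditive, not_forall] at h
  obtain ⟨x, hx, y, hy, hxy⟩ := h
  refine ⟨max x y, max_rec' (· ∈ U) hx hy, fun h => hxy ?_⟩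
  exact hU _ h _ (add_le_add (le_max_left x y) (le_max_right x y))

theorem IsCut.exists_floorMul_mem_and_notMem {U : Set N.HNat} (hU : N.IsCut U) {c : N.HNat}
    (hc : N.IsNonstandard c) (hcU : c ∈ U) (hccU : c + c ∉ U) :
    ∃ r : ℝ, 0 < r ∧ (∀ s < r, N.floorMul c s ∈ U) ∧ ∀ s, r < s → N.floorMul c s ∉ U := by
  have hself := isSt_self hc.ne_zero
  let A : Set ℝ := {s | N.floorMul c s ∈ U}
  have hmono : ∀ {s t}, s ≤ t → t ∈ A → s ∈ A := fun hst ht => hU _ ht _ (floorMul_mono c hst)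
  have hhalf : 1 / 2 ∈ A :=
    hU c hcU _ ((isSt_floorMul hc one_half_pos.le).lt hself one_half_lt_one).le
  have hthree : 3 ∉ A := fun h => hccU (hU _ h _
    ((hself.add hself).lt (isSt_floorMul hc zero_le_three) (by norm_num)).le)
  have hbdd : BddAbove A := ⟨3, fun s hs => le_of_not_ge fun h => hthree (hmono h hs)⟩
  refine ⟨sSup A, one_half_pos.trans_le (le_csSup hbdd hhalf), fun s hs => ?_, fun s hs h => ?_⟩
  · obtain ⟨t, ht, hst⟩ := exists_lt_of_lt_csSup ⟨_, hhalf⟩ hs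
    exact hmono hst.le ht
  · exact (le_csSup hbdd h).not_gt hs

variable {X : Set (N.Obj σ)} {c : N.HNat} {r : ℝ}

theorem IsBorel.exists_cover_floorMul (hX : N.IsBorel X) (hc : N.IsNonstandard c) {s : ℝ}
    (hr : 0 ≤ r) (hrX : N.floorMul c r ∉ innerCut X) (hrs : r < s) :
    ∃ C, X ⊆ C ∧ CardLE C (N.floorMul c s) := by
  have hcr := isSt_floorMul hc hr
  have hcs := isSt_floorMul hc (hr.trans hrs.le)
  obtain ⟨k, hk⟩ := exists_nat_gt (r / (s - r))
  have hk0 : 0 < k := Nat.cast_pos.1 ((div_nonneg hr (sub_nonneg.2 hrs.le)).trans_lt hk)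
  rw [div_lt_iff₀ (sub_pos.2 hrs)] at hk
  obtain ⟨C, e, hXC, hC, hCe⟩ := hX.exists_cover (fun Y => cardLE_of_notMem_innerCut hrX) hk0
  refine ⟨C, hXC, hC.mono_right (le_of_not_ge fun hse => ?_)⟩
  have hkr := hcr.natCast_mul (k + 1)
  push_cast at hkr
  have hle := (hcs.natCast_mul k).mono hkr ((mul_le_mul_right hse _).trans hCe)
  linarith

theorem IsBorel.piecewiseLE_stLE (hX : N.IsBorel X) (hc : N.IsNonstandard c) (hr : 0 ≤ r)
    (hrX : ∀ s, r < s → N.floorMul c s ∉ innerCut X) : PiecewiseLE X (stLE c r) := by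
  rw [stLE_eq_iInter hc hr]
  refine piecewiseLE_iInter_Iio hX fun n => ?_
  obtain ⟨s, hrs, hs⟩ := exists_between
    (lt_add_of_pos_right r (by positivity : (0 : ℝ) < 1 / (n + 1)))
  exact hX.exists_cover_floorMul hc (hr.trans hrs.le) (hrX s hrs) hs

theorem stLT_piecewiseLE (hc : N.IsNonstandard c) (hrX : ∀ s < r, N.floorMul c s ∈ innerCut X) :
    PiecewiseLE (stLT c r) X := by
  refine piecewiseLE_of_subset_iUnion_Iio (isBorel_stLT hc r) ?_ (stLT_eq_iUnion hc r).subset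
    fun n => exists_hasCard_of_mem_innerCut (hrX _ (sub_lt_self r (by positivity)))
  exact fun m n hmn => floorMul_mono c (sub_le_sub_left (Nat.one_div_le_one_div hmn) r)

theorem exists_isCanonicalCut_of_not_isAdditive (hX : N.IsBorel X) (hinf : X.Infinite)
    (hadd : ¬ N.IsAdditive (innerCut X)) : ∃ W, IsCanonicalCut W ∧ PiecewiseEquiv X W := by
  obtain ⟨c, hcX, hccX⟩ := (isCut_innerCut X).exists_add_notMem hadd
  have hc : N.IsNonstandard c := by
    rintro n rfl
    exact hccX (Nat.cast_add (R := N.HNat) n n ▸ natCast_mem_innerCut hinf (n + n))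
  obtain ⟨r, hr, hlt, hgt⟩ := (isCut_innerCut X).exists_floorMul_mem_and_notMem hc hcX hccX
  refine ⟨N.realCut c r, Or.inr (Or.inr ⟨c, hc, r, hr, rfl⟩), ?_⟩
  rw [realCut_eq_stLT hc hr]
  exact ⟨(hX.piecewiseLE_stLE hc hr.le hgt).trans (stLE_piecewiseLE_stLT hc hr),
    stLT_piecewiseLE hc hlt⟩

end NotAdditive

theorem IsBorel.exists_isCanonicalCut {X : Set N.HNat} (hX : N.IsBorel X) :
    ∃ W, IsCanonicalCut W ∧ PiecewiseEquiv X W := by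
  rcases X.finite_or_infinite with hfin | hinf
  · exact exists_isCanonicalCut_of_finite hfin
  by_cases hadd : N.IsAdditive (innerCut X)
  · by_cases hcof : ∃ u : ℕ → N.HNat, (∀ n, u n ∈ innerCut X) ∧ ∀ x ∈ innerCut X, ∃ n, x ≤ u n
    · obtain ⟨u, hu, hcof⟩ := hcof
      obtain ⟨hW, hequiv⟩ := piecewiseEquiv_innerCut_of_cofinal hX hinf hadd hu hcof
      exact ⟨innerCut X, Or.inl ⟨⟨isCut_innerCut X, hW⟩, hadd⟩, hequiv⟩
    · push Not at hcof
      exact exists_isCanonicalCut_of_not_cofinal hX hinf hadd hcof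
  · exact exists_isCanonicalCut_of_not_isAdditive hX hinf hadd

end NonstandardUniverse

/-! ### Classification of Borel cardinalities -/

namespace NonstandardUniverse

variable {N : NonstandardUniverse.{u}}

theorem IsCut.subset_or_subset {U V : Set N.HNat} (hU : N.IsCut U) (hV : N.IsCut V) :
    U ⊆ V ∨ V ⊆ U := by
  by_contra! h
  obtain ⟨x, hx, hxV⟩ := Set.not_subset.1 h.1
  obtain ⟨y, hy, hyU⟩ := Set.not_subset.1 h.2
  rcases le_total x y with hxy | hxy
  · exact hxV (hV y hy x hxy)
  · exact hyU (hU x hx y hxy)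

theorem IsBorel.borelLE_of_subset {X Y : Set N.HNat} (hX : N.IsBorel X) (h : X ⊆ Y) :
    N.BorelLE X Y :=
  (hX.piecewiseLE_of_subset h).borelLE

theorem IsMinimalBorelCut.subset_of_borelLE {U V : Set N.HNat} (hU : N.IsMinimalBorelCut U)
    (hV : N.IsBorelCut V) (h : N.BorelLE U V) : U ⊆ V := by
  by_contra hUV
  have hVU := (hU.1.1.subset_or_subset hV.1).resolve_left hUV
  exact hU.2 V hV.1 ⟨hVU, hUV⟩ ⟨hV.2.borelLE_of_subset hVU, h⟩

theorem IsMinimalBorelCut.eq_of_borelEquiv {U V : Set N.HNat} (hU : N.IsMinimalBorelCut U)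
    (hV : N.IsMinimalBorelCut V) (h : N.BorelEquiv U V) : U = V :=
  (hU.subset_of_borelLE hV.1 h.1).antisymm (hV.subset_of_borelLE hU.1 h.2)

theorem IsMinimalBorelCut.borelLT {U V : Set N.HNat} (hU : N.IsMinimalBorelCut U)
    (hV : N.IsBorelCut V) (h : V ⊂ U) : N.BorelLT V U :=
  ⟨hV.2.borelLE_of_subset h.1, fun h' => h.2 (hU.subset_of_borelLE hV h')⟩

theorem BorelLT.exists_notMem {U V : Set N.HNat} (h : N.BorelLT V U) (hU : N.IsBorel U) :
    ∃ u ∈ U, u ∉ V :=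
  Set.not_subset.1 fun h' => h.2 (hU.borelLE_of_subset h')

theorem IsCanonicalCut.isMinimalBorelCut {W : Set N.HNat} (h : IsCanonicalCut W) :
    N.IsMinimalBorelCut W := by
  rcases h with ⟨hW, hadd⟩ | ⟨n, rfl⟩ | ⟨c, hc, r, hr, rfl⟩
  · exact isMinimalBorelCut_of_isAdditive hW hadd
  · exact isMinimalBorelCut_below_ofNat n
  · rw [realCut_eq_stLT hc hr]
    exact isMinimalBorelCut_stLT hc r

theorem IsBorel.exists_isMinimalBorelCut {X : Set N.HNat} (hX : N.IsBorel X) :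
    ∃ U, N.IsMinimalBorelCut U ∧ PiecewiseEquiv X U :=
  let ⟨U, hU, hXU⟩ := hX.exists_isCanonicalCut
  ⟨U, hU.isMinimalBorelCut, hXU⟩

theorem isMinimalBorelCut_iff_isCanonicalCut {U : Set N.HNat} :
    N.IsMinimalBorelCut U ↔ IsCanonicalCut U := by
  refine ⟨fun hU => ?_, IsCanonicalCut.isMinimalBorelCut⟩
  obtain ⟨W, hW, h, h'⟩ := hU.1.2.exists_isCanonicalCut
  rwa [hU.eq_of_borelEquiv hW.isMinimalBorelCut ⟨h.borelLE, h'.borelLE⟩]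

theorem IsBorel.borelLE_total {X Y : Set N.HNat} (hX : N.IsBorel X) (hY : N.IsBorel Y) :
    N.BorelLE X Y ∨ N.BorelLE Y X := by
  obtain ⟨U, ⟨⟨hU, hUB⟩, -⟩, hXU, hUX⟩ := hX.exists_isMinimalBorelCut
  obtain ⟨V, ⟨⟨hV, hVB⟩, -⟩, hYV, hVY⟩ := hY.exists_isMinimalBorelCut
  rcases hU.subset_or_subset hV with h | h
  · exact Or.inl (hXU.trans ((hUB.piecewiseLE_of_subset h).trans hVY)).borelLE
  · exact Or.inr (hYV.trans ((hVB.piecewiseLE_of_subset h).trans hUX)).borelLE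

/-! ### Minimal cuts between `c/ℕ` and `cℕ` -/

theorem isBorelCut_divNat (c : N.HNat) : N.IsBorelCut (N.divNat c) := by
  refine ⟨fun x hx y hy n => (mul_le_mul_right (α := N.HNat) hy n).trans (hx n), ?_⟩
  have hinter : N.divNat c = ⋂ n : ℕ, {x : N.HNat | n * x ≤ c} := Set.ofPred_forall _
  rw [hinter]
  refine .iInter fun n => ?_
  rcases n.eq_zero_or_pos with rfl | hn
  · simpa using isInternal_univ.isBorel
  · obtain ⟨q, hq⟩ := exists_forall_natCast_mul_le_iff c hn
    simp only [hq]
    exact (isInternal_Iic q).isBorel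

theorem isBorelCut_mulNat (c : N.HNat) : N.IsBorelCut (N.mulNat c) := by
  refine ⟨fun x ⟨n, hn⟩ y hy => ⟨n, le_trans (α := N.HNat) hy hn⟩, ?_⟩
  have hunion : N.mulNat c = ⋃ n : ℕ, Set.Iic ((n : N.HNat) * c) := Set.ofPred_exists _
  rw [hunion]
  exact .iUnion fun n => (isInternal_Iic _).isBorel

theorem isAdditive_mulNat (c : N.HNat) : N.IsAdditive (N.mulNat c) := by
  rintro x ⟨n, hn⟩ y ⟨m, hm⟩
  have hle : x + y ≤ ((n + m : ℕ) : N.HNat) * c := by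
    rw [Nat.cast_add, add_mul]
    exact add_le_add hn hm
  exact ⟨n + m, hle⟩

theorem isMinimalBorelCut_mulNat (c : N.HNat) : N.IsMinimalBorelCut (N.mulNat c) :=
  isMinimalBorelCut_of_isAdditive (isBorelCut_mulNat c) (isAdditive_mulNat c)

theorem IsAdditive.mulNat_subset {U : Set N.HNat} (hadd : N.IsAdditive U) (hU : N.IsCut U)
    {u : N.HNat} (hu : u ∈ U) : N.mulNat u ⊆ U := by
  have hmul : ∀ n : ℕ, (n : N.HNat) * u ∈ U := fun n => by
    induction n with
    | zero => simpa using hU u hu 0 (zero_le (a := u))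
    | succ n ih =>
      rw [Nat.cast_succ, add_mul, one_mul]
      exact hadd _ ih _ hu
  rintro x ⟨n, hn⟩
  exact hU _ (hmul n) x hn

theorem le_of_mem_divNat {c x : N.HNat} (h : x ∈ N.divNat c) : x ≤ c := by
  have hle : ((1 : ℕ) : N.HNat) * x ≤ c := h 1
  rwa [Nat.cast_one, one_mul] at hle

theorem divNat_ssubset {U : Set N.HNat} (hU : N.IsCut U) {c : N.HNat} (hc : c ∈ U)
    (hc0 : c ≠ 0) : N.divNat c ⊂ U := by
  refine ⟨fun x hx => hU c hc x (le_of_mem_divNat hx), fun h => ?_⟩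
  have hle : ((2 : ℕ) : N.HNat) * c ≤ c := h hc 2
  rw [Nat.cast_two, two_mul] at hle
  exact (lt_add_of_pos_right c (pos_iff_ne_zero.2 hc0)).not_ge hle

theorem IsMinimalBorelCut.exists_borelLT_and_borelLT {U : Set N.HNat}
    (hU : N.IsMinimalBorelCut U) (hadd : ¬ N.IsAdditive U) :
    ∃ c ∈ U, N.add c c ∉ U ∧ N.BorelLT (N.divNat c) U ∧ N.BorelLT U (N.mulNat c) := by
  obtain ⟨c, hc, hcc⟩ := hU.1.1.exists_add_notMem hadd
  have hc0 : c ≠ 0 := by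
    rintro rfl
    exact hcc ((add_zero (0 : N.HNat)).symm ▸ hc)
  have htwo : ((2 : ℕ) : N.HNat) * c = c + c := by rw [Nat.cast_two, two_mul]
  have hsub : U ⊆ N.mulNat c := fun x hx =>
    ⟨2, (le_of_not_ge fun h => hcc (hU.1.1 x hx _ h)).trans_eq htwo.symm⟩
  exact ⟨c, hc, hcc, hU.borelLT (isBorelCut_divNat c) (divNat_ssubset hU.1.1 hc hc0),
    (isMinimalBorelCut_mulNat c).borelLT hU.1 ⟨hsub, fun h => hcc (h ⟨2, htwo.ge⟩)⟩⟩

theorem divNat_ssubset_stLT {c : N.HNat} (hc : N.IsNonstandard c) {r : ℝ} (hr : 0 < r) :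
    N.divNat c ⊂ stLT c r := by
  have hself := isSt_self hc.ne_zero
  have st_nonpos : ∀ {x : N.HNat} {s : ℝ}, x ∈ N.divNat c → IsSt c x s → s ≤ 0 := by
    intro x s hx hs
    by_contra! h
    obtain ⟨n, hn⟩ := exists_nat_gt (1 / s)
    rw [div_lt_iff₀ h] at hn
    exact hn.not_ge ((hs.natCast_mul n).mono hself (hx n))
  refine ⟨fun x hx => ?_, fun h => ?_⟩
  · obtain ⟨s, -, hs⟩ := hself.exists_of_le hc.ne_zero (le_of_mem_divNat hx)
    exact ⟨s, (st_nonpos hx hs).trans_lt hr, hs⟩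
  · have hhalf := isSt_floorMul hc (half_pos hr).le
    exact (half_pos hr).not_ge (st_nonpos (h ⟨_, half_lt_self hr, hhalf⟩) hhalf)

theorem stLT_ssubset_mulNat {c : N.HNat} (hc : N.IsNonstandard c) (r : ℝ) :
    stLT c r ⊂ N.mulNat c := by
  obtain ⟨n, hn⟩ := exists_nat_gt r
  have hnc := (isSt_self hc.ne_zero).natCast_mul n
  rw [mul_one] at hnc
  refine ⟨?_, fun h => ?_⟩
  · rintro x ⟨s, hs, hx⟩
    exact ⟨n, (hx.lt hnc (hs.trans hn)).le⟩
  · obtain ⟨s, hs, hx⟩ := h ⟨n, le_refl ((n : N.HNat) * c)⟩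
    exact (hs.trans hn).ne (hx.unique hnc)

theorem le_of_stLT_subset_stLT {c : N.HNat} (hc : N.IsNonstandard c) {r s : ℝ} (hr : 0 ≤ r)
    (h : stLT c s ⊆ stLT c r) : s ≤ r := by
  by_contra! hrs
  have hcr := isSt_floorMul hc hr
  obtain ⟨q, hq, hcq⟩ := h ⟨r, hrs, hcr⟩
  exact hq.ne (hcq.unique hcr)

theorem realCut_injOn {c : N.HNat} (hc : N.IsNonstandard c) :
    Set.InjOn (N.realCut c) (Set.Ioi 0) := by
  intro r (hr : 0 < r) s (hs : 0 < s) h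
  rw [realCut_eq_stLT hc hr, realCut_eq_stLT hc hs] at h
  exact (le_of_stLT_subset_stLT hc hs.le h.subset).antisymm
    (le_of_stLT_subset_stLT hc hr.le h.superset)

theorem stLT_eq_stLT_of_isSt {c d : N.HNat} {p : ℝ} (hc : c ≠ 0) (hd : d ≠ 0) (hp : 0 < p)
    (h : IsSt d c p) (r : ℝ) : stLT d r = stLT c (r * p⁻¹) := by
  ext x
  constructor
  · rintro ⟨s, hs, hx⟩
    exact ⟨s * p⁻¹, by gcongr, (h.inv hp.ne').trans hd hx⟩
  · rintro ⟨s, hs, hx⟩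
    refine ⟨s * p, ?_, h.trans hc hx⟩
    rwa [← div_eq_mul_inv, lt_div_iff₀ hp] at hs

theorem exists_stLT_eq_stLT {c d u v : N.HNat} (hc : c ≠ 0) (hd : d ≠ 0) {r : ℝ} (hr : 0 < r)
    {n k : ℕ} (hu : u ∈ stLT d r) (hcu : c ≤ n * u) (hv : v ∉ stLT d r) (hvc : v ≤ k * c) :
    ∃ p : ℝ, 0 < p ∧ stLT d r = stLT c p := by
  obtain ⟨s, -, hs⟩ := hu
  obtain ⟨p, -, hp⟩ := (hs.natCast_mul n).exists_of_le hd hcu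
  have hp0 : 0 < p := by
    refine hp.nonneg.lt_of_ne ?_
    rintro rfl
    obtain ⟨q, hq, hvq⟩ := (hp.natCast_mul k).exists_of_le hd hvc
    rw [mul_zero] at hq
    exact hv ⟨q, hq.trans_lt hr, hvq⟩
  exact ⟨r * p⁻¹, by positivity, stLT_eq_stLT_of_isSt hc hd hp0 hp r⟩

theorem IsCanonicalCut.exists_eq_stLT {U : Set N.HNat} (hU : IsCanonicalCut U) {c : N.HNat}
    (hc : N.IsNonstandard c) (hlt : N.BorelLT (N.divNat c) U) (hgt : N.BorelLT U (N.mulNat c)) :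
    ∃ r : ℝ, 0 < r ∧ U = stLT c r := by
  have hUb := hU.isMinimalBorelCut.1
  obtain ⟨u, hu, huc⟩ := hlt.exists_notMem hUb.2
  obtain ⟨v, ⟨k, hvc⟩, hv⟩ := hgt.exists_notMem (isBorelCut_mulNat c).2
  obtain ⟨n, hn⟩ := not_forall.1 huc
  have hcu : c < n * u := lt_of_not_ge hn
  rcases hU with ⟨-, hadd⟩ | ⟨m, rfl⟩ | ⟨d, hd, r, hr, rfl⟩
  · have hcU := hadd.mulNat_subset hUb.1 hu ⟨n, hcu.le⟩
    exact absurd (hadd.mulNat_subset hUb.1 hcU ⟨k, hvc⟩) hv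
  · obtain ⟨j, -, rfl⟩ := exists_eq_natCast_of_lt (n := m) hu
    have hlt := hc.natCast_lt (n * j)
    rw [Nat.cast_mul] at hlt
    exact absurd hcu hlt.not_gt
  · rw [realCut_eq_stLT hd hr] at hu hv ⊢
    exact exists_stLT_eq_stLT hc.ne_zero hd.ne_zero hr hu hcu.le hv hvc

theorem isMinimalBorelCut_and_between_iff {c : N.HNat} (hc : N.IsNonstandard c)
    {U : Set N.HNat} :
    (N.IsMinimalBorelCut U ∧ N.BorelLT (N.divNat c) U ∧ N.BorelLT U (N.mulNat c)) ↔
      ∃ r : ℝ, 0 < r ∧ U = N.realCut c r := by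
  constructor
  · rintro ⟨hU, hlt, hgt⟩
    obtain ⟨r, hr, rfl⟩ := (isMinimalBorelCut_iff_isCanonicalCut.1 hU).exists_eq_stLT hc hlt hgt
    exact ⟨r, hr, (realCut_eq_stLT hc hr).symm⟩
  · rintro ⟨r, hr, rfl⟩
    rw [realCut_eq_stLT hc hr]
    have hmin := isMinimalBorelCut_stLT hc r
    exact ⟨hmin, hmin.borelLT (isBorelCut_divNat c) (divNat_ssubset_stLT hc hr),
      (isMinimalBorelCut_mulNat c).borelLT hmin.1 (stLT_ssubset_mulNat hc r)⟩

end NonstandardUniverse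

open NonstandardUniverse

theorem mainTheorem4 (N : NonstandardUniverse.{u}) :
    -- every Borel set admits a Borel bijection onto a Borel cut, and among the Borel cuts
    -- Borel equivalent to it there is a least one, the unique minimal Borel cut in its class
    (∀ X : Set N.HNat, N.IsBorel X →
      ∃ U : Set N.HNat, N.IsMinimalBorelCut U ∧ N.BorelEquiv X U ∧ N.BorelBijective X U ∧
        (∀ V, N.IsBorelCut V → N.BorelEquiv X V → U ⊆ V) ∧
        (∀ V, N.IsMinimalBorelCut V → N.BorelEquiv X V → V = U)) ∧
    -- any two Borel sets are comparable
    (∀ X Y : Set N.HNat, N.IsBorel X → N.IsBorel Y → N.BorelLE X Y ∨ N.BorelLE Y X) ∧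
    -- the list of all minimal Borel cuts
    (∀ U : Set N.HNat, N.IsMinimalBorelCut U ↔
      (N.IsBorelCut U ∧ N.IsAdditive U) ∨
      (∃ n : ℕ, U = N.below (N.ofNat n)) ∨
      (∃ c : N.HNat, N.IsNonstandard c ∧ ∃ r : ℝ, 0 < r ∧ U = N.realCut c r)) ∧
    -- a minimal Borel cut that is not additive lies between `c/ℕ` and `cℕ` for some `c`
    (∀ U : Set N.HNat, N.IsMinimalBorelCut U → ¬ N.IsAdditive U →
      ∃ c ∈ U, N.add c c ∉ U ∧ N.BorelLT (N.divNat c) U ∧ N.BorelLT U (N.mulNat c)) ∧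
    -- the minimal Borel cuts between `c/ℕ` and `cℕ`
    (∀ c : N.HNat, N.IsNonstandard c →
      (∀ U : Set N.HNat,
        (N.IsMinimalBorelCut U ∧ N.BorelLT (N.divNat c) U ∧ N.BorelLT U (N.mulNat c)) ↔
          ∃ r : ℝ, 0 < r ∧ U = N.realCut c r) ∧
      (∀ r s : ℝ, 0 < r → 0 < s → N.realCut c r = N.realCut c s → r = s)) := by
  refine ⟨fun X hX => ?_, fun X Y hX hY => hX.borelLE_total hY,
    fun U => isMinimalBorelCut_iff_isCanonicalCut,
    fun U hU hadd => hU.exists_borelLT_and_borelLT hadd,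
    fun c hc => ⟨fun U => isMinimalBorelCut_and_between_iff hc,
      fun r s hr hs h => realCut_injOn hc hr hs h⟩⟩
  obtain ⟨U, hU, hXU, hUX⟩ := hX.exists_isMinimalBorelCut
  have hleast : ∀ V, N.IsBorelCut V → N.BorelEquiv X V → U ⊆ V := fun V hV hXV =>
    hU.subset_of_borelLE hV (hUX.trans_borelLE hXV.1)
  have hunique : ∀ V, N.IsMinimalBorelCut V → N.BorelEquiv X V → V = U := fun V hV hXV =>
    (hV.subset_of_borelLE hU.1 (hXV.2.trans_piecewiseLE hXU)).antisymm (hleast V hV.1 hXV)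
  exact ⟨U, hU, ⟨hXU.borelLE, hUX.borelLE⟩, hXU.borelBijective hX hU.1.2 hUX, hleast, hunique⟩
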